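/- Let $\mathbb{R}_+=(0,\infty)$. Let $a,a_1,r:\mathbb{R}_+\to\mathbb{R}$ and $b:\mathbb{R}_+^2\to[0,\infty)$ be measurable functions such that: 1. $0\le a\in L_{\infty,loc}([0,\infty))$, and there are constants $a_0,\gamma_0,x_0>0$ with $a(x)\ge a_0x^{\gamma_0}$ for all $x\ge x_0$; 2. $1/r\in L_{1,loc}(\mathbb{R}_+)$ and $0<r(x)\le r_0+r_1x$ for all $x>0$, for some constants $r_0,r_1\ge 0$; 3. $0\le a_1\in L_{\infty,loc}([0,\infty))$ and $a_1(x)/a(x)$ remains bounded as $x\to\infty$; 4. $b(x,y)=0$ for $x>y$, and $\int_0^y x\,b(x,y)\,dx=y$ for every $y>0$; 5. writing $n_m(y)=\int_0^y b(x,y)x^m\,dx$ for $m\ge 0$, there are $b_0>0$ and $l\ge 0$ with $n_0(y)\le b_0(1+y^l)$ for all $y>0$, and there is $m_0>1$ with $\liminf_{y\to\infty}\bigl(y^{m_0}-n_{m_0}(y)\bigr)/y^{m_0}>0$. For $m>\max\{1,l\}$ let $X_{0,m}=L_1(\mathbb{R}_+,(1+x^m)\,dx)$, $q=a+a_1$,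 and let $D(G_{0,m})$ be the set of all $f\in X_{0,m}$ such that $rf$ is absolutely continuous on compact subintervals of $\mathbb{R}_+$, $\frac{d}{dx}(rf)\in X_{0,m}$, $qf\in X_{0,m}$ and, in the case when $1/r$ is integrable near $0$, also $r(x)f(x)\to 0$ as $x\to 0^+$. For $f\in D(G_{0,m})$ put $$(G_{0,m}f)(x)=-\frac{d}{dx}\bigl(r(x)f(x)\bigr)-q(x)f(x)+\int_x^\infty a(y)b(x,y)f(y)\,dy .$$ Then the following hold. (i) For every $m>\max\{1,l\}$ the operator $G_{0,m}$ with domain $D(G_{0,m})$ is the generator of a strongly continuous semigroup $(S_{G_{0,m}}(t))_{t\ge 0}$ on $X_{0,m}$. (ii) If $\max\{1,l\}<p<m$, then $S_{G_{0,p}}(t)$ maps $D(G_{0,p})$ into $D(G_{0,m})$ for every $t>0$. (iii) If $p,m>\max\{1,l\}$ and $\mathring f\in X_{0,m}\cap D(G_{0,p})$, then the growth--fragmentation problem $$\partial_t f(x,t)=-\partial_x[r(x)f(x,t)]-q(x)f(x,t)+\int_x^\infty a(y)b(x,y)f(y,t)\,dy,\qquad f(x,0)=\mathring f(x),$$ has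 a classical solution in $X_{0,m}$; that is, there is $f\in C([0,\infty),X_{0,m})\cap C^1((0,\infty),X_{0,m})$ with $f(0)=\mathring f$ and, for every $t>0$, $f(t)\in D(G_{0,m})$ and $f'(t)=G_{0,m}f(t)$ in $X_{0,m}$. -/

import Mathlib

open MeasureTheory Set Filter Topology

namespace GrowthFrag

noncomputable section

/-- Lebesgue measure on `(0, ∞)`. -/
abbrev posVol : Measure ℝ := volume.restrict (Ioi (0 : ℝ))

/-- The measure `w_m(x) dx` on `(0, ∞)`, where `w_m(x) = 1 + x ^ m`. -/
def weightMeasure (m : ℝ) : Measure ℝ :=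
  posVol.withDensity fun x => ENNReal.ofReal (1 + x ^ m)

/-- The Banach space `X_{0,m} = L₁((0, ∞), (1 + x ^ m) dx)`.  For different `m` its elements are
compared through equality almost everywhere on `(0, ∞)`. -/
abbrev X (m : ℝ) : Type := Lp ℝ 1 (weightMeasure m)

/-- `h` belongs to `L_{∞,loc}([0, ∞))`: it is measurable on `(0, ∞)` and essentially bounded on
each `(0, ρ]`, i.e. up to and including the end point `0`. -/
def MemLinftyLoc (h : ℝ → ℝ) : Prop :=
  AEMeasurable h posVol ∧
    ∀ ρ : ℝ, ∃ C : ℝ, ∀ᵐ x ∂(volume.restrict (Ioc (0 : ℝ) ρ)), |h x| ≤ C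

/-- `n_m(y) = ∫₀^y b(x, y) x ^ m dx`. -/
def fragMoment (b : ℝ → ℝ → ℝ) (m y : ℝ) : ℝ := ∫ x in Ioc (0 : ℝ) y, b x y * x ^ m

/-- `N_m(y) = y ^ m - n_m(y)`. -/
def fragDefect (b : ℝ → ℝ → ℝ) (m y : ℝ) : ℝ := y ^ m - fragMoment b m y

/-- `F` is the absolutely continuous version of the flux `r f` of an element `f` of `D(T_{0,m})`,
where `T_{0,m} f = -(r f)' - q f`.  The boundary condition is imposed only when `1 / r` is
integrable near `0` (for `1 / r` locally integrable on `(0, ∞)` the choice of the right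
neighbourhood `(0, 1)` of `0` is immaterial). -/
structure IsFlux (r q : ℝ → ℝ) (m : ℝ) (f : X m) (F : ℝ → ℝ) : Prop where
  ae_eq : ∀ᵐ x ∂posVol, F x = r x * f x
  absCont : ∀ x y : ℝ, 0 < x → x ≤ y → AbsolutelyContinuousOnInterval F x y
  deriv_mem : Integrable (deriv F) (weightMeasure m)
  absorb_mem : Integrable (fun x => q x * f x) (weightMeasure m)
  boundary : IntegrableOn (fun x => 1 / r x) (Ioo (0 : ℝ) 1) → Tendsto F (𝓝[>] 0) (𝓝 0)

/-- `D(G_{0,m}) = D(T_{0,m})`, with `q = a + a₁`. -/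
def domG (r a a₁ : ℝ → ℝ) (m : ℝ) : Set (X m) :=
  {f | ∃ F : ℝ → ℝ, IsFlux r (fun x => a x + a₁ x) m f F}

/-- The graph of `G_{0,m} = T_{0,m} + B_{0,m}` on `D(T_{0,m})`: `f ∈ D(T_{0,m})` and
`g = -(r f)' - (a + a₁) f + ∫_x^∞ a(y) b(x, y) f(y) dy`, the integral being absolutely convergent
for almost every `x > 0`. -/
def graphG (r a a₁ : ℝ → ℝ) (b : ℝ → ℝ → ℝ) (m : ℝ) (f g : X m) : Prop :=
  ∃ F : ℝ → ℝ, IsFlux r (fun x => a x + a₁ x) m f F ∧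
    (∀ᵐ x ∂posVol, IntegrableOn (fun y => a y * b x y * f y) (Ioi x)) ∧
    ∀ᵐ x ∂posVol,
      g x = -deriv F x - (a x + a₁ x) * f x + ∫ y in Ioi x, a y * b x y * f y

/-- Strongly continuous semigroup of bounded operators on `E`; only times `t ≥ 0` matter. -/
structure IsC0Semigroup {E : Type*} [NormedAddCommGroup E] [NormedSpace ℝ E]
    (S : ℝ → E →L[ℝ] E) : Prop where
  zero : S 0 = ContinuousLinearMap.id ℝ E
  add : ∀ s t : ℝ, 0 ≤ s → 0 ≤ t → S (s + t) = (S s).comp (S t)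
  strongCont : ∀ f : E, Tendsto (fun t => S t f) (𝓝[>] 0) (𝓝 f)

/-- The graph of the infinitesimal generator of `S`. -/
def graphGenerator {E : Type*} [NormedAddCommGroup E] [NormedSpace ℝ E]
    (S : ℝ → E →L[ℝ] E) (f g : E) : Prop :=
  Tendsto (fun h : ℝ => h⁻¹ • (S h f - f)) (𝓝[>] 0) (𝓝 g)

/-- `S` is the semigroup `S_{G_{0,m}}`: a strongly continuous semigroup on `X_{0,m}` whose
generator has domain `D(G_{0,m})` and coincides with `G_{0,m}` there. -/
structure IsSemigroupG (r a a₁ : ℝ → ℝ) (b : ℝ → ℝ → ℝ) (m : ℝ)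
    (S : ℝ → X m →L[ℝ] X m) : Prop where
  isC0 : IsC0Semigroup S
  dom_iff : ∀ f : X m, (∃ g : X m, graphGenerator S f g) ↔ f ∈ domG r a a₁ m
  graph_iff : ∀ f g : X m, graphGenerator S f g ↔ graphG r a a₁ b m f g

/-- `u` is a classical solution on `[0, ∞)` in `E` of `u' = A u` (`t > 0`), `u(0) = u₀`, where the
operator `A` is given by its graph: `u ∈ C([0, ∞), E) ∩ C¹((0, ∞), E)` and, for every `t > 0`,
`u(t) ∈ D(A)` and `u'(t) = A u(t)`. -/
structure IsClassicalSolution {E : Type*} [NormedAddCommGroup E] [NormedSpace ℝ E]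
    (A : E → E → Prop) (u₀ : E) (u : ℝ → E) : Prop where
  init : u 0 = u₀
  cont : ContinuousOn u (Ici 0)
  diff : ∀ t : ℝ, 0 < t → DifferentiableAt ℝ u t
  cont_deriv : ContinuousOn (deriv u) (Ioi 0)
  eqn : ∀ t : ℝ, 0 < t → A (u t) (deriv u t)

end

end GrowthFrag

/-! Write G = T + B, where T f = -(r f)' - q f is transport with absorption and B is the gain term.
Everything rests on comparing B with the absorption q f.

Generation. Put w(x) = 1 + x^m. Since r grows at most linearly, r w' ≤ C w, and testing (λ - T)u = h
against w · sign(u) gives (λ - C)‖u‖ + ‖q u‖ ≤ ‖h‖ (`TransportEq.estimate`). The resolvent of T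
itself comes from an integrating factor (`TransportCoeff.exists_solution`). For the gain term, ∫
w(x) b(x,y) dx = n_0(y) + n_m(y). The liminf hypothesis at the single exponent m₀, interpolated
against mass conservation, gives n_m(y) ≤ κ₀ y^m for large y with κ₀ < 1, for every m > 1; n_0 is of
lower order because l < m. Hence ‖B u‖ ≤ κ‖q u‖ + D‖u‖ with κ < 1 (`exists_fragBound`,
`fragOp_bound_of_absorb`). For large λ the operator B R(λ,T) has norm at most κ, so R(λ,G) = R(λ,T)
∑ (B R(λ,T))^n is positive and has range exactly D(T) (`exists_resolventG`). It also satisfies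
‖R(λ,G)‖ ≤ (λ - C - D)⁻¹, so Hille–Yosida produces a positive quasi-contractive semigroup on each
X_{0,m}.

Gain of moments. As q ≥ a ≥ a₀ x^γ₀ for large x, D(G_{0,m}) lies in X_{0,m+γ₀}. For f ≥ 0 the time
integral of s ↦ S(s)f over [0,t] belongs to the domain, hence has γ₀ extra moments; by positivity so
does S(s)f for almost every s in (0,t] (`exists_time_integrable`). The semigroups on different
spaces are restrictions of one another (`embed_semigroup`), so the extra moments persist at later
times, and iteration gives S(t) X_{0,p} ⊂ X_{0,m} for all m.

Domain and classical solutions. If f ∈ D(G_{0,p}), then S(t)f and G S(t)f = S(t)G f both lie in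
X_{0,m}; comparing the resolvents of G_{0,m} and G_{0,p} puts S(t)f in D(G_{0,m})
(`IsSemigroupG.exists_mem_domG`). An orbit that lies in the domain for all t > 0 is a classical
solution (`IsC0Semigroup.classicalSolution`). -/

namespace GrowthFrag

noncomputable section

/-! ### Strongly continuous semigroups -/

section Semigroup

variable {E F : Type*} [NormedAddCommGroup E] [NormedSpace ℝ E]
  [NormedAddCommGroup F] [NormedSpace ℝ F]

namespace IsC0Semigroup

variable {S : ℝ → E →L[ℝ] E}

theorem apply_add (hS : IsC0Semigroup S) {s t : ℝ} (hs : 0 ≤ s) (ht : 0 ≤ t) (f : E) :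
    S (s + t) f = S s (S t f) := by
  rw [hS.add s t hs ht]; rfl

theorem apply_zero (hS : IsC0Semigroup S) (f : E) : S 0 f = f := by
  rw [hS.zero]; rfl

/-- Otherwise norms exceed n at times t_n → 0, while each sequence S(t_n) f converges; this
contradicts the uniform boundedness principle. -/
theorem exists_bound_near_zero [CompleteSpace E] (hS : IsC0Semigroup S) :
    ∃ δ > 0, ∃ M : ℝ, ∀ t ∈ Icc (0 : ℝ) δ, ‖S t‖ ≤ M := by
  by_contra! hcon
  have hseq : ∀ n : ℕ, ∃ t ∈ Icc (0 : ℝ) (1 / (n + 1)), (n : ℝ) < ‖S t‖ := fun n =>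
    hcon (1 / (n + 1)) (by positivity) n
  choose t ht hlt using hseq
  have ht0 : Tendsto t atTop (𝓝 0) :=
    squeeze_zero (fun n => (ht n).1) (fun n => (ht n).2) tendsto_one_div_add_atTop_nhds_zero_nat
  have hptw : ∀ f, ∃ C, ∀ n, ‖S (t n) f‖ ≤ C := by
    intro f
    have hcont : Tendsto (fun s => S s f) (𝓝[≥] 0) (𝓝 f) := by
      rw [← Ioi_insert, nhdsWithin_insert, tendsto_sup]
      refine ⟨?_, hS.strongCont f⟩
      rw [tendsto_pure_left]
      intro s hs
      rw [hS.apply_zero]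
      exact mem_of_mem_nhds hs
    have htend : Tendsto (fun n => S (t n) f) atTop (𝓝 f) :=
      hcont.comp (tendsto_nhdsWithin_iff.2 ⟨ht0, Eventually.of_forall fun n => (ht n).1⟩)
    obtain ⟨C, hC⟩ := (htend.norm).bddAbove_range
    exact ⟨C, fun n => hC ⟨n, rfl⟩⟩
  obtain ⟨C, hC⟩ := banach_steinhaus hptw
  obtain ⟨n, hn⟩ := exists_nat_gt C
  exact absurd (hC n) (not_le.2 (hn.trans (hlt n)))

theorem exists_bound [CompleteSpace E] (hS : IsC0Semigroup S) (T : ℝ) :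
    ∃ M : ℝ, 0 ≤ M ∧ ∀ t ∈ Icc (0 : ℝ) T, ‖S t‖ ≤ M := by
  obtain ⟨δ, hδ, M, hM⟩ := hS.exists_bound_near_zero
  have key : ∀ n : ℕ, ∃ C : ℝ, 0 ≤ C ∧ ∀ t ∈ Icc (0 : ℝ) (n * δ), ‖S t‖ ≤ C := by
    intro n
    induction n with
    | zero =>
      refine ⟨‖S 0‖, norm_nonneg _, fun t ht => ?_⟩
      have : t = 0 := by simpa using ht
      rw [this]
    | succ n ih =>
      obtain ⟨C, hC0, hC⟩ := ih
      have hM0 : 0 ≤ M := (norm_nonneg _).trans (hM 0 ⟨le_rfl, hδ.le⟩)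
      refine ⟨C + C * M, by positivity, fun t ht => ?_⟩
      rcases le_total t (n * δ) with h | h
      · exact (hC t ⟨ht.1, h⟩).trans (le_add_of_nonneg_right (by positivity))
      · have hmem : t - n * δ ∈ Icc (0 : ℝ) δ := by
          have := ht.2
          push_cast at this
          exact ⟨by linarith, by linarith⟩
        have hsplit : S t = (S (n * δ)).comp (S (t - n * δ)) := by
          rw [← hS.add _ _ (by positivity) hmem.1]; congr 1; ring
        rw [hsplit]
        refine (ContinuousLinearMap.opNorm_comp_le _ _).trans ?_
        have h1 := hC (n * δ) ⟨by positivity, le_rfl⟩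
        have h2 := hM _ hmem
        have := mul_le_mul h1 h2 (norm_nonneg _) hC0
        linarith
  obtain ⟨n, hn⟩ := exists_nat_ge (T / δ)
  obtain ⟨C, hC0, hC⟩ := key n
  refine ⟨C, hC0, fun t ht => hC t ⟨ht.1, ht.2.trans ?_⟩⟩
  rwa [div_le_iff₀ hδ] at hn

theorem continuousOn_apply [CompleteSpace E] (hS : IsC0Semigroup S) (f : E) :
    ContinuousOn (fun t => S t f) (Ici 0) := by
  intro t ht
  obtain ⟨M, hM0, hM⟩ := hS.exists_bound (t + 1)
  have h0 : Tendsto (fun h => ‖S h f - f‖) (𝓝[≥] 0) (𝓝 0) := by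
    rw [← Ioi_insert, nhdsWithin_insert, tendsto_sup]
    constructor
    · rw [tendsto_pure_left]
      intro s hs
      rw [hS.apply_zero, sub_self, norm_zero]
      exact mem_of_mem_nhds hs
    · have := (hS.strongCont f).sub_const f
      simpa using this.norm
  -- The smaller of the two times is factored out, so continuity from both sides reduces to right
  -- continuity at 0 and a local bound on the norms.
  have hle : ∀ᶠ s in 𝓝[Ici 0] t, ‖S s f - S t f‖ ≤ M * ‖S |s - t| f - f‖ := by
    have hlt : ∀ᶠ s in 𝓝[Ici 0] t, s < t + 1 :=
      nhdsWithin_le_nhds (Iio_mem_nhds (by linarith))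
    filter_upwards [hlt, self_mem_nhdsWithin] with s hs hs0
    rw [mem_Ici] at hs0 ht
    rcases le_total t s with h | h
    · have : S s f - S t f = S t (S |s - t| f - f) := by
        rw [abs_of_nonneg (by linarith), map_sub, ← hS.apply_add ht (by linarith)]
        congr 3; ring
      rw [this]
      exact (ContinuousLinearMap.le_opNorm _ _).trans
        (mul_le_mul_of_nonneg_right (hM t ⟨ht, by linarith⟩) (norm_nonneg _))
    · have : S s f - S t f = - S s (S |s - t| f - f) := by
        rw [abs_of_nonpos (by linarith), map_sub, ← hS.apply_add hs0 (by linarith)]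
        rw [neg_sub]; congr 3; ring
      rw [this, norm_neg]
      exact (ContinuousLinearMap.le_opNorm _ _).trans
        (mul_le_mul_of_nonneg_right (hM s ⟨hs0, by linarith⟩) (norm_nonneg _))
  have habs : Tendsto (fun s => |s - t|) (𝓝[Ici 0] t) (𝓝[≥] 0) := by
    refine tendsto_nhdsWithin_iff.2 ⟨?_, Eventually.of_forall fun s => mem_Ici.2 (abs_nonneg _)⟩
    have : Tendsto (fun s => |s - t|) (𝓝 t) (𝓝 |t - t|) := by
      apply Continuous.tendsto; fun_prop
    rw [sub_self, abs_zero] at this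
    exact this.mono_left nhdsWithin_le_nhds
  have hlim := (h0.comp habs).const_mul M
  rw [mul_zero] at hlim
  exact tendsto_iff_norm_sub_tendsto_zero.2
    (squeeze_zero' (Eventually.of_forall fun _ => norm_nonneg _) hle hlim)

/-- A strongly continuous semigroup is jointly continuous along right-continuous curves. -/
theorem tendsto_apply [CompleteSpace E] (hS : IsC0Semigroup S) {α : Type*} {L : Filter α}
    {τ : α → ℝ} {v : α → E} {t : ℝ} {f : E} (ht : 0 ≤ t) (hτ : Tendsto τ L (𝓝 t))
    (hτ0 : ∀ᶠ x in L, 0 ≤ τ x) (hv : Tendsto v L (𝓝 f)) :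
    Tendsto (fun x => S (τ x) (v x)) L (𝓝 (S t f)) := by
  obtain ⟨M, hM0, hM⟩ := hS.exists_bound (t + 1)
  have h1 : Tendsto (fun x => S (τ x) f) L (𝓝 (S t f)) :=
    (hS.continuousOn_apply f t ht).tendsto.comp (tendsto_nhdsWithin_iff.2 ⟨hτ, hτ0⟩)
  have h2 : Tendsto (fun x => S (τ x) (v x - f)) L (𝓝 0) := by
    have hv' : Tendsto (fun x => M * ‖v x - f‖) L (𝓝 0) := by
      simpa using (tendsto_iff_norm_sub_tendsto_zero.1 hv).const_mul M
    refine squeeze_zero_norm' ?_ hv'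
    filter_upwards [hτ0, hτ.eventually (Iio_mem_nhds (show t < t + 1 by linarith))] with x h0 hx
    exact (ContinuousLinearMap.le_opNorm _ _).trans
      (mul_le_mul_of_nonneg_right (hM _ ⟨h0, le_of_lt hx⟩) (norm_nonneg _))
  have := h1.add h2
  simpa using this

theorem graphGenerator_apply (hS : IsC0Semigroup S) {f g : E} (h : graphGenerator S f g) {t : ℝ}
    (ht : 0 ≤ t) : graphGenerator S (S t f) (S t g) := by
  have := ((S t).continuous.tendsto g).comp h
  refine this.congr' ?_
  filter_upwards [self_mem_nhdsWithin] with s hs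
  simp only [Function.comp, map_smul, map_sub]
  rw [← hS.apply_add ht (le_of_lt hs), ← hS.apply_add (le_of_lt hs) ht, add_comm]

theorem hasDerivWithinAt_Ici (hS : IsC0Semigroup S) {f g : E}
    (h : graphGenerator S f g) {t : ℝ} (ht : 0 ≤ t) :
    HasDerivWithinAt (fun s => S s f) (S t g) (Ici t) t := by
  rw [← hasDerivWithinAt_Ioi_iff_Ici, hasDerivWithinAt_iff_tendsto_slope' (by simp)]
  have h1 := hS.graphGenerator_apply h ht
  have hshift : Tendsto (fun s => s - t) (𝓝[>] t) (𝓝[>] 0) := by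
    refine tendsto_nhdsWithin_iff.2 ⟨?_, ?_⟩
    · have : Tendsto (fun s => s - t) (𝓝 t) (𝓝 (t - t)) := by
        apply Continuous.tendsto; fun_prop
      rw [sub_self] at this
      exact this.mono_left nhdsWithin_le_nhds
    · filter_upwards [self_mem_nhdsWithin] with s hs
      exact mem_Ioi.2 (sub_pos.2 (mem_Ioi.1 hs))
  refine (h1.comp hshift).congr' ?_
  filter_upwards [self_mem_nhdsWithin] with s hs
  simp only [Function.comp, slope, vsub_eq_sub]
  rw [← hS.apply_add (sub_nonneg.2 (le_of_lt hs)) ht, sub_add_cancel]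

theorem intervalIntegrable_apply [CompleteSpace E] (hS : IsC0Semigroup S) (f : E) {s t : ℝ}
    (hs : 0 ≤ s) (ht : 0 ≤ t) : IntervalIntegrable (fun τ => S τ f) volume s t :=
  ((hS.continuousOn_apply f).mono fun _ hx => (le_min hs ht).trans hx.1).intervalIntegrable

theorem integral_apply_generator [CompleteSpace E] (hS : IsC0Semigroup S) {f g : E}
    (h : graphGenerator S f g) {t : ℝ} (ht : 0 ≤ t) :
    ∫ s in (0 : ℝ)..t, S s g = S t f - f := by
  rw [intervalIntegral.integral_eq_sub_of_hasDeriv_right (f := fun s => S s f), hS.apply_zero]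
  · exact (hS.continuousOn_apply f).mono fun x hx => by
      rw [uIcc_of_le ht] at hx; exact hx.1
  · intro x hx
    rw [min_eq_left ht] at hx
    exact (hS.hasDerivWithinAt_Ici h hx.1.le).mono Ioi_subset_Ici_self
  · exact hS.intervalIntegrable_apply g le_rfl ht

/-- The generator only controls right derivatives. The orbit is, however, f plus the integral of the
continuous function s ↦ S(s)g, so it is differentiable from both sides. -/
theorem hasDerivAt_apply [CompleteSpace E] (hS : IsC0Semigroup S) {f g : E}
    (h : graphGenerator S f g) {t : ℝ} (ht : 0 < t) :
    HasDerivAt (fun s => S s f) (S t g) t := by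
  have hc : ContinuousAt (fun s => S s g) t :=
    (hS.continuousOn_apply g).continuousAt (Ici_mem_nhds ht)
  have h1 : HasDerivAt (fun τ => ∫ s in (0 : ℝ)..τ, S s g) (S t g) t := by
    refine intervalIntegral.integral_hasDerivAt_right
      (hS.intervalIntegrable_apply g le_rfl ht.le) ?_ hc
    exact ContinuousOn.stronglyMeasurableAtFilter isOpen_Ioi
      ((hS.continuousOn_apply g).mono Ioi_subset_Ici_self) t ht
  refine (h1.add_const f).congr_of_eventuallyEq ?_
  filter_upwards [Ioi_mem_nhds ht] with s hs
  rw [hS.integral_apply_generator h (le_of_lt hs), sub_add_cancel]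

/-- The integral of an orbit belongs to the domain of the generator. -/
theorem graphGenerator_integral [CompleteSpace E] (hS : IsC0Semigroup S) (f : E) {t : ℝ}
    (ht : 0 ≤ t) : graphGenerator S (∫ s in (0 : ℝ)..t, S s f) (S t f - f) := by
  have hrew : ∀ h : ℝ, 0 < h → S h (∫ s in (0 : ℝ)..t, S s f) - ∫ s in (0 : ℝ)..t, S s f =
      (∫ s in t..(t + h), S s f) - ∫ s in (0 : ℝ)..h, S s f := by
    intro h hh
    have h1 : S h (∫ s in (0 : ℝ)..t, S s f) = ∫ s in h..(t + h), S s f := by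
      rw [← ContinuousLinearMap.intervalIntegral_comp_comm _
        (hS.intervalIntegrable_apply f le_rfl ht)]
      have := intervalIntegral.integral_comp_add_right (a := 0) (b := t) (fun s => S s f) h
      rw [zero_add] at this
      rw [← this]
      refine intervalIntegral.integral_congr fun s hs => ?_
      rw [uIcc_of_le ht] at hs
      rw [add_comm, hS.apply_add hh.le hs.1]
    rw [h1]
    have i1 := hS.intervalIntegrable_apply f le_rfl ht
    have i2 := hS.intervalIntegrable_apply f hh.le ht
    have i3 := hS.intervalIntegrable_apply f ht (add_nonneg ht hh.le)
    have i4 := hS.intervalIntegrable_apply f le_rfl hh.le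
    rw [← intervalIntegral.integral_add_adjacent_intervals i2 i3,
      ← intervalIntegral.integral_add_adjacent_intervals i4 i2]
    abel
  have hder : ∀ τ : ℝ, 0 ≤ τ →
      Tendsto (fun h : ℝ => h⁻¹ • ∫ s in τ..(τ + h), S s f) (𝓝[>] 0) (𝓝 (S τ f)) := by
    intro τ hτ
    have hw : HasDerivWithinAt (fun b => ∫ s in τ..b, S s f) (S τ f) (Ici τ) τ := by
      refine intervalIntegral.integral_hasDerivWithinAt_right (t := Ioi τ)
        (hS.intervalIntegrable_apply f hτ hτ) ?_ ?_
      · refine ⟨Ioi τ, self_mem_nhdsWithin, ?_⟩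
        exact ((hS.continuousOn_apply f).mono
          (Ioi_subset_Ici_self.trans (Ici_subset_Ici.2 hτ))).aestronglyMeasurable measurableSet_Ioi
      · exact (hS.continuousOn_apply f τ hτ).mono
          (Ioi_subset_Ici_self.trans (Ici_subset_Ici.2 hτ))
    rw [← hasDerivWithinAt_Ioi_iff_Ici, hasDerivWithinAt_iff_tendsto_slope' (by simp)] at hw
    have hshift : Tendsto (fun h => τ + h) (𝓝[>] 0) (𝓝[>] τ) := by
      refine tendsto_nhdsWithin_iff.2 ⟨?_, ?_⟩
      · have : Tendsto (fun h => τ + h) (𝓝 0) (𝓝 (τ + 0)) := by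
          apply Continuous.tendsto; fun_prop
        rw [add_zero] at this
        exact this.mono_left nhdsWithin_le_nhds
      · filter_upwards [self_mem_nhdsWithin] with s hs
        simpa using hs
    refine (hw.comp hshift).congr fun h => ?_
    simp [Function.comp, slope]
  have hfin := (hder t ht).sub (hder 0 le_rfl)
  rw [hS.apply_zero] at hfin
  refine hfin.congr' ?_
  filter_upwards [self_mem_nhdsWithin] with h hh
  rw [hrew h hh, smul_sub, zero_add]

/-- If a bounded operator intertwines the generators of two semigroups, then it intertwines the
semigroups. -/
theorem intertwine [CompleteSpace E] [CompleteSpace F] (hS : IsC0Semigroup S)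
    {S' : ℝ → F →L[ℝ] F} (hS' : IsC0Semigroup S') (ι : E →L[ℝ] F)
    (hι : ∀ f g, graphGenerator S f g → graphGenerator S' (ι f) (ι g))
    (hdense : Dense {f | ∃ g, graphGenerator S f g}) {t : ℝ} (ht : 0 ≤ t) (f : E) :
    ι (S t f) = S' t (ι f) := by
  have hclosed : IsClosed {f | ι (S t f) = S' t (ι f)} :=
    isClosed_eq (by fun_prop) (by fun_prop)
  refine hdense.induction (P := fun f => ι (S t f) = S' t (ι f)) ?_ hclosed f
  rintro f ⟨g, hfg⟩
  -- The function s ↦ S'(t - s) ι S(s) f joins S'(t) ι f at s = 0 to ι S(t) f at s = t. Its right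
  -- difference quotient at s is S'(t - x) applied to the difference of two quotients which both
  -- tend to ι S(s) g, so its right derivative vanishes.
  set φ : ℝ → F := fun s => S' (t - s) (ι (S s f)) with hφ
  have hcont : ContinuousOn φ (Icc 0 t) := by
    intro s hs
    refine hS'.tendsto_apply (sub_nonneg.2 hs.2) ?_ ?_ ?_
    · have : Tendsto (fun x => t - x) (𝓝 s) (𝓝 (t - s)) := by
        apply Continuous.tendsto; fun_prop
      exact this.mono_left nhdsWithin_le_nhds
    · filter_upwards [self_mem_nhdsWithin] with x hx
      exact sub_nonneg.2 hx.2
    · exact (ι.continuous.tendsto _).comp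
        (((hS.continuousOn_apply f).mono fun _ hx => hx.1) s hs)
  have hderiv : ∀ s ∈ Ico 0 t, HasDerivWithinAt φ 0 (Ici s) s := by
    intro s hs
    rw [← hasDerivWithinAt_Ioi_iff_Ici, hasDerivWithinAt_iff_tendsto_slope' (by simp)]
    have h1 : Tendsto (fun x => ι ((x - s)⁻¹ • (S x f - S s f))) (𝓝[>] s) (𝓝 (ι (S s g))) := by
      have := hS.hasDerivWithinAt_Ici hfg hs.1
      rw [← hasDerivWithinAt_Ioi_iff_Ici, hasDerivWithinAt_iff_tendsto_slope' (by simp)] at this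
      exact (ι.continuous.tendsto _).comp this
    have hshift : Tendsto (fun x => x - s) (𝓝[>] s) (𝓝[>] 0) := by
      refine tendsto_nhdsWithin_iff.2 ⟨?_, ?_⟩
      · have : Tendsto (fun x => x - s) (𝓝 s) (𝓝 (s - s)) := by
          apply Continuous.tendsto; fun_prop
        rw [sub_self] at this
        exact this.mono_left nhdsWithin_le_nhds
      · filter_upwards [self_mem_nhdsWithin] with x hx
        exact mem_Ioi.2 (sub_pos.2 (mem_Ioi.1 hx))
    have h2 : Tendsto (fun x => (x - s)⁻¹ • (S' (x - s) (ι (S s f)) - ι (S s f))) (𝓝[>] s)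
        (𝓝 (ι (S s g))) := (hι _ _ (hS.graphGenerator_apply hfg hs.1)).comp hshift
    have h3 := h1.sub h2
    rw [sub_self] at h3
    have hlt : ∀ᶠ x in 𝓝[>] s, x < t := nhdsWithin_le_nhds (Iio_mem_nhds hs.2)
    have h4 := hS'.tendsto_apply (L := 𝓝[>] s) (τ := fun x => t - x) (t := t - s)
      (sub_nonneg.2 hs.2.le) ?_ ?_ h3
    · rw [map_zero] at h4
      refine h4.congr' ?_
      filter_upwards [hlt, self_mem_nhdsWithin] with x hx hxs
      have hxs' : 0 ≤ x - s := sub_nonneg.2 (le_of_lt hxs)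
      simp only [hφ, slope, vsub_eq_sub]
      have : S' (t - s) (ι (S s f)) = S' (t - x) (S' (x - s) (ι (S s f))) := by
        rw [← hS'.apply_add (sub_nonneg.2 hx.le) hxs']; congr 2; ring
      rw [this, map_smul, ← smul_sub, map_smul, ← map_sub, map_sub ι]
      congr 2
      abel
    · have : Tendsto (fun x => t - x) (𝓝 s) (𝓝 (t - s)) := by
        apply Continuous.tendsto; fun_prop
      exact this.mono_left nhdsWithin_le_nhds
    · filter_upwards [hlt] with x hx
      exact sub_nonneg.2 hx.le
  have := constant_of_has_deriv_right_zero hcont hderiv t ⟨ht, le_rfl⟩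
  simpa [hφ, hS'.apply_zero, hS.apply_zero] using this

end IsC0Semigroup

end Semigroup


/-! ### The Hille–Yosida theorem -/

section HilleYosida

variable {E : Type*} [NormedAddCommGroup E] [NormedSpace ℝ E] [CompleteSpace E]

theorem norm_exp_le_exp_norm (K : E →L[ℝ] E) : ‖NormedSpace.exp K‖ ≤ Real.exp ‖K‖ := by
  have h1 := NormedSpace.exp_series_hasSum_exp' (𝕂 := ℝ) K
  have h2 := NormedSpace.exp_series_hasSum_exp' (𝕂 := ℝ) ‖K‖
  rw [← Real.exp_eq_exp_ℝ] at h2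
  refine h1.norm_le_of_bounded h2 fun n => ?_
  rw [norm_smul, norm_inv, Real.norm_natCast, smul_eq_mul]
  gcongr
  rcases n with _ | n
  · rw [pow_zero, pow_zero]; exact ContinuousLinearMap.norm_id_le
  · exact norm_pow_le' K n.succ_pos

/-- A closed convex cone preserved by `K` is preserved by `exp K`. -/
theorem exp_apply_mem {K : E →L[ℝ] E} {P : Set E} (hclosed : IsClosed P) (hzero : (0 : E) ∈ P)
    (hadd : ∀ f ∈ P, ∀ g ∈ P, f + g ∈ P) (hsmul : ∀ c : ℝ, 0 ≤ c → ∀ f ∈ P, c • f ∈ P)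
    (hK : ∀ f ∈ P, K f ∈ P) {f : E} (hf : f ∈ P) : NormedSpace.exp K f ∈ P := by
  have h1 := (NormedSpace.exp_series_hasSum_exp' (𝕂 := ℝ) K).mapL
    (ContinuousLinearMap.apply ℝ E f)
  refine hclosed.mem_of_tendsto h1 (Eventually.of_forall fun s => ?_)
  refine Finset.sum_induction _ (· ∈ P) (fun a b ha hb => hadd a ha b hb) hzero fun n hn => ?_
  simp only [ContinuousLinearMap.apply_apply, smul_apply]
  refine hsmul _ (by positivity) _ ?_
  clear hn
  induction n with
  | zero => simpa using hf
  | succ n ih => rw [pow_succ']; exact hK _ ih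

/-- The Yosida approximation `λ (λ R - 1)`. -/
def yosida (R : E →L[ℝ] E) (lam : ℝ) : E →L[ℝ] E := (lam ^ 2) • R - lam • 1

/-- The semigroup generated by the Yosida approximation. -/
def yosidaExp (R : E →L[ℝ] E) (lam t : ℝ) : E →L[ℝ] E := NormedSpace.exp (t • yosida R lam)

/-- Splitting off the scalar -tλ leaves the exponential of a nonnegative multiple of R. This is what
gives the contraction bound and the invariance of cones, neither of which is visible on λ²R - λ. -/
theorem yosidaExp_eq (R : E →L[ℝ] E) (lam t : ℝ) :
    yosidaExp R lam t = Real.exp (-(t * lam)) • NormedSpace.exp ((t * lam ^ 2) • R) := by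
  have hsplit : t • yosida R lam
      = (algebraMap ℝ (E →L[ℝ] E)) (-(t * lam)) + (t * lam ^ 2) • R := by
    rw [yosida, Algebra.algebraMap_eq_smul_one, smul_sub, smul_smul, smul_smul, neg_smul]
    abel
  let : NormedAlgebra ℚ (E →L[ℝ] E) := .restrictScalars ℚ ℝ _
  rw [yosidaExp, hsplit, NormedSpace.exp_add_of_commute (Algebra.commutes _ _),
    ← NormedSpace.algebraMap_exp_comm, ← Real.exp_eq_exp_ℝ, ← Algebra.smul_def]

theorem norm_yosidaExp_le {R : E →L[ℝ] E} {lam t : ℝ} (hlam : 0 < lam) (hR : ‖R‖ ≤ lam⁻¹)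
    (ht : 0 ≤ t) : ‖yosidaExp R lam t‖ ≤ 1 := by
  rw [yosidaExp_eq, norm_smul, Real.norm_eq_abs, abs_of_pos (Real.exp_pos _)]
  have h1 : ‖(t * lam ^ 2) • R‖ ≤ t * lam := by
    rw [norm_smul, Real.norm_eq_abs, abs_of_nonneg (by positivity)]
    calc t * lam ^ 2 * ‖R‖ ≤ t * lam ^ 2 * lam⁻¹ := by gcongr
      _ = t * lam := by field_simp
  calc _ ≤ Real.exp (-(t * lam)) * Real.exp (t * lam) := by
        gcongr
        exact (norm_exp_le_exp_norm _).trans (Real.exp_le_exp.2 h1)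
    _ = 1 := by rw [← Real.exp_add]; simp

theorem norm_yosidaExp_apply_le {R : E →L[ℝ] E} {lam t : ℝ} (hlam : 0 < lam)
    (hR : ‖R‖ ≤ lam⁻¹) (ht : 0 ≤ t) (f : E) : ‖yosidaExp R lam t f‖ ≤ ‖f‖ := by
  simpa using (yosidaExp R lam t).le_of_opNorm_le (norm_yosidaExp_le hlam hR ht) f

theorem hasDerivAt_yosidaExp (R : E →L[ℝ] E) (lam t : ℝ) :
    HasDerivAt (yosidaExp R lam) (yosidaExp R lam t * yosida R lam) t :=
  hasDerivAt_exp_smul_const (yosida R lam) t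

theorem yosidaExp_add (R : E →L[ℝ] E) (lam s t : ℝ) :
    yosidaExp R lam (s + t) = yosidaExp R lam s * yosidaExp R lam t := by
  let : NormedAlgebra ℚ (E →L[ℝ] E) := .restrictScalars ℚ ℝ _
  rw [yosidaExp, add_smul, NormedSpace.exp_add_of_commute]
  · rfl
  · exact ((Commute.refl _).smul_left s).smul_right t

/-- Since the approximations commute, s ↦ e^{sA_λ} e^{(t-s)A_μ} f has derivative e^{sA_λ}
e^{(t-s)A_μ}(A_λ - A_μ) f, and the exponentials are contractions. Convergence of the Yosida
approximations on the domain thus passes to their semigroups. -/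
theorem norm_yosidaExp_sub_le {R R' : E →L[ℝ] E} {lam mu : ℝ} (hlam : 0 < lam) (hmu : 0 < mu)
    (hR : ‖R‖ ≤ lam⁻¹) (hR' : ‖R'‖ ≤ mu⁻¹) (hcomm : Commute R R') {t : ℝ} (ht : 0 ≤ t) (f : E) :
    ‖yosidaExp R lam t f - yosidaExp R' mu t f‖ ≤ t * ‖yosida R lam f - yosida R' mu f‖ := by
  have hcomm' : Commute (yosida R lam) (yosida R' mu) := by
    unfold yosida
    refine Commute.sub_left (Commute.sub_right ?_ ?_) (Commute.sub_right ?_ ?_)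
    · exact (hcomm.smul_left _).smul_right _
    · exact ((Commute.one_right _).smul_left _).smul_right _
    · exact ((Commute.one_left _).smul_left _).smul_right _
    · exact ((Commute.one_left _).smul_left _).smul_right _
  have hce : ∀ s, Commute (yosida R lam) (yosidaExp R' mu s) := fun s =>
    (hcomm'.smul_right s).exp_right
  set φ : ℝ → E := fun s => yosidaExp R lam s (yosidaExp R' mu (t - s) f) with hφ
  have hder : ∀ s, HasDerivAt φ
      (yosidaExp R lam s (yosidaExp R' mu (t - s) (yosida R lam f - yosida R' mu f))) s := by
    intro s
    have h1 := hasDerivAt_yosidaExp R lam s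
    have h2 : HasDerivAt (fun s => yosidaExp R' mu (t - s))
        (-(yosidaExp R' mu (t - s) * yosida R' mu)) s := by
      have := (hasDerivAt_yosidaExp R' mu (t - s)).scomp s ((hasDerivAt_id s).const_sub t)
      rw [neg_smul, one_smul] at this
      exact this
    have h3 := (h1.mul h2).clm_apply (hasDerivAt_const s f)
    refine h3.congr_deriv ?_
    have h4 := congrArg (fun K : E →L[ℝ] E => K f) (hce (t - s)).eq
    simp only [mul_apply_eq_comp] at h4
    simp [h4]
    abel
  have hbound := (convex_Icc (0 : ℝ) t).norm_image_sub_le_of_norm_hasDerivWithin_le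
    (f := φ) (C := ‖yosida R lam f - yosida R' mu f‖)
    (fun s _ => (hder s).hasDerivWithinAt) (fun s hs =>
      (norm_yosidaExp_apply_le hlam hR hs.1 _).trans
        (norm_yosidaExp_apply_le hmu hR' (sub_nonneg.2 hs.2) _))
    (left_mem_Icc.2 ht) (right_mem_Icc.2 ht)
  have h0 : ∀ (K : E →L[ℝ] E) (c : ℝ), yosidaExp K c 0 = 1 := by simp [yosidaExp]
  simp only [hφ, sub_self, sub_zero, h0, one_apply_eq_self, Real.norm_eq_abs,
    abs_of_nonneg ht] at hbound
  rw [mul_comm]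
  exact hbound

theorem norm_yosidaExp_sub_self_le {R : E →L[ℝ] E} {lam : ℝ} (hlam : 0 < lam)
    (hR : ‖R‖ ≤ lam⁻¹) {t : ℝ} (ht : 0 ≤ t) (f : E) :
    ‖yosidaExp R lam t f - f‖ ≤ t * ‖yosida R lam f‖ := by
  have hbound := (convex_Icc (0 : ℝ) t).norm_image_sub_le_of_norm_hasDerivWithin_le
    (f := fun s => yosidaExp R lam s f) (C := ‖yosida R lam f‖)
    (fun s _ => ((hasDerivAt_yosidaExp R lam s).clm_apply
      (hasDerivAt_const s f)).hasDerivWithinAt) (fun s hs => by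
      simpa using norm_yosidaExp_apply_le hlam hR hs.1 (yosida R lam f))
    (left_mem_Icc.2 ht) (right_mem_Icc.2 ht)
  have h0 : yosidaExp R lam 0 = 1 := by simp [yosidaExp]
  simp only [sub_zero, h0, one_apply_eq_self, Real.norm_eq_abs,
    abs_of_nonneg ht] at hbound
  rw [mul_comm]
  exact hbound

/-- Used to differentiate the limit semigroup at 0 with g = A f. As g need not lie in the domain,
A_λ g need not stay bounded in λ; the auxiliary h is a domain element close to g, and only A_λ h
enters the estimate. -/
theorem norm_yosidaExp_sub_sub_le {R : E →L[ℝ] E} {lam : ℝ} (hlam : 0 < lam)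
    (hR : ‖R‖ ≤ lam⁻¹) {t : ℝ} (ht : 0 ≤ t) (f g h : E) :
    ‖yosidaExp R lam t f - f - t • g‖ ≤
      t * (‖yosida R lam f - g‖ + 2 * ‖g - h‖ + t * ‖yosida R lam h‖) := by
  have hder : ∀ s, HasDerivAt (fun s => yosidaExp R lam s f - s • g)
      (yosidaExp R lam s (yosida R lam f) - g) s := by
    intro s
    have h1 := ((hasDerivAt_yosidaExp R lam s).clm_apply (hasDerivAt_const s f)).sub
      ((hasDerivAt_id s).smul_const g)
    refine h1.congr_deriv ?_
    simp
  have hbound := (convex_Icc (0 : ℝ) t).norm_image_sub_le_of_norm_hasDerivWithin_le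
    (C := ‖yosida R lam f - g‖ + 2 * ‖g - h‖ + t * ‖yosida R lam h‖)
    (fun s _ => (hder s).hasDerivWithinAt) (fun s hs => ?_)
    (left_mem_Icc.2 ht) (right_mem_Icc.2 ht)
  · have h0 : yosidaExp R lam 0 = 1 := by simp [yosidaExp]
    simp only [sub_zero, h0, one_apply_eq_self, Real.norm_eq_abs,
      abs_of_nonneg ht, zero_smul] at hbound
    rw [mul_comm, sub_right_comm]
    exact hbound
  · have hsplit : yosidaExp R lam s (yosida R lam f) - g =
        yosidaExp R lam s (yosida R lam f - g) + yosidaExp R lam s (g - h)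
          + (yosidaExp R lam s h - h) + (h - g) := by
      simp only [map_sub]; abel
    rw [hsplit]
    have e1 := norm_yosidaExp_apply_le hlam hR hs.1 (yosida R lam f - g)
    have e2 := norm_yosidaExp_apply_le hlam hR hs.1 (g - h)
    have e3 := norm_yosidaExp_sub_self_le hlam hR hs.1 h
    have e4 : s * ‖yosida R lam h‖ ≤ t * ‖yosida R lam h‖ :=
      mul_le_mul_of_nonneg_right hs.2 (norm_nonneg _)
    have e5 := norm_sub_rev h g
    refine (norm_add₄_le).trans ?_
    linarith

/-- **Hille–Yosida theorem**, contraction case.  The operator is given by its graph `A`, and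
`R lam` is its resolvent. -/
theorem hilleYosida_contraction (A : E → E → Prop) (lam₀ : ℝ) (hlam₀ : 0 ≤ lam₀)
    (R : ℝ → E →L[ℝ] E)
    (hR : ∀ lam, lam₀ < lam → ∀ f g, A f g ↔ R lam (lam • f - g) = f)
    (hnorm : ∀ lam, lam₀ < lam → ‖R lam‖ ≤ lam⁻¹)
    (hdense : Dense {f | ∃ g, A f g}) :
    ∃ S : ℝ → E →L[ℝ] E, IsC0Semigroup S ∧ (∀ f g, graphGenerator S f g ↔ A f g) ∧
      ∀ P : Set E, IsClosed P → (0 : E) ∈ P → (∀ f ∈ P, ∀ g ∈ P, f + g ∈ P) →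
        (∀ c : ℝ, 0 ≤ c → ∀ f ∈ P, c • f ∈ P) → (∀ lam, lam₀ < lam → ∀ f ∈ P, R lam f ∈ P) →
        ∀ t, 0 ≤ t → ∀ f ∈ P, S t f ∈ P := by
  -- resolvent identity
  have hA : ∀ lam, lam₀ < lam → ∀ h, A (R lam h) (lam • R lam h - h) := by
    intro lam hl h
    rw [hR lam hl]; congr 1; abel
  have hres : ∀ lam mu, lam₀ < lam → lam₀ < mu → ∀ h,
      R lam h = R mu h + (mu - lam) • R mu (R lam h) := by
    intro lam mu hl hm h
    have := (hR mu hm _ _).1 (hA lam hl h)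
    have h2 : mu • R lam h - (lam • R lam h - h) = h + (mu - lam) • R lam h := by
      rw [sub_smul]; abel
    rw [h2, map_add, map_smul] at this
    exact this.symm
  have hcomm : ∀ lam mu, lam₀ < lam → lam₀ < mu → Commute (R lam) (R mu) := by
    intro lam mu hl hm
    rcases eq_or_ne lam mu with rfl | hne
    · exact Commute.refl _
    ext h
    simp only [mul_apply_eq_comp]
    have e1 := hres lam mu hl hm h
    have e2 := hres mu lam hm hl h
    have e3 : (mu - lam) • (R mu (R lam h) - R lam (R mu h)) = 0 := by
      have e4 : (mu - lam) • R mu (R lam h) = R lam h - R mu h := by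
        rw [eq_sub_iff_add_eq, add_comm]; exact e1.symm
      have e5 : (lam - mu) • R lam (R mu h) = R mu h - R lam h := by
        rw [eq_sub_iff_add_eq, add_comm]; exact e2.symm
      have e6 : (mu - lam) • R lam (R mu h) = R lam h - R mu h := by
        rw [← neg_sub lam mu, neg_smul, e5, neg_sub]
      rw [smul_sub, e4, e6, sub_self]
    rcases smul_eq_zero.1 e3 with h0 | h0
    · exact absurd (sub_eq_zero.1 h0).symm hne
    · exact (sub_eq_zero.1 h0).symm
  -- the sequence of parameters
  set ν : ℕ → ℝ := fun n => lam₀ + 1 + n with hν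
  have hνlt : ∀ n, lam₀ < ν n := fun n => by
    have : (0 : ℝ) ≤ n := n.cast_nonneg
    simp only [hν]; linarith
  have hνpos : ∀ n, 0 < ν n := fun n => hlam₀.trans_lt (hνlt n)
  have hνtop : Tendsto ν atTop atTop :=
    tendsto_atTop_add_const_left _ _ tendsto_natCast_atTop_atTop
  have hnν : ∀ n, ‖R (ν n)‖ ≤ (ν n)⁻¹ := fun n => hnorm _ (hνlt n)
  have hcontr : ∀ n (f : E), ‖ν n • R (ν n) f‖ ≤ ‖f‖ := by
    intro n f
    rw [norm_smul, Real.norm_eq_abs, abs_of_pos (hνpos n)]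
    have h1 := (R (ν n)).le_of_opNorm_le (hnν n) f
    calc ν n * ‖R (ν n) f‖ ≤ ν n * ((ν n)⁻¹ * ‖f‖) :=
          mul_le_mul_of_nonneg_left h1 (hνpos n).le
      _ = ‖f‖ := by rw [← mul_assoc, mul_inv_cancel₀ (hνpos n).ne', one_mul]
  have hyos : ∀ n f g, A f g → yosida (R (ν n)) (ν n) f = ν n • R (ν n) g := by
    intro n f g hfg
    have h1 := (hR _ (hνlt n) _ _).1 hfg
    rw [map_sub, map_smul] at h1
    have h2 : ν n • R (ν n) f - f = R (ν n) g := by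
      rw [sub_eq_iff_eq_add, ← sub_eq_iff_eq_add']; exact h1
    simp only [yosida, sub_apply, smul_apply,
      one_apply_eq_self]
    rw [pow_two, mul_smul, ← smul_sub, h2]
  -- a density principle
  have hdens : ∀ (T : ℕ → E →L[ℝ] E) (_ : ∀ n f, ‖T n f‖ ≤ ‖f‖)
      (_ : ∀ f g, A f g → CauchySeq fun n => T n f), ∀ f, CauchySeq fun n => T n f := by
    intro T hT hTd f
    rw [Metric.cauchySeq_iff']
    intro ε hε
    obtain ⟨f', ⟨g', hfg'⟩, hf'⟩ := hdense.exists_dist_lt f (show 0 < ε / 3 by positivity)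
    obtain ⟨N, hN⟩ := Metric.cauchySeq_iff'.1 (hTd f' g' hfg') (ε / 3) (by positivity)
    refine ⟨N, fun n hn => ?_⟩
    have h1 : ∀ k, dist (T k f) (T k f') < ε / 3 := fun k => by
      rw [dist_eq_norm, ← map_sub]
      exact (hT k _).trans_lt (by rwa [← dist_eq_norm])
    have h2 := hN n hn
    have h3 := h1 N
    have h4 := h1 n
    rw [dist_comm] at h3
    calc dist (T n f) (T N f) ≤ dist (T n f) (T n f') + dist (T n f') (T N f')
          + dist (T N f') (T N f) := dist_triangle4 _ _ _ _
      _ < ε := by linarith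
  have hRlim : ∀ f, Tendsto (fun n => ν n • R (ν n) f) atTop (𝓝 f) := by
    intro f
    rw [Metric.tendsto_atTop]
    intro ε hε
    obtain ⟨f', ⟨g', hfg'⟩, hf'⟩ := hdense.exists_dist_lt f (show 0 < ε / 3 by positivity)
    have h0 : Tendsto (fun n => (ν n)⁻¹ * ‖g'‖) atTop (𝓝 0) := by
      simpa using (hνtop.inv_tendsto_atTop).mul_const ‖g'‖
    obtain ⟨N, hN⟩ := eventually_atTop.1
      (h0.eventually (Iio_mem_nhds (show 0 < ε / 3 by positivity)))
    refine ⟨N, fun n hn => ?_⟩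
    have h1 := (hR _ (hνlt n) _ _).1 hfg'
    rw [map_sub, map_smul] at h1
    have h2 : ν n • R (ν n) f' - f' = R (ν n) g' := by
      rw [sub_eq_iff_eq_add, ← sub_eq_iff_eq_add']; exact h1
    have h3 : ‖ν n • R (ν n) f' - f'‖ < ε / 3 := by
      rw [h2]
      exact ((R (ν n)).le_of_opNorm_le (hnν n) g').trans_lt (hN n hn)
    have h4 := hcontr n (f - f')
    rw [dist_eq_norm] at hf' ⊢
    have h5 : ν n • R (ν n) f - f = ν n • R (ν n) (f - f') + (ν n • R (ν n) f' - f')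
        - (f - f') := by
      rw [map_sub, smul_sub]; abel
    rw [h5]
    refine (norm_sub_le _ _).trans_lt ?_
    have := norm_add_le (ν n • R (ν n) (f - f')) (ν n • R (ν n) f' - f')
    linarith
  have hyoslim : ∀ f g, A f g → Tendsto (fun n => yosida (R (ν n)) (ν n) f) atTop (𝓝 g) := by
    intro f g hfg
    exact (hRlim g).congr fun n => (hyos n f g hfg).symm
  set T : ℕ → ℝ → E →L[ℝ] E := fun n t => yosidaExp (R (ν n)) (ν n) t with hT
  have hTc : ∀ n t, 0 ≤ t → ∀ f, ‖T n t f‖ ≤ ‖f‖ := fun n t ht f =>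
    norm_yosidaExp_apply_le (hνpos n) (hnν n) ht f
  have hcau : ∀ t, 0 ≤ t → ∀ f, CauchySeq fun n => T n t f := by
    intro t ht
    refine hdens (fun n => T n t) (fun n f => hTc n t ht f) ?_
    intro f g hfg
    have h1 := (hyoslim f g hfg).cauchySeq
    rw [Metric.cauchySeq_iff] at h1 ⊢
    intro ε hε
    obtain ⟨N, hN⟩ := h1 (ε / (t + 1)) (by positivity)
    refine ⟨N, fun m hm n hn => ?_⟩
    have h2 := hN m hm n hn
    rw [dist_eq_norm] at h2 ⊢
    have h3 := norm_yosidaExp_sub_le (hνpos m) (hνpos n) (hnν m) (hnν n)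
      (hcomm _ _ (hνlt m) (hνlt n)) ht f
    rw [lt_div_iff₀ (by positivity)] at h2
    have h4 := norm_nonneg (yosida (R (ν m)) (ν m) f - yosida (R (ν n)) (ν n) f)
    refine h3.trans_lt ?_
    nlinarith
  -- The limit is available for t ≥ 0 only; negative times receive the zero operator, so that one
  -- total family of operators can be chosen.
  have hex : ∀ t, ∃ K : E →L[ℝ] E, 0 ≤ t → ∀ f, Tendsto (fun n => T n t f) atTop (𝓝 (K f)) := by
    intro t
    by_cases ht : 0 ≤ t
    · have h1 : ∀ f, ∃ y, Tendsto (fun n => T n t f) atTop (𝓝 y) := fun f =>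
        cauchySeq_tendsto_of_complete (hcau t ht f)
      choose L hL using h1
      exact ⟨continuousLinearMapOfTendsto (fun n => T n t) (f := L) (tendsto_pi_nhds.2 hL),
        fun _ f => hL f⟩
    · exact ⟨0, fun h => absurd h ht⟩
  choose S hS using hex
  have hSc : ∀ t, 0 ≤ t → ∀ f, ‖S t f‖ ≤ ‖f‖ := fun t ht f =>
    le_of_tendsto (hS t ht f).norm (Eventually.of_forall fun n => hTc n t ht f)
  have hdiff : ∀ f g, A f g → ∀ t, 0 ≤ t → ‖S t f - f‖ ≤ t * ‖g‖ := by
    intro f g hfg t ht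
    refine le_of_tendsto_of_tendsto ((hS t ht f).sub_const f).norm
      (((hyoslim f g hfg).norm).const_mul t) (Eventually.of_forall fun n => ?_)
    exact norm_yosidaExp_sub_self_le (hνpos n) (hnν n) ht f
  have hC0 : IsC0Semigroup S := by
    refine ⟨?_, ?_, ?_⟩
    · ext f
      refine tendsto_nhds_unique (hS 0 le_rfl f) ?_
      have : ∀ n, T n 0 f = f := fun n => by simp [hT, yosidaExp]
      simp only [this]
      exact tendsto_const_nhds
    · intro s t hs ht
      ext f
      refine tendsto_nhds_unique (hS (s + t) (add_nonneg hs ht) f) ?_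
      have h1 : ∀ n, T n (s + t) f = T n s (S t f) + T n s (T n t f - S t f) := fun n => by
        simp only [hT]
        rw [yosidaExp_add, map_sub]
        simp
      simp only [h1]
      have h2 : Tendsto (fun n => T n s (T n t f - S t f)) atTop (𝓝 0) :=
        squeeze_zero_norm (fun n => hTc n s hs _)
          (tendsto_iff_norm_sub_tendsto_zero.1 (hS t ht f))
      simpa using (hS s hs (S t f)).add h2
    · intro f
      rw [Metric.tendsto_nhds]
      intro ε hε
      obtain ⟨f', ⟨g', hfg'⟩, hf'⟩ := hdense.exists_dist_lt f (show 0 < ε / 3 by positivity)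
      have hlt : ∀ᶠ t in 𝓝[>] (0 : ℝ), t * ‖g'‖ < ε / 3 := by
        have : Tendsto (fun t : ℝ => t * ‖g'‖) (𝓝 0) (𝓝 (0 * ‖g'‖)) := by
          apply Continuous.tendsto; fun_prop
        rw [zero_mul] at this
        exact nhdsWithin_le_nhds (this.eventually (Iio_mem_nhds (by positivity)))
      filter_upwards [hlt, self_mem_nhdsWithin] with t h1 h2
      have h3 := hdiff f' g' hfg' t (le_of_lt h2)
      have h4 := hSc t (le_of_lt h2) (f - f')
      rw [dist_eq_norm] at hf' ⊢
      have h5 : S t f - f = S t (f - f') + (S t f' - f') - (f - f') := by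
        rw [map_sub]; abel
      rw [h5]
      refine (norm_sub_le _ _).trans_lt ?_
      have := norm_add_le (S t (f - f')) (S t f' - f')
      linarith
  have hgen : ∀ f g, A f g → graphGenerator S f g := by
    intro f g hfg
    have hb : ∀ h k, A h k → ∀ t, 0 ≤ t → ‖S t f - f - t • g‖ ≤ t * (2 * ‖g - h‖ + t * ‖k‖) := by
      intro h k hhk t ht
      have l1 := (((hS t ht f).sub_const f).sub_const (t • g)).norm
      have l2 : Tendsto (fun n => t * (‖yosida (R (ν n)) (ν n) f - g‖ + 2 * ‖g - h‖
          + t * ‖yosida (R (ν n)) (ν n) h‖)) atTop (𝓝 (t * (0 + 2 * ‖g - h‖ + t * ‖k‖))) :=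
        (((tendsto_iff_norm_sub_tendsto_zero.1 (hyoslim f g hfg)).add_const _).add
          (((hyoslim h k hhk).norm).const_mul t)).const_mul t
      rw [zero_add] at l2
      exact le_of_tendsto_of_tendsto l1 l2 (Eventually.of_forall fun n =>
        norm_yosidaExp_sub_sub_le (hνpos n) (hnν n) ht f g h)
    rw [graphGenerator, Metric.tendsto_nhds]
    intro ε hε
    obtain ⟨h, ⟨k, hhk⟩, hgh⟩ := hdense.exists_dist_lt g (show 0 < ε / 4 by positivity)
    have hlt : ∀ᶠ t in 𝓝[>] (0 : ℝ), t * ‖k‖ < ε / 4 := by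
      have : Tendsto (fun t : ℝ => t * ‖k‖) (𝓝 0) (𝓝 (0 * ‖k‖)) := by
        apply Continuous.tendsto; fun_prop
      rw [zero_mul] at this
      exact nhdsWithin_le_nhds (this.eventually (Iio_mem_nhds (by positivity)))
    filter_upwards [hlt, self_mem_nhdsWithin] with t h1 h2
    have ht : 0 < t := h2
    have h3 := hb h k hhk t ht.le
    rw [dist_eq_norm] at hgh ⊢
    have h5 : t⁻¹ • (S t f - f) - g = t⁻¹ • (S t f - f - t • g) := by
      rw [smul_sub _ _ (t • g), inv_smul_smul₀ ht.ne']
    rw [h5, norm_smul, norm_inv, Real.norm_eq_abs, abs_of_pos ht]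
    calc t⁻¹ * ‖S t f - f - t • g‖ ≤ t⁻¹ * (t * (2 * ‖g - h‖ + t * ‖k‖)) := by gcongr
      _ = 2 * ‖g - h‖ + t * ‖k‖ := by field_simp
      _ < ε := by linarith
  refine ⟨S, hC0, fun f g => ⟨fun hfg => ?_, hgen f g⟩, ?_⟩
  -- The generator cannot properly extend A: with u = R(λf - g), the difference u - f satisfies the
  -- eigenvalue equation of the generator for λ > 0, and a contraction semigroup has no such nonzero
  -- vector.
  · set lam := lam₀ + 1 with hlam
    have hl : lam₀ < lam := by linarith
    have hlpos : 0 < lam := by linarith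
    set u := R lam (lam • f - g) with hu
    have h1 := hgen _ _ (hA lam hl (lam • f - g))
    rw [← hu] at h1
    have h2 : Tendsto (fun t : ℝ => t⁻¹ • (S t (u - f) - (u - f))) (𝓝[>] 0)
        (𝓝 (lam • (u - f))) := by
      have h3 := h1.sub hfg
      have h4 : lam • u - (lam • f - g) - g = lam • (u - f) := by rw [smul_sub]; abel
      rw [h4] at h3
      refine h3.congr fun t => ?_
      rw [← smul_sub, map_sub]; congr 1; abel
    have h5 : u - f = 0 := by
      generalize u - f = v at h2
      have h6 : Tendsto (fun t : ℝ => ‖t⁻¹ • (S t v - v) - lam • v‖) (𝓝[>] 0) (𝓝 0) :=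
        tendsto_iff_norm_sub_tendsto_zero.1 h2
      have h7 : lam * ‖v‖ ≤ 0 := by
        refine ge_of_tendsto h6 ?_
        filter_upwards [self_mem_nhdsWithin] with t ht
        have ht : 0 < t := ht
        have h8 : (t⁻¹ + lam) • v = t⁻¹ • S t v - (t⁻¹ • (S t v - v) - lam • v) := by
          rw [add_smul, smul_sub]; abel
        have h9 : (t⁻¹ + lam) * ‖v‖ ≤ t⁻¹ * ‖v‖ + ‖t⁻¹ • (S t v - v) - lam • v‖ := by
          calc (t⁻¹ + lam) * ‖v‖ = ‖(t⁻¹ + lam) • v‖ := by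
                rw [norm_smul, Real.norm_eq_abs, abs_of_pos (by positivity)]
            _ ≤ ‖t⁻¹ • S t v‖ + ‖t⁻¹ • (S t v - v) - lam • v‖ := by
                rw [h8]; exact norm_sub_le _ _
            _ ≤ _ := by
                gcongr
                rw [norm_smul, norm_inv, Real.norm_eq_abs, abs_of_pos ht]
                gcongr
                exact hSc t ht.le v
        linarith
      have h8 : ‖v‖ ≤ 0 := by
        by_contra hcon
        push Not at hcon
        nlinarith
      exact norm_le_zero_iff.1 h8
    rw [hR lam hl]
    exact sub_eq_zero.1 h5
  · intro P hP h0 hadd hsmul hRP t ht f hf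
    refine hP.mem_of_tendsto (hS t ht f) (Eventually.of_forall fun n => ?_)
    simp only [hT]
    rw [yosidaExp_eq, smul_apply]
    refine hsmul _ (Real.exp_pos _).le _ (exp_apply_mem hP h0 hadd hsmul ?_ hf)
    intro f hf
    exact hsmul _ (by positivity) _ (hRP _ (hνlt n) f hf)

/-- **Hille–Yosida theorem**, quasi-contractive case. -/
theorem hilleYosida (A : E → E → Prop) (ω lam₀ : ℝ) (hlam₀ : ω ≤ lam₀)
    (R : ℝ → E →L[ℝ] E)
    (hR : ∀ lam, lam₀ < lam → ∀ f g, A f g ↔ R lam (lam • f - g) = f)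
    (hnorm : ∀ lam, lam₀ < lam → ‖R lam‖ ≤ (lam - ω)⁻¹)
    (hdense : Dense {f | ∃ g, A f g}) :
    ∃ S : ℝ → E →L[ℝ] E, IsC0Semigroup S ∧ (∀ f g, graphGenerator S f g ↔ A f g) ∧
      ∀ P : Set E, IsClosed P → (0 : E) ∈ P → (∀ f ∈ P, ∀ g ∈ P, f + g ∈ P) →
        (∀ c : ℝ, 0 ≤ c → ∀ f ∈ P, c • f ∈ P) → (∀ lam, lam₀ < lam → ∀ f ∈ P, R lam f ∈ P) →
        ∀ t, 0 ≤ t → ∀ f ∈ P, S t f ∈ P := by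
  -- The relation `A f (g + ω • f)` is the graph of A - ω, whose resolvent at λ is R(λ + ω). Its
  -- contraction semigroup is then multiplied by e^{ωt}.
  obtain ⟨S, hS, hgen, hpos⟩ := hilleYosida_contraction (fun f g => A f (g + ω • f)) (lam₀ - ω)
    (by linarith) (fun lam => R (lam + ω)) (fun lam hl f g => by
      rw [hR (lam + ω) (by linarith)]
      rw [add_smul, add_sub_add_right_eq_sub])
    (fun lam hl => by simpa using hnorm (lam + ω) (by linarith))
    (by
      convert hdense using 2
      ext f
      exact ⟨fun ⟨g, hg⟩ => ⟨_, hg⟩, fun ⟨g, hg⟩ => ⟨g - ω • f, by simpa using hg⟩⟩)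
  have hexp : Tendsto (fun t : ℝ => Real.exp (ω * t)) (𝓝[>] 0) (𝓝 1) := by
    have : Tendsto (fun t : ℝ => Real.exp (ω * t)) (𝓝 0) (𝓝 (Real.exp (ω * 0))) := by
      apply Continuous.tendsto; fun_prop
    rw [mul_zero, Real.exp_zero] at this
    exact this.mono_left nhdsWithin_le_nhds
  refine ⟨fun t => Real.exp (ω * t) • S t, ⟨?_, ?_, ?_⟩, ?_, ?_⟩
  · simp [hS.zero]
  · intro s t hs ht
    ext f
    simp [hS.add s t hs ht, mul_add, Real.exp_add, smul_smul, mul_comm]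
  · intro f
    simpa using hexp.smul (hS.strongCont f)
  · intro f g
    have hder : Tendsto (fun t : ℝ => t⁻¹ * (Real.exp (ω * t) - 1)) (𝓝[>] 0) (𝓝 ω) := by
      have h1 : HasDerivAt (fun t : ℝ => Real.exp (ω * t)) ω 0 := by
        have := ((hasDerivAt_id (0 : ℝ)).const_mul ω).exp
        simpa using this
      have h2 := (hasDerivWithinAt_iff_tendsto_slope' (s := Ioi (0 : ℝ)) (by simp)).1
        h1.hasDerivWithinAt
      refine h2.congr fun t => ?_
      simp [slope]
    have hiff : ∀ k, graphGenerator S f k →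
        graphGenerator (fun t => Real.exp (ω * t) • S t) f (k + ω • f) := by
      intro k hk
      have h1 := (hexp.smul hk).add (hder.smul_const f)
      rw [one_smul] at h1
      refine h1.congr fun t => ?_
      simp only [smul_apply, smul_sub, sub_smul, mul_sub, smul_smul]
      rw [mul_comm t⁻¹ (Real.exp _)]
      rw [mul_one]
      abel
    have hiff' : ∀ k, graphGenerator (fun t => Real.exp (ω * t) • S t) f k →
        graphGenerator S f (k - ω • f) := by
      intro k hk
      have h1 := (hexp.inv₀ one_ne_zero).smul (hk.sub (hder.smul_const f))
      rw [inv_one, one_smul] at h1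
      refine h1.congr fun t => ?_
      have hne : Real.exp (ω * t) ≠ 0 := (Real.exp_pos _).ne'
      simp only [smul_apply, smul_sub, sub_smul, mul_sub, smul_smul]
      rw [show (Real.exp (ω * t))⁻¹ * (t⁻¹ * Real.exp (ω * t)) = t⁻¹ by field_simp]
      rw [mul_one]
      abel
    constructor
    · intro h
      have := (hgen _ _).1 (hiff' _ h)
      simpa using this
    · intro h
      have := hiff (g - ω • f) ((hgen _ _).2 (by simpa using h))
      simpa using this
  · intro P hP h0 hadd hsmul hRP t ht f hf
    exact hsmul _ (Real.exp_pos _).le _ (hpos P hP h0 hadd hsmul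
      (fun lam hl => hRP _ (by linarith)) t ht f hf)

end HilleYosida


/-! ### Weighted spaces -/

section Weight

theorem weight_pos (m : ℝ) {x : ℝ} (hx : 0 < x) : 0 < 1 + x ^ m := by positivity

theorem ae_pos : ∀ᵐ x ∂posVol, (0 : ℝ) < x := by
  filter_upwards [ae_restrict_mem measurableSet_Ioi] with x hx using hx

theorem measurable_weight (m : ℝ) : Measurable fun x : ℝ => 1 + x ^ m := by fun_prop

/-- The weight is strictly positive on the half-line, so all these measures share their null sets.
This is what allows elements of different `X m` to be compared as functions. -/
theorem ae_weightMeasure (m : ℝ) : ae (weightMeasure m) = ae posVol := by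
  refine le_antisymm (withDensity_absolutelyContinuous _ _).ae_le
    (withDensity_absolutelyContinuous' (measurable_weight m).ennreal_ofReal.aemeasurable ?_).ae_le
  filter_upwards [ae_pos] with x hx
  simpa using weight_pos m hx

theorem ae_weightMeasure_iff {m : ℝ} {p : ℝ → Prop} :
    (∀ᵐ x ∂weightMeasure m, p x) ↔ ∀ᵐ x ∂posVol, p x := by
  rw [ae_weightMeasure]

theorem integrable_weightMeasure_iff {m : ℝ} {f : ℝ → ℝ} :
    Integrable f (weightMeasure m) ↔ Integrable (fun x => (1 + x ^ m) * f x) posVol := by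
  rw [weightMeasure, integrable_withDensity_iff_integrable_smul'
    (measurable_weight m).ennreal_ofReal (by simp)]
  refine integrable_congr ?_
  filter_upwards [ae_pos] with x hx
  rw [ENNReal.toReal_ofReal (weight_pos m hx).le, smul_eq_mul]

theorem integral_weightMeasure (m : ℝ) (f : ℝ → ℝ) :
    ∫ x, f x ∂weightMeasure m = ∫ x, (1 + x ^ m) * f x ∂posVol := by
  rw [weightMeasure, integral_withDensity_eq_integral_toReal_smul
    (measurable_weight m).ennreal_ofReal (by simp)]
  refine integral_congr_ae ?_
  filter_upwards [ae_pos] with x hx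
  rw [ENNReal.toReal_ofReal (weight_pos m hx).le, smul_eq_mul]

theorem lintegral_weightMeasure (m : ℝ) (f : ℝ → ENNReal) :
    ∫⁻ x, f x ∂weightMeasure m = ∫⁻ x, ENNReal.ofReal (1 + x ^ m) * f x ∂posVol := by
  rw [weightMeasure, lintegral_withDensity_eq_lintegral_mul_non_measurable _
    (measurable_weight m).ennreal_ofReal (by simp)]
  rfl

theorem aestronglyMeasurable_weightMeasure_iff {m : ℝ} {f : ℝ → ℝ} :
    AEStronglyMeasurable f (weightMeasure m) ↔ AEStronglyMeasurable f posVol := by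
  constructor <;> intro h <;> refine h.mono_ac ?_
  · refine Measure.AbsolutelyContinuous.mk fun s _ hs => ?_
    have : ∀ᵐ x ∂weightMeasure m, x ∉ s := measure_eq_zero_iff_ae_notMem.1 hs
    exact measure_eq_zero_iff_ae_notMem.2 (ae_weightMeasure_iff.1 this)
  · exact withDensity_absolutelyContinuous _ _

theorem aemeasurable_coe {m : ℝ} (f : X m) : AEMeasurable f posVol :=
  (aestronglyMeasurable_weightMeasure_iff.1 (Lp.aestronglyMeasurable f)).aemeasurable

theorem integrable_coe {m : ℝ} (f : X m) : Integrable f (weightMeasure m) :=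
  L1.integrable_coeFn f

/-- Integrability with respect to the weighted measure implies integrability. -/
theorem integrable_posVol {m : ℝ} {f : ℝ → ℝ} (hf : Integrable f (weightMeasure m)) :
    Integrable f posVol := by
  have h1 := integrable_weightMeasure_iff.1 hf
  refine h1.mono (aestronglyMeasurable_weightMeasure_iff.1 hf.1) ?_
  filter_upwards [ae_pos] with x hx
  rw [norm_mul, Real.norm_of_nonneg (weight_pos m hx).le]
  have : 0 ≤ x ^ m := by positivity
  nlinarith [norm_nonneg (f x)]

end Weight

/-! ### Locally absolutely continuous functions on the half-line -/

section AbsCont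

theorem _root_.LipschitzOnWith.comp_absolutelyContinuousOnInterval {g P : ℝ → ℝ} {s : Set ℝ}
    {K : NNReal} {a b : ℝ} (hg : LipschitzOnWith K g s)
    (hP : AbsolutelyContinuousOnInterval P a b) (hs : MapsTo P (uIcc a b) s) :
    AbsolutelyContinuousOnInterval (fun x => g (P x)) a b := by
  have hlim := Tendsto.const_mul (K : ℝ) hP
  rw [mul_zero] at hlim
  refine squeeze_zero' (Eventually.of_forall fun t => Finset.sum_nonneg fun i _ => dist_nonneg)
    ?_ hlim
  filter_upwards [mem_inf_of_right (mem_principal_self _)] with t ht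
  rw [Finset.mul_sum]
  refine Finset.sum_le_sum fun i hi => ?_
  exact hg.dist_le_mul _ (hs (ht.1 i hi).1) _ (hs (ht.1 i hi).2)

theorem _root_.AbsolutelyContinuousOnInterval.abs {P : ℝ → ℝ} {a b : ℝ}
    (hP : AbsolutelyContinuousOnInterval P a b) :
    AbsolutelyContinuousOnInterval (fun x => |P x|) a b := by
  have hlip : LipschitzOnWith 1 (fun x : ℝ => |x|) univ :=
    (LipschitzWith.of_dist_le_mul fun x y => by
      simpa [Real.dist_eq] using abs_abs_sub_abs_le_abs_sub x y).lipschitzOnWith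
  exact hlip.comp_absolutelyContinuousOnInterval hP (mapsTo_univ _ _)

theorem _root_.AbsolutelyContinuousOnInterval.exp {P : ℝ → ℝ} {a b : ℝ}
    (hP : AbsolutelyContinuousOnInterval P a b) :
    AbsolutelyContinuousOnInterval (fun x => Real.exp (P x)) a b := by
  obtain ⟨C, hC⟩ := hP.exists_bound
  obtain ⟨K, hK⟩ := (Real.contDiff_exp (n := 1)).contDiffOn.exists_lipschitzOnWith
    (s := Icc (-C) C) (by decide) (convex_Icc _ _) isCompact_Icc
  exact hK.comp_absolutelyContinuousOnInterval hP fun x hx => abs_le.1 (hC x hx)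

/-- Absolute continuity on the compact subintervals of `(0, ∞)`. -/
def LocAC (F : ℝ → ℝ) : Prop :=
  ∀ x y : ℝ, 0 < x → x ≤ y → AbsolutelyContinuousOnInterval F x y

theorem exists_nat_mem_Icc {x : ℝ} (hx : 0 < x) :
    ∃ n : ℕ, x ∈ Icc (1 / ((n : ℝ) + 1)) ((n : ℝ) + 1) := by
  obtain ⟨n₁, h₁⟩ := exists_nat_ge x
  obtain ⟨n₂, h₂⟩ := exists_nat_one_div_lt hx
  have e₁ : (n₁ : ℝ) ≤ (max n₁ n₂ : ℕ) := by exact_mod_cast le_max_left _ _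
  have e₂ : (n₂ : ℝ) ≤ (max n₁ n₂ : ℕ) := by exact_mod_cast le_max_right _ _
  refine ⟨max n₁ n₂, ?_, by linarith⟩
  refine le_trans ?_ h₂.le
  gcongr

theorem one_div_add_one_le (n : ℕ) : 1 / ((n : ℝ) + 1) ≤ (n : ℝ) + 1 := by
  have : (0 : ℝ) ≤ n := n.cast_nonneg
  rw [div_le_iff₀ (by positivity)]
  nlinarith

/-- A property that holds almost everywhere on each compact subinterval of `(0, ∞)` holds almost
everywhere. -/
theorem ae_posVol_of_forall_Icc {p : ℝ → Prop}
    (h : ∀ n : ℕ, ∀ᵐ x, x ∈ Icc (1 / ((n : ℝ) + 1)) ((n : ℝ) + 1) → p x) :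
    ∀ᵐ x ∂posVol, p x := by
  rw [ae_restrict_iff' measurableSet_Ioi]
  filter_upwards [ae_all_iff.2 h] with x hx hx0
  obtain ⟨n, hn⟩ := exists_nat_mem_Icc hx0
  exact hx n hn

namespace LocAC

variable {F : ℝ → ℝ}

theorem ae_differentiableAt (hF : LocAC F) : ∀ᵐ x ∂posVol, DifferentiableAt ℝ F x := by
  refine ae_posVol_of_forall_Icc fun n => ?_
  have := (hF _ _ (by positivity) (one_div_add_one_le n)).ae_differentiableAt
  rwa [uIcc_of_le (one_div_add_one_le n)] at this

theorem continuousOn (hF : LocAC F) : ContinuousOn F (Ioi 0) := by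
  intro x hx
  have hx : 0 < x := hx
  have := (hF (x / 2) (x + 1) (by positivity) (by linarith)).continuousOn
  rw [uIcc_of_le (by linarith)] at this
  exact (this.continuousAt (Icc_mem_nhds (by linarith) (by linarith))).continuousWithinAt

end LocAC

theorem aecover_posVol :
    AECover posVol atTop fun n : ℕ => Ioc (1 / ((n : ℝ) + 1)) ((n : ℝ) + 1) := by
  refine ⟨?_, fun n => measurableSet_Ioc⟩
  filter_upwards [ae_pos] with x hx
  obtain ⟨n₁, h₁⟩ := exists_nat_ge x
  obtain ⟨n₂, h₂⟩ := exists_nat_one_div_lt hx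
  filter_upwards [eventually_ge_atTop (max n₁ n₂)] with n hn
  have e₁ : (n₁ : ℝ) ≤ n := by exact_mod_cast (le_max_left _ _).trans hn
  have e₂ : (n₂ : ℝ) ≤ n := by exact_mod_cast (le_max_right _ _).trans hn
  refine ⟨lt_of_le_of_lt ?_ h₂, by linarith⟩
  gcongr

theorem restrict_posVol_Ioc {ε N : ℝ} (hε : 0 < ε) :
    posVol.restrict (Ioc ε N) = volume.restrict (Ioc ε N) :=
  Measure.restrict_restrict_of_subset fun _ hx => hε.trans hx.1

theorem ae_restrict_Ioc {ε N : ℝ} (hε : 0 < ε) {p : ℝ → Prop} (h : ∀ᵐ x ∂posVol, p x) :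
    ∀ᵐ x ∂volume.restrict (Ioc ε N), p x := by
  rw [← restrict_posVol_Ioc hε]
  exact ae_restrict_of_ae h

end AbsCont

/-! ### The flux estimate -/

section Flux

/-- Because ρ > 0, F and v have the same sign, and away from zeros the derivative of |F| is
sign(v)(h - c v). -/
theorem deriv_abs_le {F : ℝ → ℝ} {x ρ v c h : ℝ} (hF : DifferentiableAt ℝ F x) (hρ : 0 < ρ)
    (hv : F x = ρ * v) (hd : deriv F x = h - c * v) :
    deriv (fun y => |F y|) x ≤ |h| - c * |v| := by
  rcases lt_trichotomy (F x) 0 with h0 | h0 | h0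
  · have hev : (fun y => |F y|) =ᶠ[𝓝 x] fun y => -F y := by
      filter_upwards [hF.continuousAt.eventually (Iio_mem_nhds h0)] with y hy
      exact abs_of_neg hy
    have hv0 : v < 0 := by
      by_contra hcon
      push Not at hcon
      have : 0 ≤ ρ * v := by positivity
      linarith
    rw [hev.deriv_eq, deriv.fun_neg, hd, abs_of_neg hv0]
    linarith [neg_abs_le h]
  · have hv0 : v = 0 := by
      rw [h0] at hv
      rcases mul_eq_zero.1 hv.symm with h1 | h1
      · exact absurd h1 hρ.ne'
      · exact h1
    -- At a zero of F, |F| has a minimum, so `deriv` is 0 whether or not |F| is differentiable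
    -- there.
    have hmin : IsLocalMin (fun y => |F y|) x :=
      Eventually.of_forall fun y => by simp [h0]
    rw [hmin.deriv_eq_zero, hv0]
    simp
  · have hev : (fun y => |F y|) =ᶠ[𝓝 x] F := by
      filter_upwards [hF.continuousAt.eventually (Ioi_mem_nhds h0)] with y hy
      exact abs_of_pos hy
    have hv0 : 0 < v := by
      by_contra hcon
      push Not at hcon
      have : ρ * v ≤ 0 := mul_nonpos_of_nonneg_of_nonpos hρ.le hcon
      linarith
    rw [hev.deriv_eq, hd, abs_of_pos hv0]
    linarith [le_abs_self h]

variable {r q u F h : ℝ → ℝ} {m C lam : ℝ}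

theorem hasDerivAt_weight {x : ℝ} (hx : 0 < x) :
    HasDerivAt (fun x : ℝ => 1 + x ^ m) (m * x ^ (m - 1)) x :=
  (Real.hasDerivAt_rpow_const (Or.inl hx.ne')).const_add 1

theorem locAC_weight : LocAC fun x : ℝ => 1 + x ^ m := by
  intro x y hx hxy
  apply ContDiffOn.absolutelyContinuousOnInterval
  intro z hz
  rw [uIcc_of_le hxy] at hz
  exact (contDiffAt_const.add (Real.contDiffAt_rpow_const_of_ne
    (hx.trans_le hz.1).ne')).contDiffWithinAt

/-- With w = 1 + x^m, the derivative of |F| w is at most w|h| - (λ + q)w|u| + |F|w', and |F|w' =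
r|u|w' ≤ C w|u|. Integrating over (ε, N] and dropping the nonnegative boundary term at N leaves only
the flux at ε. -/
theorem flux_estimate_Ioc (hr_pos : ∀ x : ℝ, 0 < x → 0 < r x)
    (hC : ∀ x : ℝ, 0 < x → r x * (m * x ^ (m - 1)) ≤ C * (1 + x ^ m))
    (hC0 : 0 ≤ C) (hlam : C ≤ lam) (hq : ∀ x : ℝ, 0 < x → 0 ≤ q x)
    (hqm : AEMeasurable q posVol) (hum : AEMeasurable u posVol) (hF : LocAC F)
    (hFu : ∀ᵐ x ∂posVol, F x = r x * u x)
    (hh : ∀ᵐ x ∂posVol, deriv F x = h x - (lam + q x) * u x)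
    (hInt : Integrable h (weightMeasure m)) {ε N : ℝ} (hε : 0 < ε) (hN : ε ≤ N) :
    IntegrableOn (fun x => (1 + x ^ m) * ((lam - C + q x) * |u x|)) (Ioc ε N) ∧
    ∫ x in Ioc ε N, (1 + x ^ m) * ((lam - C + q x) * |u x|) ≤
      (∫ x, |h x| ∂weightMeasure m) + |F ε| * (1 + ε ^ m) := by
  have hW : LocAC fun x : ℝ => 1 + x ^ m := locAC_weight
  have hAC := (hF ε N hε hN).abs
  have hprod := hAC.fun_mul (hW ε N hε hN)
  have hIh : IntegrableOn (fun x => (1 + x ^ m) * h x) (Ioc ε N) := by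
    have := (integrable_weightMeasure_iff.1 hInt).restrict (s := Ioc ε N)
    rwa [restrict_posVol_Ioc hε] at this
  have hIF : IntegrableOn (fun x => (1 + x ^ m) * deriv F x) (Ioc ε N) := by
    have := (hF ε N hε hN).intervalIntegrable_deriv.continuousOn_mul (hW ε N hε hN).continuousOn
    rwa [intervalIntegrable_iff_integrableOn_Ioc_of_le hN] at this
  have hLm : AEStronglyMeasurable (fun x => (1 + x ^ m) * ((lam - C + q x) * |u x|))
      (volume.restrict (Ioc ε N)) := by
    rw [← restrict_posVol_Ioc hε]
    refine AEStronglyMeasurable.restrict (AEMeasurable.aestronglyMeasurable ?_)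
    refine (measurable_weight m).aemeasurable.mul ((hqm.const_add _).mul ?_)
    exact (continuous_abs.measurable.comp_aemeasurable hum)
  have hpos := ae_restrict_Ioc (N := N) hε ae_pos
  have hh' := ae_restrict_Ioc (N := N) hε hh
  have hFu' := ae_restrict_Ioc (N := N) hε hFu
  have hIL : IntegrableOn (fun x => (1 + x ^ m) * ((lam - C + q x) * |u x|)) (Ioc ε N) := by
    refine Integrable.mono (hIh.sub hIF) hLm ?_
    filter_upwards [hpos, hh'] with x hx hhx
    have h1 := weight_pos m hx
    have h2 := hq x hx
    simp only [Pi.sub_apply]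
    rw [hhx, ← mul_sub, sub_sub_cancel, norm_mul, norm_mul, norm_mul, norm_mul]
    rw [Real.norm_of_nonneg h1.le, Real.norm_of_nonneg (by linarith : 0 ≤ lam - C + q x),
      Real.norm_of_nonneg (by linarith : 0 ≤ lam + q x), norm_abs_eq_norm]
    gcongr
    linarith
  refine ⟨hIL, ?_⟩
  have hIabs : IntegrableOn (fun x => (1 + x ^ m) * |h x|) (Ioc ε N) := by
    refine hIh.norm.congr ?_
    filter_upwards [hpos] with x hx
    rw [norm_mul, Real.norm_of_nonneg (weight_pos m hx).le, Real.norm_eq_abs]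
  have hID : IntegrableOn (deriv fun x => |F x| * (1 + x ^ m)) (Ioc ε N) := by
    have := hprod.intervalIntegrable_deriv
    rwa [intervalIntegrable_iff_integrableOn_Ioc_of_le hN] at this
  have hDF := ae_restrict_Ioc (N := N) hε hF.ae_differentiableAt
  have hDA : ∀ᵐ x ∂volume.restrict (Ioc ε N), DifferentiableAt ℝ (fun x => |F x|) x := by
    rw [ae_restrict_iff' measurableSet_Ioc]
    filter_upwards [hAC.ae_differentiableAt] with x hx hxm
    rw [uIcc_of_le hN] at hx
    exact hx (Ioc_subset_Icc_self hxm)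
  have hmain : ∫ x in Ioc ε N, (1 + x ^ m) * ((lam - C + q x) * |u x|) ≤
      ∫ x in Ioc ε N, ((1 + x ^ m) * |h x| - deriv (fun x => |F x| * (1 + x ^ m)) x) := by
    refine integral_mono_ae hIL (hIabs.sub hID) ?_
    filter_upwards [hpos, hh', hFu', hDF, hDA] with x hx h1 h2 h3 h4
    have h5 := (h4.hasDerivAt.mul (hasDerivAt_weight (m := m) hx)).deriv
    have h6 : deriv (fun x => |F x| * (1 + x ^ m)) x =
        deriv (fun x => |F x|) x * (1 + x ^ m) + |F x| * (m * x ^ (m - 1)) := h5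
    have h7 := deriv_abs_le h3 (hr_pos x hx) h2 h1
    have h8 := weight_pos m hx
    have h9 : |F x| * (m * x ^ (m - 1)) ≤ C * (1 + x ^ m) * |u x| := by
      rw [h2, abs_mul, abs_of_pos (hr_pos x hx)]
      have := mul_le_mul_of_nonneg_right (hC x hx) (abs_nonneg (u x))
      linarith
    have h10 := mul_le_mul_of_nonneg_right h7 h8.le
    rw [h6]
    linarith
  rw [integral_sub hIabs hID, ← intervalIntegral.integral_of_le hN (f := deriv _),
    hprod.integral_deriv_eq_sub] at hmain
  have hle : ∫ x in Ioc ε N, (1 + x ^ m) * |h x| ≤ ∫ x, |h x| ∂weightMeasure m := by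
    rw [integral_weightMeasure, ← restrict_posVol_Ioc hε]
    refine setIntegral_le_integral (integrable_weightMeasure_iff.1 hInt.abs) ?_
    filter_upwards [ae_pos] with x hx
    have := weight_pos m hx
    simp only [Pi.zero_apply]
    positivity
  have hend : 0 ≤ |F N| * (1 + N ^ m) := by
    have := weight_pos m (hε.trans_le hN)
    positivity
  linarith

/-- Let ε = 1/(n+1) and N = n+1. Since m ≥ 0, the remaining boundary term is at most 2|F(ε)|, which
tends to 0; integrability over the half-line follows from the uniform bound. -/
theorem flux_estimate (hm : 0 ≤ m) (hr_pos : ∀ x : ℝ, 0 < x → 0 < r x)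
    (hC : ∀ x : ℝ, 0 < x → r x * (m * x ^ (m - 1)) ≤ C * (1 + x ^ m))
    (hC0 : 0 ≤ C) (hlam : C ≤ lam) (hq : ∀ x : ℝ, 0 < x → 0 ≤ q x)
    (hqm : AEMeasurable q posVol) (hum : AEMeasurable u posVol) (hF : LocAC F)
    (hFu : ∀ᵐ x ∂posVol, F x = r x * u x) (hF0 : Tendsto F (𝓝[>] 0) (𝓝 0))
    (hh : ∀ᵐ x ∂posVol, deriv F x = h x - (lam + q x) * u x)
    (hInt : Integrable h (weightMeasure m)) :
    Integrable (fun x => (lam - C + q x) * |u x|) (weightMeasure m) ∧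
    ∫ x, (lam - C + q x) * |u x| ∂weightMeasure m ≤ ∫ x, |h x| ∂weightMeasure m := by
  set I := ∫ x, |h x| ∂weightMeasure m
  have hest := fun n : ℕ => flux_estimate_Ioc hr_pos hC hC0 hlam hq hqm hum hF hFu hh hInt
    (ε := 1 / ((n : ℝ) + 1)) (N := (n : ℝ) + 1) (by positivity) (one_div_add_one_le n)
  have hε : Tendsto (fun n : ℕ => 1 / ((n : ℝ) + 1)) atTop (𝓝[>] 0) :=
    tendsto_nhdsWithin_iff.2 ⟨tendsto_one_div_add_atTop_nhds_zero_nat,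
      Eventually.of_forall fun n => mem_Ioi.2 (by positivity)⟩
  have hbd : Tendsto (fun n : ℕ => I + |F (1 / ((n : ℝ) + 1))| * (1 + (1 / ((n : ℝ) + 1)) ^ m))
      atTop (𝓝 I) := by
    have h1 : Tendsto (fun n : ℕ => |F (1 / ((n : ℝ) + 1))|) atTop (𝓝 0) := by
      simpa using (hF0.comp hε).abs
    have h2 : Tendsto (fun n : ℕ => |F (1 / ((n : ℝ) + 1))| * 2) atTop (𝓝 0) := by
      simpa using h1.mul_const 2
    have h3 : Tendsto (fun n : ℕ => |F (1 / ((n : ℝ) + 1))| * (1 + (1 / ((n : ℝ) + 1)) ^ m))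
        atTop (𝓝 0) := by
      refine squeeze_zero (fun n => ?_) (fun n => ?_) h2
      · have := weight_pos m (show 0 < 1 / ((n : ℝ) + 1) by positivity)
        positivity
      · gcongr
        have : (1 / ((n : ℝ) + 1)) ^ m ≤ 1 := by
          refine Real.rpow_le_one (by positivity) ?_ hm
          rw [div_le_one (by positivity)]
          have : (0 : ℝ) ≤ n := n.cast_nonneg
          linarith
        linarith
    simpa using h3.const_add I
  have hInt' : Integrable (fun x => (1 + x ^ m) * ((lam - C + q x) * |u x|)) posVol := by
    refine aecover_posVol.integrable_of_integral_bounded_of_nonneg_ae (I + 1) (fun n => ?_) ?_ ?_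
    · have := (hest n).1
      rwa [IntegrableOn, ← restrict_posVol_Ioc (by positivity)] at this
    · filter_upwards [ae_pos] with x hx
      have h1 := weight_pos m hx
      have h2 := hq x hx
      have h3 : 0 ≤ lam - C + q x := by linarith
      positivity
    · filter_upwards [hbd.eventually (Iio_mem_nhds (show I < I + 1 by linarith))] with n hn
      rw [restrict_posVol_Ioc (by positivity)]
      exact (hest n).2.trans (le_of_lt hn)
  refine ⟨integrable_weightMeasure_iff.2 hInt', ?_⟩
  rw [integral_weightMeasure]
  refine le_of_tendsto_of_tendsto (aecover_posVol.integral_tendsto_of_countably_generated hInt')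
    hbd (Eventually.of_forall fun n => ?_)
  simp only
  rw [restrict_posVol_Ioc (by positivity)]
  exact (hest n).2

end Flux


/-! ### The transport operator -/

section Transport

/-- The standing assumptions on the growth rate `r` and the absorption rate `q`. -/
structure TransportCoeff (r q : ℝ → ℝ) : Prop where
  r_pos : ∀ x : ℝ, 0 < x → 0 < r x
  r_loc : LocallyIntegrableOn (fun x => 1 / r x) (Ioi 0)
  r_le : ∃ r₀ r₁ : ℝ, 0 ≤ r₀ ∧ 0 ≤ r₁ ∧ ∀ x : ℝ, 0 < x → r x ≤ r₀ + r₁ * x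
  q_nonneg : ∀ x : ℝ, 0 < x → 0 ≤ q x
  q_loc : MemLinftyLoc q

namespace TransportCoeff

variable {r q : ℝ → ℝ}

/-- Linear growth of r is exactly what makes r w' comparable with w = 1 + x^m: both x^(m-1) and x ·
x^(m-1) are at most w. -/
theorem exists_growth_bound (hc : TransportCoeff r q) {m : ℝ} (hm : 1 < m) :
    ∃ C : ℝ, 0 ≤ C ∧ ∀ x : ℝ, 0 < x → r x * (m * x ^ (m - 1)) ≤ C * (1 + x ^ m) := by
  obtain ⟨r₀, r₁, h₀, h₁, hle⟩ := hc.r_le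
  refine ⟨m * (r₀ + r₁), by positivity, fun x hx => ?_⟩
  have e1 : x ^ (m - 1) ≤ 1 + x ^ m := by
    rcases le_total x 1 with h | h
    · have := Real.rpow_le_one hx.le h (show 0 ≤ m - 1 by linarith)
      have : 0 ≤ x ^ m := by positivity
      linarith
    · have := Real.rpow_le_rpow_of_exponent_le h (show m - 1 ≤ m by linarith)
      linarith
  have e2 : x * x ^ (m - 1) ≤ 1 + x ^ m := by
    rw [← Real.rpow_one_add' hx.le (by linarith), add_sub_cancel]
    linarith
  have e3 := hle x hx
  have e4 : 0 ≤ x ^ (m - 1) := by positivity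
  calc r x * (m * x ^ (m - 1)) ≤ (r₀ + r₁ * x) * (m * x ^ (m - 1)) := by gcongr
    _ = m * (r₀ * x ^ (m - 1) + r₁ * (x * x ^ (m - 1))) := by ring
    _ ≤ m * (r₀ * (1 + x ^ m) + r₁ * (1 + x ^ m)) := by gcongr
    _ = _ := by ring

theorem aemeasurable_inv (hc : TransportCoeff r q) : AEMeasurable (fun x => 1 / r x) posVol :=
  hc.r_loc.aestronglyMeasurable.aemeasurable

theorem integrableOn_inv (hc : TransportCoeff r q) {x y : ℝ} (hx : 0 < x) :
    IntegrableOn (fun x => 1 / r x) (Icc x y) :=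
  hc.r_loc.integrableOn_compact_subset (fun _ hz => hx.trans_le hz.1) isCompact_Icc

theorem intervalIntegrable_rate (hc : TransportCoeff r q) (lam : ℝ) {x y : ℝ} (hx : 0 < x)
    (hy : 0 < y) : IntervalIntegrable (fun z => (lam + q z) / r z) volume x y := by
  wlog hxy : x ≤ y generalizing x y
  · exact (this hy hx (by linarith)).symm
  rw [intervalIntegrable_iff_integrableOn_Icc_of_le hxy]
  obtain ⟨C, hC⟩ := hc.q_loc.2 y
  have hsub : Icc x y ⊆ Ioc 0 y := fun z hz => ⟨hx.trans_le hz.1, hz.2⟩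
  have hC' : ∀ᵐ z ∂volume.restrict (Icc x y), |q z| ≤ C := ae_restrict_of_ae_restrict_of_subset hsub hC
  have hqm : AEMeasurable q (volume.restrict (Icc x y)) :=
    hc.q_loc.1.mono_set fun z hz => hx.trans_le hz.1
  have := (hc.integrableOn_inv (y := y) hx).bdd_mul (c := |lam| + C)
    ((hqm.const_add lam).aestronglyMeasurable) (by
      filter_upwards [hC'] with z hz
      exact (norm_add_le _ _).trans (add_le_add le_rfl hz))
  refine this.congr (Eventually.of_forall fun z => ?_)
  simp only
  ring

/-- The flux of an element of the domain vanishes at the origin. -/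
theorem tendsto_flux (hc : TransportCoeff r q) {u F : ℝ → ℝ} (hF : LocAC F)
    (hFu : ∀ᵐ x ∂posVol, F x = r x * u x) (hu : Integrable u posVol)
    (hF' : Integrable (deriv F) posVol)
    (hbd : IntegrableOn (fun x => 1 / r x) (Ioo (0 : ℝ) 1) → Tendsto F (𝓝[>] 0) (𝓝 0)) :
    Tendsto F (𝓝[>] 0) (𝓝 0) := by
  by_cases hInt : IntegrableOn (fun x => 1 / r x) (Ioo (0 : ℝ) 1)
  · exact hbd hInt
  have hii : IntervalIntegrable (deriv F) volume 0 1 := by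
    rw [intervalIntegrable_iff_integrableOn_Ioc_of_le zero_le_one]
    exact IntegrableOn.mono_set (t := Ioi 0) hF' fun x hx => hx.1
  have hcont := intervalIntegral.continuousOn_primitive_interval' hii
    (show (1 : ℝ) ∈ uIcc 0 1 by simp)
  have hlim : Tendsto F (𝓝[>] 0) (𝓝 (F 1 + ∫ x in (1 : ℝ)..0, deriv F x)) := by
    have h1 : Tendsto (fun b => F 1 + ∫ x in (1 : ℝ)..b, deriv F x) (𝓝[>] 0)
        (𝓝 (F 1 + ∫ x in (1 : ℝ)..0, deriv F x)) := by
      refine Tendsto.const_add _ ?_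
      have h2 := hcont 0 (by simp)
      rw [uIcc_of_le zero_le_one] at h2
      refine h2.tendsto.mono_left ?_
      rw [← nhdsWithin_Ioo_eq_nhdsGT (zero_lt_one (α := ℝ))]
      exact nhdsWithin_mono _ Ioo_subset_Icc_self
    refine h1.congr' ?_
    have : Ioo (0 : ℝ) 1 ∈ 𝓝[>] (0 : ℝ) := Ioo_mem_nhdsGT zero_lt_one
    filter_upwards [this] with x hx
    rw [(hF x 1 hx.1 hx.2.le).symm.integral_deriv_eq_sub]
    ring
  set c := F 1 + ∫ x in (1 : ℝ)..0, deriv F x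
  by_cases hc0 : c = 0
  · rwa [hc0] at hlim
  -- F has a limit c at 0 because F' is integrable. If c ≠ 0, then |u| = |F|/r > |c|/(2r) near 0,
  -- and integrability of u would force 1/r to be integrable there.
  exfalso
  apply hInt
  have hev : ∀ᶠ x in 𝓝[>] (0 : ℝ), |c| / 2 < |F x| :=
    (hlim.abs).eventually (Ioi_mem_nhds (half_lt_self (abs_pos.2 hc0)))
  obtain ⟨δ, hδ, hsub⟩ := mem_nhdsGT_iff_exists_Ioo_subset.1 hev
  have hδ : 0 < δ := hδ
  have h1 : IntegrableOn (fun x => 1 / r x) (Ioo 0 δ) := by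
    have hum : IntegrableOn u (Ioo 0 δ) := IntegrableOn.mono_set (t := Ioi 0) hu fun x hx => hx.1
    refine Integrable.mono (hum.const_mul (2 / |c|))
      ((hc.aemeasurable_inv.mono_set fun x hx => hx.1).aestronglyMeasurable) ?_
    have hae : ∀ᵐ x ∂volume.restrict (Ioo 0 δ), F x = r x * u x :=
      ae_restrict_of_ae_restrict_of_subset (fun x hx => hx.1) hFu
    filter_upwards [hae, ae_restrict_mem measurableSet_Ioo] with x hx hxm
    have hr := hc.r_pos x hxm.1
    have h2 : |c| / 2 < |F x| := hsub hxm
    have hcpos : 0 < |c| := abs_pos.2 hc0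
    rw [hx, abs_mul, abs_of_pos hr] at h2
    rw [Real.norm_of_nonneg (by positivity), norm_mul, Real.norm_of_nonneg (by positivity),
      Real.norm_eq_abs, div_le_iff₀ hr]
    calc (1 : ℝ) = 2 / |c| * (|c| / 2) := by field_simp
      _ ≤ 2 / |c| * (r x * |u x|) := by gcongr
      _ = _ := by ring
  refine (h1.union (hc.integrableOn_inv (x := δ) (y := 1) hδ)).mono_set fun x hx => ?_
  rcases lt_or_ge x δ with h | h
  · exact Or.inl ⟨hx.1, h⟩
  · exact Or.inr ⟨h, hx.2.le⟩

/-- Solution of the stationary transport equation with source `h`. -/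
theorem exists_solution (hc : TransportCoeff r q) {lam : ℝ} (hlam : 0 ≤ lam) {h : ℝ → ℝ}
    (hh : Integrable h posVol) :
    ∃ u F : ℝ → ℝ, LocAC F ∧ (∀ x, 0 < x → F x = r x * u x) ∧ Tendsto F (𝓝[>] 0) (𝓝 0) ∧
      (∀ᵐ x ∂posVol, deriv F x = h x - (lam + q x) * u x) ∧ AEMeasurable u posVol ∧
      ((∀ᵐ x ∂posVol, 0 ≤ h x) → ∀ x, 0 < x → 0 ≤ u x) := by
  -- Integrating factor: u = (1/r) e^{-P(x)} ∫_0^x e^{P(y)} h(y) dy with P' = (λ + q)/r. P is based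
  -- at 1, as k need not be integrable at 0 and P may tend to -∞ there; monotonicity of P still
  -- gives |F(x)| ≤ ∫_0^x |h|, hence the zero flux at the origin.
  set k : ℝ → ℝ := fun z => (lam + q z) / r z with hk
  have hkint : ∀ {x y : ℝ}, 0 < x → 0 < y → IntervalIntegrable k volume x y :=
    fun hx hy => hc.intervalIntegrable_rate lam hx hy
  have hk0 : ∀ x, 0 < x → 0 ≤ k x := fun x hx =>
    div_nonneg (add_nonneg hlam (hc.q_nonneg x hx)) (hc.r_pos x hx).le
  set P : ℝ → ℝ := fun x => ∫ z in (1 : ℝ)..x, k z with hP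
  have hPmono : ∀ {x y : ℝ}, 0 < x → x ≤ y → P x ≤ P y := by
    intro x y hx hxy
    have h1 := intervalIntegral.integral_add_adjacent_intervals
      (hkint one_pos hx) (hkint hx (hx.trans_le hxy))
    have h2 : 0 ≤ ∫ z in x..y, k z := intervalIntegral.integral_nonneg hxy fun z hz =>
      hk0 z (hx.trans_le hz.1)
    simp only [hP]
    linarith
  have hPAC : LocAC P := by
    intro x y hx hxy
    have hxp : 0 < min x 1 := lt_min hx one_pos
    have hyp : 0 < max y 1 := lt_max_of_lt_right one_pos
    have hle : min x 1 ≤ max y 1 := (min_le_right _ _).trans (le_max_right _ _)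
    have := (hkint hxp hyp).absolutelyContinuousOnInterval_intervalIntegral (c := 1)
      (by rw [uIcc_of_le hle]; exact ⟨min_le_right _ _, le_max_right _ _⟩)
    refine this.mono ?_
    rw [uIcc_of_le hle, uIcc_of_le hxy]
    exact Icc_subset_Icc (min_le_left _ _) (le_max_left _ _)
  have hPder : ∀ᵐ x ∂posVol, HasDerivAt P (k x) x := by
    refine ae_posVol_of_forall_Icc fun n => ?_
    have h1 := one_div_add_one_le n
    have hn : (0 : ℝ) ≤ n := n.cast_nonneg
    have h2 := (hkint (show 0 < 1 / ((n : ℝ) + 1) by positivity)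
      (show 0 < (n : ℝ) + 1 by positivity)).ae_hasDerivAt_integral
    rw [uIcc_of_le h1] at h2
    filter_upwards [h2] with x hx hxm
    exact hx hxm 1 ⟨by rw [div_le_one (by positivity)]; linarith, by linarith⟩
  have hint0 : ∀ {x : ℝ}, 0 < x → IntervalIntegrable (fun y => Real.exp (P y) * h y) volume 0 x := by
    intro x hx
    rw [intervalIntegrable_iff_integrableOn_Ioc_of_le hx.le]
    have hhx : IntegrableOn h (Ioc 0 x) := IntegrableOn.mono_set (t := Ioi 0) hh fun y hy => hy.1
    refine hhx.bdd_mul (c := Real.exp (P x)) ?_ ?_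
    · exact ((Real.continuous_exp.comp_continuousOn hPAC.continuousOn).mono
        fun y hy => hy.1).aestronglyMeasurable measurableSet_Ioc
    · filter_upwards [ae_restrict_mem measurableSet_Ioc] with y hy
      rw [Real.norm_of_nonneg (Real.exp_pos _).le]
      exact Real.exp_le_exp.2 (hPmono hy.1 hy.2)
  set H : ℝ → ℝ := fun x => ∫ y in (0 : ℝ)..x, Real.exp (P y) * h y with hH
  have hHAC : LocAC H := by
    intro x y hx hxy
    have hy := hx.trans_le hxy
    have := (hint0 hy).absolutelyContinuousOnInterval_intervalIntegral (c := 0) (by simp)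
    refine this.mono ?_
    rw [uIcc_of_le hxy, uIcc_of_le hy.le]
    exact Icc_subset_Icc hx.le le_rfl
  have hHder : ∀ᵐ x ∂posVol, HasDerivAt H (Real.exp (P x) * h x) x := by
    refine ae_posVol_of_forall_Icc fun n => ?_
    have hn : (0 : ℝ) < (n : ℝ) + 1 := by positivity
    have h2 := (hint0 hn).ae_hasDerivAt_integral
    rw [uIcc_of_le hn.le] at h2
    filter_upwards [h2] with x hx hxm
    have : 0 < 1 / ((n : ℝ) + 1) := by positivity
    exact hx ⟨this.le.trans hxm.1, hxm.2⟩ 0 ⟨le_rfl, hn.le⟩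
  set F : ℝ → ℝ := fun x => Real.exp (-P x) * H x with hFdef
  have hFAC : LocAC F := fun x y hx hxy => ((hPAC x y hx hxy).fun_neg.exp).fun_mul (hHAC x y hx hxy)
  refine ⟨fun x => F x * (1 / r x), F, hFAC, ?_, ?_, ?_, ?_, ?_⟩
  · intro x hx
    have := (hc.r_pos x hx).ne'
    field_simp
  · have hb : ∀ x, 0 < x → |F x| ≤ ∫ y in (0 : ℝ)..x, |h y| := by
      intro x hx
      have h1 : |H x| ≤ Real.exp (P x) * ∫ y in (0 : ℝ)..x, |h y| := by
        rw [← intervalIntegral.integral_const_mul]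
        refine (intervalIntegral.abs_integral_le_integral_abs hx.le).trans ?_
        have hhx : IntegrableOn h (Ioc 0 x) :=
          IntegrableOn.mono_set (t := Ioi 0) hh fun y hy => hy.1
        rw [intervalIntegral.integral_of_le hx.le, intervalIntegral.integral_of_le hx.le]
        refine setIntegral_mono_on ?_ (hhx.abs.const_mul _) measurableSet_Ioc fun y hy => ?_
        · have := (hint0 hx).abs
          rwa [intervalIntegrable_iff_integrableOn_Ioc_of_le hx.le] at this
        · rw [abs_mul, abs_of_pos (Real.exp_pos _)]
          gcongr
          exact hPmono hy.1 hy.2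
      simp only [hFdef]
      rw [abs_mul, abs_of_pos (Real.exp_pos _)]
      calc _ ≤ Real.exp (-P x) * (Real.exp (P x) * ∫ y in (0 : ℝ)..x, |h y|) := by gcongr
        _ = _ := by rw [← mul_assoc, ← Real.exp_add]; simp
    have hii : IntervalIntegrable (fun y => |h y|) volume 0 1 := by
      rw [intervalIntegrable_iff_integrableOn_Ioc_of_le zero_le_one]
      exact IntegrableOn.mono_set (t := Ioi 0) hh.abs fun x hx => hx.1
    have hlim : Tendsto (fun x => ∫ y in (0 : ℝ)..x, |h y|) (𝓝[>] 0) (𝓝 0) := by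
      have h2 := intervalIntegral.continuousOn_primitive_interval' hii
        (show (0 : ℝ) ∈ uIcc 0 1 by simp) 0 (by simp)
      rw [uIcc_of_le zero_le_one, ContinuousWithinAt, intervalIntegral.integral_same] at h2
      refine h2.mono_left ?_
      rw [← nhdsWithin_Ioo_eq_nhdsGT (zero_lt_one (α := ℝ))]
      exact nhdsWithin_mono _ Ioo_subset_Icc_self
    refine squeeze_zero_norm' ?_ hlim
    filter_upwards [self_mem_nhdsWithin] with x hx
    exact hb x hx
  · filter_upwards [hPder, hHder, ae_pos] with x h1 h2 hx
    have h3 : HasDerivAt F _ x := (h1.fun_neg.exp).mul h2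
    rw [h3.deriv]
    have := (hc.r_pos x hx).ne'
    have e : Real.exp (-P x) * (Real.exp (P x) * h x) = h x := by
      rw [← mul_assoc, ← Real.exp_add]; simp
    rw [e]
    simp only [hFdef, hk]
    ring
  · refine AEMeasurable.mul ?_ hc.aemeasurable_inv
    exact hFAC.continuousOn.aemeasurable measurableSet_Ioi
  · intro hpos x hx
    have h1 : 0 ≤ H x := by
      simp only [hH]
      rw [intervalIntegral.integral_of_le hx.le]
      refine integral_nonneg_of_ae ?_
      have : ∀ᵐ y ∂volume.restrict (Ioc 0 x), 0 ≤ h y :=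
        ae_restrict_of_ae_restrict_of_subset (fun y hy => hy.1) hpos
      filter_upwards [this] with y hy
      exact mul_nonneg (Real.exp_pos _).le hy
    exact mul_nonneg (mul_nonneg (Real.exp_pos _).le h1) (one_div_nonneg.2 (hc.r_pos x hx).le)

end TransportCoeff

end Transport


/-! ### The resolvent of the transport operator -/

section TransportResolvent

/-- A linear, total and bounded below relation is the graph of a bounded operator. -/
theorem exists_continuousLinearMap_of_relation {E : Type*} [NormedAddCommGroup E]
    [NormedSpace ℝ E] (Rel : E → E → Prop) {K : ℝ} (hK : 0 < K)
    (hlin : ∀ h u h' u', ∀ c : ℝ, Rel h u → Rel h' u' → Rel (h + c • h') (u + c • u'))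
    (htot : ∀ h, ∃ u, Rel h u) (hbd : ∀ h u, Rel h u → K * ‖u‖ ≤ ‖h‖) :
    ∃ R : E →L[ℝ] E, ∀ h, Rel h (R h) := by
  choose R hR using htot
  have huniq : ∀ h u v, Rel h u → Rel h v → u = v := by
    intro h u v hu hv
    have h1 := hbd _ _ (hlin _ _ _ _ (-1) hu hv)
    rw [neg_one_smul, neg_one_smul, add_neg_cancel, norm_zero, ← sub_eq_add_neg] at h1
    have h2 : ‖u - v‖ ≤ 0 := by
      by_contra hcon
      push Not at hcon
      nlinarith
    exact sub_eq_zero.1 (norm_le_zero_iff.1 h2)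
  have hadd : ∀ h h', R (h + h') = R h + R h' := by
    intro h h'
    have := hlin _ _ _ _ 1 (hR h) (hR h')
    rw [one_smul, one_smul] at this
    exact huniq _ _ _ (hR _) this
  have hzero : R 0 = 0 := by simpa using hadd 0 0
  have hsmul : ∀ (c : ℝ) h, R (c • h) = c • R h := by
    intro c h
    have := hlin _ _ _ _ c (hR 0) (hR h)
    rw [hzero, zero_add, zero_add] at this
    exact huniq _ _ _ (hR _) this
  refine ⟨LinearMap.mkContinuous ⟨⟨R, hadd⟩, hsmul⟩ K⁻¹ fun h => ?_, hR⟩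
  have := hbd _ _ (hR h)
  change ‖R h‖ ≤ _
  rw [inv_mul_eq_div, le_div_iff₀ hK, mul_comm]
  exact this

theorem coeFn_add_smul {m : ℝ} (u v : X m) (c : ℝ) :
    ∀ᵐ x ∂posVol, (u + c • v : X m) x = u x + c * v x := by
  rw [← ae_weightMeasure_iff (m := m)]
  filter_upwards [Lp.coeFn_add u (c • v), Lp.coeFn_smul c v] with x h1 h2
  rw [h1, Pi.add_apply, h2, Pi.smul_apply, smul_eq_mul]

theorem coeFn_toL1 {m : ℝ} {f : ℝ → ℝ} (hf : Integrable f (weightMeasure m)) :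
    ∀ᵐ x ∂posVol, (hf.toL1 f : X m) x = f x :=
  ae_weightMeasure_iff.1 hf.coeFn_toL1

theorem ext_posVol {m : ℝ} {u v : X m} (h : ∀ᵐ x ∂posVol, u x = v x) : u = v :=
  Lp.ext (ae_weightMeasure_iff.2 h)

theorem norm_eq_integral {m : ℝ} (f : X m) : ‖f‖ = ∫ x, |f x| ∂weightMeasure m := by
  simpa using L1.norm_eq_integral_norm f

theorem nonneg_iff {m : ℝ} (f : X m) : 0 ≤ f ↔ ∀ᵐ x ∂posVol, 0 ≤ f x := by
  rw [← ae_weightMeasure_iff (m := m), ← Lp.coeFn_nonneg]; rfl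

variable {r q : ℝ → ℝ} {m : ℝ}

theorem IsFlux.ae_deriv_add_mul {u v : X m} {F G : ℝ → ℝ} (hF : IsFlux r q m u F)
    (hG : IsFlux r q m v G) (c : ℝ) :
    ∀ᵐ x ∂posVol, deriv (fun x => F x + c * G x) x = deriv F x + c * deriv G x := by
  filter_upwards [LocAC.ae_differentiableAt hF.absCont, LocAC.ae_differentiableAt hG.absCont]
    with x h1 h2
  exact (h1.hasDerivAt.add (h2.hasDerivAt.const_mul c)).deriv

theorem IsFlux.add_smul {u v : X m} {F G : ℝ → ℝ} (hF : IsFlux r q m u F)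
    (hG : IsFlux r q m v G) (c : ℝ) :
    IsFlux r q m (u + c • v) fun x => F x + c * G x := by
  refine ⟨?_, ?_, ?_, ?_, ?_⟩
  · filter_upwards [coeFn_add_smul u v c, hF.ae_eq, hG.ae_eq] with x h1 h2 h3
    rw [h1, h2, h3]; ring
  · intro x y hx hxy
    exact (hF.absCont x y hx hxy).fun_add ((hG.absCont x y hx hxy).const_mul c)
  · refine (hF.deriv_mem.add (hG.deriv_mem.const_mul c)).congr ?_
    filter_upwards [ae_weightMeasure_iff.2 (hF.ae_deriv_add_mul hG c)] with x hx
    rw [hx]; rfl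
  · refine (hF.absorb_mem.add (hG.absorb_mem.const_mul c)).congr ?_
    filter_upwards [ae_weightMeasure_iff.2 (coeFn_add_smul u v c)] with x hx
    simp only [Pi.add_apply]
    rw [hx]; ring
  · intro h
    simpa using (hF.boundary h).add ((hG.boundary h).const_mul c)

/-- `(lam - T) u = h`, where `T` is the transport operator. -/
def TransportEq (r q : ℝ → ℝ) (m lam : ℝ) (h u : X m) : Prop :=
  ∃ F : ℝ → ℝ, IsFlux r q m u F ∧ ∀ᵐ x ∂posVol, h x = lam * u x + (deriv F x + q x * u x)

theorem TransportEq.add_smul {lam : ℝ} {h u h' u' : X m} (h₁ : TransportEq r q m lam h u)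
    (h₂ : TransportEq r q m lam h' u') (c : ℝ) :
    TransportEq r q m lam (h + c • h') (u + c • u') := by
  obtain ⟨F, hF, e₁⟩ := h₁
  obtain ⟨G, hG, e₂⟩ := h₂
  refine ⟨_, hF.add_smul hG c, ?_⟩
  filter_upwards [coeFn_add_smul u u' c, coeFn_add_smul h h' c, hF.ae_deriv_add_mul hG c, e₁, e₂]
    with x h1 h2 h3 h4 h5
  rw [h1, h2, h3, h4, h5]; ring

theorem integrable_absorb_abs (hq : ∀ x : ℝ, 0 < x → 0 ≤ q x) {f : ℝ → ℝ}
    (hf : Integrable (fun x => q x * f x) (weightMeasure m)) :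
    Integrable (fun x => q x * |f x|) (weightMeasure m) := by
  refine hf.abs.congr ?_
  filter_upwards [ae_weightMeasure_iff.2 ae_pos] with x hx
  rw [abs_mul, abs_of_nonneg (hq x hx)]

/-- The absorption integral is kept on the left with coefficient 1: it is what later pays for the
gain term. -/
theorem TransportEq.estimate (hc : TransportCoeff r q) (hm : 1 < m) {C lam : ℝ} (hC0 : 0 ≤ C)
    (hC : ∀ x : ℝ, 0 < x → r x * (m * x ^ (m - 1)) ≤ C * (1 + x ^ m)) (hlam : C ≤ lam)
    {h u : X m} (heq : TransportEq r q m lam h u) :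
    (lam - C) * ‖u‖ + ∫ x, q x * |u x| ∂weightMeasure m ≤ ‖h‖ := by
  obtain ⟨F, hF, e⟩ := heq
  have hlim := hc.tendsto_flux hF.absCont hF.ae_eq (integrable_posVol (integrable_coe u))
    (integrable_posVol hF.deriv_mem) hF.boundary
  have h1 := flux_estimate (by linarith) hc.r_pos hC hC0 hlam hc.q_nonneg hc.q_loc.1
    (aemeasurable_coe u) hF.absCont hF.ae_eq hlim (by
      filter_upwards [e] with x hx
      rw [hx]; ring) (integrable_coe h)
  rw [norm_eq_integral, norm_eq_integral]
  refine le_trans (le_of_eq ?_) h1.2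
  rw [← integral_const_mul, ← integral_add ((integrable_coe u).abs.const_mul _)
    (integrable_absorb_abs hc.q_nonneg hF.absorb_mem)]
  refine integral_congr_ae (Eventually.of_forall fun x => ?_)
  simp only
  ring

/-- The explicit solution has the right flux; `flux_estimate` bounds (λ - C + q)|u|, and since λ > C
this puts both u and q u in the weighted space. -/
theorem TransportEq.exists_nonneg (hc : TransportCoeff r q) (hm : 1 < m) {C lam : ℝ}
    (hC0 : 0 ≤ C) (hC : ∀ x : ℝ, 0 < x → r x * (m * x ^ (m - 1)) ≤ C * (1 + x ^ m))
    (hlam : C < lam) (h : X m) :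
    ∃ u : X m, TransportEq r q m lam h u ∧ (0 ≤ h → 0 ≤ u) := by
  obtain ⟨u, F, hF, hFu, hF0, hF', hum, hupos⟩ :=
    hc.exists_solution (hC0.trans hlam.le) (integrable_posVol (integrable_coe h))
  have hFu' : ∀ᵐ x ∂posVol, F x = r x * u x := by
    filter_upwards [ae_pos] with x hx using hFu x hx
  have hInt := (flux_estimate (by linarith) hc.r_pos hC hC0 hlam.le hc.q_nonneg hc.q_loc.1 hum hF
    hFu' hF0 hF' (integrable_coe h)).1
  have humm : AEStronglyMeasurable u (weightMeasure m) :=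
    aestronglyMeasurable_weightMeasure_iff.2 hum.aestronglyMeasurable
  have hu : Integrable u (weightMeasure m) := by
    refine (hInt.const_mul (lam - C)⁻¹).mono humm ?_
    filter_upwards [ae_weightMeasure_iff.2 ae_pos] with x hx
    have h1 := hc.q_nonneg x hx
    have h2 : 0 < lam - C := by linarith
    rw [norm_mul, norm_mul, norm_abs_eq_norm,
      Real.norm_of_nonneg (show 0 ≤ (lam - C)⁻¹ by positivity),
      Real.norm_of_nonneg (show 0 ≤ lam - C + q x by positivity), ← mul_assoc, mul_add, inv_mul_cancel₀ h2.ne']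
    have h3 : 0 ≤ (lam - C)⁻¹ * q x := by positivity
    nlinarith [norm_nonneg (u x)]
  have hqu : Integrable (fun x => q x * u x) (weightMeasure m) := by
    refine hInt.mono (aestronglyMeasurable_weightMeasure_iff.2
      (hc.q_loc.1.mul hum).aestronglyMeasurable) ?_
    filter_upwards [ae_weightMeasure_iff.2 ae_pos] with x hx
    have h1 := hc.q_nonneg x hx
    have h2 : 0 < lam - C := by linarith
    rw [norm_mul, norm_mul, norm_abs_eq_norm, Real.norm_of_nonneg h1,
      Real.norm_of_nonneg (show 0 ≤ lam - C + q x by positivity)]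
    nlinarith [norm_nonneg (u x)]
  have hae := coeFn_toL1 hu
  refine ⟨hu.toL1 u, ⟨F, ⟨?_, hF, ?_, ?_, fun _ => hF0⟩, ?_⟩, ?_⟩
  · filter_upwards [hFu', hae] with x h1 h2
    rw [h1, h2]
  · refine (((integrable_coe h).sub (hu.const_mul lam)).sub hqu).congr ?_
    filter_upwards [ae_weightMeasure_iff.2 hF'] with x hx
    rw [hx]
    simp only [Pi.sub_apply]
    ring
  · refine hqu.congr ?_
    filter_upwards [ae_weightMeasure_iff.2 hae] with x hx
    rw [hx]
  · filter_upwards [hF', hae] with x h1 h2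
    rw [h1, h2]; ring
  · intro hh
    rw [nonneg_iff] at hh ⊢
    filter_upwards [hae, ae_pos] with x h1 hx
    rw [h1]
    exact hupos hh x hx

/-- The resolvent of the transport operator. -/
theorem exists_transportResolvent (hc : TransportCoeff r q) (hm : 1 < m) {C lam : ℝ}
    (hC0 : 0 ≤ C) (hC : ∀ x : ℝ, 0 < x → r x * (m * x ^ (m - 1)) ≤ C * (1 + x ^ m))
    (hlam : C < lam) :
    ∃ R : X m →L[ℝ] X m, (∀ h, TransportEq r q m lam h (R h)) ∧ ∀ h, 0 ≤ h → 0 ≤ R h := by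
  have hqint : ∀ u : X m, 0 ≤ ∫ x, q x * |u x| ∂weightMeasure m := fun u => by
    refine integral_nonneg_of_ae ?_
    filter_upwards [ae_weightMeasure_iff.2 ae_pos] with x hx
    exact mul_nonneg (hc.q_nonneg x hx) (abs_nonneg _)
  obtain ⟨R, hR⟩ := exists_continuousLinearMap_of_relation (TransportEq r q m lam)
    (K := lam - C) (by linarith) (fun h u h' u' c h₁ h₂ => h₁.add_smul h₂ c)
    (fun h => (TransportEq.exists_nonneg hc hm hC0 hC hlam h).imp fun u hu => hu.1)
    (fun h u hu => by
      have h1 := hu.estimate hc hm hC0 hC hlam.le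
      linarith [hqint u])
  refine ⟨R, hR, fun h hh => ?_⟩
  obtain ⟨u, hu, hpos⟩ := TransportEq.exists_nonneg hc hm hC0 hC hlam h
  have h1 := ((hR h).add_smul hu (-1)).estimate hc hm hC0 hC hlam.le
  have h2 := hqint (R h + (-1 : ℝ) • u)
  rw [neg_one_smul, neg_one_smul, add_neg_cancel, norm_zero, ← sub_eq_add_neg] at h1
  rw [neg_one_smul, ← sub_eq_add_neg] at h2
  have h3 : ‖R h - u‖ ≤ 0 := by
    by_contra hcon
    push Not at hcon
    have : 0 < lam - C := by linarith
    nlinarith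
  rw [sub_eq_zero.1 (norm_le_zero_iff.1 h3)]
  exact hpos hh

end TransportResolvent

/-! ### The fragmentation operator -/

section Fragmentation

/-- Assumptions on the fragmentation rate and kernel: the gain term is bounded relative to the
loss term with relative bound `κ`. -/
structure FragBound (a : ℝ → ℝ) (b : ℝ → ℝ → ℝ) (m κ D : ℝ) : Prop where
  a_nonneg : ∀ x : ℝ, 0 < x → 0 ≤ a x
  a_meas : AEMeasurable a posVol
  b_meas : Measurable (Function.uncurry b)
  b_nonneg : ∀ x y : ℝ, 0 < x → 0 < y → 0 ≤ b x y
  bound : ∀ᵐ y ∂posVol, ENNReal.ofReal (a y) *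
    ∫⁻ x in Ioc 0 y, ENNReal.ofReal ((1 + x ^ m) * b x y) ≤
      ENNReal.ofReal ((κ * a y + D) * (1 + y ^ m))

/-- The gain term `∫_x^∞ a(y) b(x, y) u(y) dy`. -/
def fragOp (a : ℝ → ℝ) (b : ℝ → ℝ → ℝ) (u : ℝ → ℝ) (x : ℝ) : ℝ :=
  ∫ y in Ioi x, a y * b x y * u y

/-- The kernel of the gain term, as a function on the quadrant. -/
def fragKernel (a : ℝ → ℝ) (b : ℝ → ℝ → ℝ) (u : ℝ → ℝ) : ℝ × ℝ → ℝ :=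
  {p : ℝ × ℝ | p.1 < p.2}.indicator fun p => a p.2 * b p.1 p.2 * u p.2

variable {a : ℝ → ℝ} {b : ℝ → ℝ → ℝ} {m κ D : ℝ} {u v : ℝ → ℝ}

theorem fragKernel_section (x : ℝ) :
    (fun y => fragKernel a b u (x, y)) = (Ioi x).indicator fun y => a y * b x y * u y := by
  ext y
  simp [fragKernel, indicator]

theorem integral_fragKernel {x : ℝ} (hx : 0 < x) :
    ∫ y, fragKernel a b u (x, y) ∂posVol = fragOp a b u x := by
  rw [fragKernel_section, integral_indicator measurableSet_Ioi, fragOp,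
    Measure.restrict_restrict_of_subset (Ioi_subset_Ioi hx.le)]

instance instSFiniteWeightMeasure : SFinite (weightMeasure m) := by
  unfold weightMeasure; infer_instance

theorem aestronglyMeasurable_fragKernel (hb : FragBound a b m κ D) (hu : AEMeasurable u posVol) :
    AEStronglyMeasurable (fragKernel a b u) ((weightMeasure m).prod posVol) := by
  refine AEMeasurable.aestronglyMeasurable (AEMeasurable.indicator ?_
    (measurableSet_lt measurable_fst measurable_snd))
  exact ((hb.a_meas.comp_snd).mul hb.b_meas.aemeasurable).mul hu.comp_snd

/-- Tonelli: integrating first in x, against the weight, turns the kernel into the quantity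
controlled by `FragBound.bound`, which already carries the weight in y. Extended integrals avoid any
prior integrability. -/
theorem lintegral_fragKernel_le (hb : FragBound a b m κ D) (hu : AEMeasurable u posVol) :
    ∫⁻ p, ‖fragKernel a b u p‖ₑ ∂(weightMeasure m).prod posVol ≤
      ∫⁻ y, ENNReal.ofReal (κ * a y + D) * ‖u y‖ₑ ∂weightMeasure m := by
  rw [lintegral_prod_symm _ (aestronglyMeasurable_fragKernel hb hu).enorm, lintegral_weightMeasure]
  refine lintegral_mono_ae ?_
  filter_upwards [hb.bound, ae_pos] with y hy hy0
  have h1 : ∫⁻ x, ‖fragKernel a b u (x, y)‖ₑ ∂weightMeasure m ≤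
      ENNReal.ofReal (a y) * (∫⁻ x in Ioc 0 y, ENNReal.ofReal ((1 + x ^ m) * b x y)) * ‖u y‖ₑ := by
    rw [lintegral_weightMeasure, ← lintegral_const_mul', ← lintegral_mul_const',
      ← lintegral_indicator measurableSet_Ioc, ← lintegral_indicator measurableSet_Ioi]
    · refine lintegral_mono fun x => ?_
      by_cases hx : 0 < x
      · rw [indicator_of_mem (show x ∈ Ioi 0 from hx)]
        by_cases hxy : x < y
        · rw [indicator_of_mem (show x ∈ Ioc 0 y from ⟨hx, hxy.le⟩), fragKernel,
            indicator_of_mem (show (x, y) ∈ {p : ℝ × ℝ | p.1 < p.2} from hxy)]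
          simp only
          rw [enorm_mul, enorm_mul, Real.enorm_of_nonneg (hb.a_nonneg y hy0),
            Real.enorm_of_nonneg (hb.b_nonneg x y hx hy0),
            ENNReal.ofReal_mul (weight_pos m hx).le]
          refine le_of_eq ?_
          ring
        · rw [fragKernel,
            indicator_of_notMem (show (x, y) ∉ {p : ℝ × ℝ | p.1 < p.2} from hxy)]
          simp
      · rw [indicator_of_notMem (show x ∉ Ioi 0 from hx)]
        exact zero_le
    · simp
    · simp
  refine h1.trans ?_
  calc _ ≤ ENNReal.ofReal ((κ * a y + D) * (1 + y ^ m)) * ‖u y‖ₑ := by gcongr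
    _ = _ := by
      rw [mul_comm (κ * a y + D), ENNReal.ofReal_mul (weight_pos m hy0).le]; ring

theorem integrable_fragKernel (hb : FragBound a b m κ D) (hκ : 0 ≤ κ) (hD : 0 ≤ D)
    (hu : Integrable (fun y => (κ * a y + D) * |u y|) (weightMeasure m))
    (hum : AEMeasurable u posVol) :
    Integrable (fragKernel a b u) ((weightMeasure m).prod posVol) ∧
    ∫ p, ‖fragKernel a b u p‖ ∂(weightMeasure m).prod posVol ≤
      ∫ y, (κ * a y + D) * |u y| ∂weightMeasure m := by
  have hpos : ∀ᵐ y ∂weightMeasure m, 0 ≤ κ * a y + D := by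
    filter_upwards [ae_weightMeasure_iff.2 ae_pos] with y hy
    have := hb.a_nonneg y hy
    positivity
  have hpos' : ∀ᵐ y ∂weightMeasure m, 0 ≤ (κ * a y + D) * |u y| := by
    filter_upwards [hpos] with y hy
    positivity
  have hle := lintegral_fragKernel_le hb hum
  have heq : ∫⁻ y, ENNReal.ofReal (κ * a y + D) * ‖u y‖ₑ ∂weightMeasure m =
      ENNReal.ofReal (∫ y, (κ * a y + D) * |u y| ∂weightMeasure m) := by
    rw [ofReal_integral_eq_lintegral_ofReal hu hpos']
    refine lintegral_congr_ae ?_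
    filter_upwards [hpos] with y hy
    rw [ENNReal.ofReal_mul hy, Real.enorm_eq_ofReal_abs]
  rw [heq] at hle
  have hInt : Integrable (fragKernel a b u) ((weightMeasure m).prod posVol) :=
    ⟨aestronglyMeasurable_fragKernel hb hum, hle.trans_lt ENNReal.ofReal_lt_top⟩
  refine ⟨hInt, ?_⟩
  rw [integral_norm_eq_lintegral_enorm hInt.1]
  exact ENNReal.toReal_le_of_le_ofReal (integral_nonneg_of_ae hpos') hle

theorem fragOp_bound (hb : FragBound a b m κ D) (hκ : 0 ≤ κ) (hD : 0 ≤ D)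
    (hu : Integrable (fun y => (κ * a y + D) * |u y|) (weightMeasure m))
    (hum : AEMeasurable u posVol) :
    (∀ᵐ x ∂posVol, IntegrableOn (fun y => a y * b x y * u y) (Ioi x)) ∧
    Integrable (fragOp a b u) (weightMeasure m) ∧
    ∫ x, |fragOp a b u x| ∂weightMeasure m ≤ ∫ y, (κ * a y + D) * |u y| ∂weightMeasure m := by
  obtain ⟨hInt, hle⟩ := integrable_fragKernel hb hκ hD hu hum
  have hae : (fun x => ∫ y, fragKernel a b u (x, y) ∂posVol) =ᵐ[weightMeasure m]
      fragOp a b u := by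
    filter_upwards [ae_weightMeasure_iff.2 ae_pos] with x hx using integral_fragKernel hx
  refine ⟨?_, hInt.integral_prod_left.congr hae, ?_⟩
  · filter_upwards [ae_weightMeasure_iff.1 hInt.prod_right_ae, ae_pos] with x h1 hx
    rw [fragKernel_section, integrable_indicator_iff measurableSet_Ioi, IntegrableOn,
      Measure.restrict_restrict_of_subset (Ioi_subset_Ioi hx.le)] at h1
    exact h1
  · refine le_trans ?_ hle
    rw [integral_prod _ hInt.norm]
    refine integral_mono_ae ((hInt.integral_prod_left.congr hae).abs) hInt.norm.integral_prod_left ?_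
    filter_upwards [hae] with x hx
    rw [← hx]
    exact norm_integral_le_integral_norm fun y => fragKernel a b u (x, y)

theorem fragOp_congr (h : ∀ᵐ x ∂posVol, u x = v x) {x : ℝ} (hx : 0 < x) :
    fragOp a b u x = fragOp a b v x := by
  refine integral_congr_ae ?_
  have : ∀ᵐ y ∂volume.restrict (Ioi x), u y = v y :=
    ae_restrict_of_ae_restrict_of_subset (Ioi_subset_Ioi hx.le) h
  filter_upwards [this] with y hy
  rw [hy]

theorem integrableOn_fragOp_congr (h : ∀ᵐ x ∂posVol, u x = v x) {x : ℝ} (hx : 0 < x)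
    (hu : IntegrableOn (fun y => a y * b x y * u y) (Ioi x)) :
    IntegrableOn (fun y => a y * b x y * v y) (Ioi x) := by
  refine Integrable.congr hu ?_
  have : ∀ᵐ y ∂volume.restrict (Ioi x), u y = v y :=
    ae_restrict_of_ae_restrict_of_subset (Ioi_subset_Ioi hx.le) h
  filter_upwards [this] with y hy
  rw [hy]

theorem fragOp_add_smul {x c : ℝ} (hu : IntegrableOn (fun y => a y * b x y * u y) (Ioi x))
    (hv : IntegrableOn (fun y => a y * b x y * v y) (Ioi x)) :
    IntegrableOn (fun y => a y * b x y * (u y + c * v y)) (Ioi x) ∧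
    fragOp a b (fun y => u y + c * v y) x = fragOp a b u x + c * fragOp a b v x := by
  have h1 : (fun y => a y * b x y * (u y + c * v y)) =
      fun y => a y * b x y * u y + c * (a y * b x y * v y) := by
    ext y; ring
  refine ⟨?_, ?_⟩
  · rw [h1]; exact hu.add (hv.const_mul c)
  · rw [fragOp, h1, integral_add hu (hv.const_mul c), integral_const_mul]; rfl

theorem fragOp_nonneg (hb : FragBound a b m κ D) (h : ∀ᵐ x ∂posVol, 0 ≤ u x) {x : ℝ}
    (hx : 0 < x) : 0 ≤ fragOp a b u x := by
  refine integral_nonneg_of_ae ?_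
  have : ∀ᵐ y ∂volume.restrict (Ioi x), 0 ≤ u y :=
    ae_restrict_of_ae_restrict_of_subset (Ioi_subset_Ioi hx.le) h
  filter_upwards [this, ae_restrict_mem measurableSet_Ioi] with y hy hyx
  have hy0 := hx.trans hyx
  exact mul_nonneg (mul_nonneg (hb.a_nonneg y hy0) (hb.b_nonneg x y hx hy0)) hy

end Fragmentation


/-! ### The resolvent of the growth–fragmentation operator -/

section GrowthFragResolvent

variable {r a a₁ : ℝ → ℝ} {b : ℝ → ℝ → ℝ} {m κ D : ℝ}

theorem graphG.add_smul {f g f' g' : X m} (h : graphG r a a₁ b m f g)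
    (h' : graphG r a a₁ b m f' g') (c : ℝ) :
    graphG r a a₁ b m (f + c • f') (g + c • g') := by
  obtain ⟨F, hF, hi, e⟩ := h
  obtain ⟨F', hF', hi', e'⟩ := h'
  have hsum := coeFn_add_smul f f' c
  have hlin : ∀ᵐ x ∂posVol, IntegrableOn (fun y => a y * b x y * (f + c • f' : X m) y) (Ioi x) ∧
      fragOp a b (f + c • f' : X m) x = fragOp a b f x + c * fragOp a b f' x := by
    filter_upwards [hi, hi', ae_pos] with x h1 h2 hx
    obtain ⟨h3, h4⟩ := fragOp_add_smul (c := c) h1 h2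
    have hsum' : ∀ᵐ x ∂posVol, f x + c * f' x = (f + c • f' : X m) x := by
      filter_upwards [hsum] with x hx using hx.symm
    exact ⟨integrableOn_fragOp_congr hsum' hx h3, by rw [fragOp_congr hsum hx, h4]⟩
  refine ⟨_, hF.add_smul hF' c, hlin.mono fun x hx => hx.1, ?_⟩
  filter_upwards [hlin, hsum, coeFn_add_smul g g' c, hF.ae_deriv_add_mul hF' c, e, e']
    with x h1 h2 h3 h4 h5 h6
  have h7 := h1.2
  rw [fragOp, fragOp, fragOp] at h7
  rw [h3, h4, h7, h2, h5, h6]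
  ring

/-- The gain term is controlled by the absorption term. -/
theorem fragOp_bound_of_absorb (hb : FragBound a b m κ D) (hκ : 0 ≤ κ) (hD : 0 ≤ D)
    (ha₁ : ∀ x : ℝ, 0 < x → 0 ≤ a₁ x) {u : X m}
    (hu : Integrable (fun x => (a x + a₁ x) * u x) (weightMeasure m)) :
    (∀ᵐ x ∂posVol, IntegrableOn (fun y => a y * b x y * u y) (Ioi x)) ∧
    Integrable (fragOp a b u) (weightMeasure m) ∧
    ∫ x, |fragOp a b u x| ∂weightMeasure m ≤
      κ * (∫ x, (a x + a₁ x) * |u x| ∂weightMeasure m) + D * ‖u‖ := by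
  have hq : Integrable (fun x => (a x + a₁ x) * |u x|) (weightMeasure m) :=
    integrable_absorb_abs (fun x hx => add_nonneg (hb.a_nonneg x hx) (ha₁ x hx)) hu
  have hum := aemeasurable_coe u
  have hau : Integrable (fun x => a x * |u x|) (weightMeasure m) := by
    refine hq.mono (aestronglyMeasurable_weightMeasure_iff.2 (hb.a_meas.mul
      (continuous_abs.measurable.comp_aemeasurable hum)).aestronglyMeasurable) ?_
    filter_upwards [ae_weightMeasure_iff.2 ae_pos] with x hx
    have h1 := hb.a_nonneg x hx
    have h2 := ha₁ x hx
    rw [norm_mul, norm_mul, Real.norm_of_nonneg h1, Real.norm_of_nonneg (add_nonneg h1 h2)]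
    gcongr
    linarith
  have hsplit : (fun y => (κ * a y + D) * |u y|) = fun y => κ * (a y * |u y|) + D * |u y| := by
    ext y; ring
  have hInt : Integrable (fun y => (κ * a y + D) * |u y|) (weightMeasure m) := by
    rw [hsplit]
    exact (hau.const_mul κ).add ((integrable_coe u).abs.const_mul D)
  obtain ⟨h1, h2, h3⟩ := fragOp_bound hb hκ hD hInt hum
  refine ⟨h1, h2, h3.trans ?_⟩
  rw [hsplit, integral_add (hau.const_mul κ) ((integrable_coe u).abs.const_mul D),
    integral_const_mul, integral_const_mul, ← norm_eq_integral]
  refine add_le_add (mul_le_mul_of_nonneg_left (integral_mono_ae hau hq ?_) hκ) le_rfl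
  filter_upwards [ae_weightMeasure_iff.2 ae_pos] with x hx
  have h1 := ha₁ x hx
  gcongr
  linarith

/-- Every element of the domain has an image under the growth–fragmentation operator. -/
theorem exists_graphG (hb : FragBound a b m κ D) (hκ : 0 ≤ κ) (hD : 0 ≤ D)
    (ha₁ : ∀ x : ℝ, 0 < x → 0 ≤ a₁ x) {u : X m} (hu : u ∈ domG r a a₁ m) :
    ∃ g, graphG r a a₁ b m u g := by
  obtain ⟨F, hF⟩ := hu
  obtain ⟨h1, h2, -⟩ := fragOp_bound_of_absorb hb hκ hD ha₁ hF.absorb_mem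
  have hInt := (hF.deriv_mem.neg.sub hF.absorb_mem).add h2
  refine ⟨hInt.toL1 _, F, hF, h1, ?_⟩
  filter_upwards [coeFn_toL1 hInt] with x hx
  rw [hx]; rfl

/-- The gain term is moved into the source of the transport equation. Its part κ‖q u‖ is absorbed by
the left side of `TransportEq.estimate` because κ ≤ 1, and D‖u‖ shifts the constant from C to C + D.
This bound gives both injectivity of λ - G and the Hille–Yosida norm. -/
theorem graphG.estimate (hc : TransportCoeff r fun x => a x + a₁ x) (hb : FragBound a b m κ D)
    (hκ : 0 ≤ κ) (hκ1 : κ ≤ 1) (hD : 0 ≤ D) (ha₁ : ∀ x : ℝ, 0 < x → 0 ≤ a₁ x) (hm : 1 < m)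
    {C lam : ℝ} (hC0 : 0 ≤ C)
    (hC : ∀ x : ℝ, 0 < x → r x * (m * x ^ (m - 1)) ≤ C * (1 + x ^ m)) (hlam : C ≤ lam)
    {u g : X m} (h : graphG r a a₁ b m u g) :
    (lam - (C + D)) * ‖u‖ ≤ ‖lam • u - g‖ := by
  obtain ⟨F, hF, hi, e⟩ := h
  obtain ⟨h1, h2, h3⟩ := fragOp_bound_of_absorb hb hκ hD ha₁ hF.absorb_mem
  set B : X m := h2.toL1 _ with hB
  have hBe := coeFn_toL1 h2
  have hnorm : ‖B‖ = ∫ x, |fragOp a b u x| ∂weightMeasure m := by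
    rw [norm_eq_integral]
    refine integral_congr_ae ?_
    filter_upwards [ae_weightMeasure_iff.2 hBe] with x hx
    rw [hx]
  have heq : TransportEq r (fun x => a x + a₁ x) m lam ((lam • u - g) + B) u := by
    refine ⟨F, hF, ?_⟩
    have e1 := ae_weightMeasure_iff.1 (Lp.coeFn_add (lam • u - g) B)
    have e2 := ae_weightMeasure_iff.1 (Lp.coeFn_sub (lam • u) g)
    have e3 := ae_weightMeasure_iff.1 (Lp.coeFn_smul lam u)
    filter_upwards [e, hBe, e1, e2, e3] with x h4 h5 h6 h7 h8
    rw [h6, Pi.add_apply, h7, Pi.sub_apply, h8, Pi.smul_apply, smul_eq_mul, h5, h4, fragOp]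
    ring
  have hest := heq.estimate hc hm hC0 hC hlam
  have hq0 : 0 ≤ ∫ x, (a x + a₁ x) * |u x| ∂weightMeasure m := by
    refine integral_nonneg_of_ae ?_
    filter_upwards [ae_weightMeasure_iff.2 ae_pos] with x hx
    exact mul_nonneg (hc.q_nonneg x hx) (abs_nonneg _)
  have h4 := norm_add_le (lam • u - g) B
  have h5 := mul_le_of_le_one_left hq0 hκ1
  rw [hnorm] at h4
  linarith

/-- The resolvent of the growth–fragmentation operator. -/
theorem exists_resolventG (hc : TransportCoeff r fun x => a x + a₁ x) (hb : FragBound a b m κ D)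
    (hκ : 0 < κ) (hκ1 : κ < 1) (hD : 0 ≤ D) (ha₁ : ∀ x : ℝ, 0 < x → 0 ≤ a₁ x) (hm : 1 < m)
    {C lam : ℝ} (hC0 : 0 ≤ C)
    (hC : ∀ x : ℝ, 0 < x → r x * (m * x ^ (m - 1)) ≤ C * (1 + x ^ m)) (hlam : C + D / κ < lam) :
    ∃ R : X m →L[ℝ] X m, (∀ f g, graphG r a a₁ b m f g ↔ R (lam • f - g) = f) ∧
      ‖R‖ ≤ (lam - (C + D))⁻¹ ∧ ∀ h, 0 ≤ h → 0 ≤ R h := by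
  have hDκ : D ≤ D / κ := by
    rw [le_div_iff₀ hκ]
    nlinarith
  have hlamC : C < lam := by linarith
  -- The threshold C + D/κ is chosen for this inequality: then κ‖q u‖ + D‖u‖ ≤ κ(‖q u‖ + (λ - C)‖u‖)
  -- ≤ κ‖h‖ for u = R h.
  have hlamD : D ≤ κ * (lam - C) := by
    have : D / κ ≤ lam - C := by linarith
    rw [div_le_iff₀ hκ] at this
    linarith
  obtain ⟨R, hR, hRpos⟩ := exists_transportResolvent hc hm hC0 hC hlamC
  have hfrag : ∀ h : X m, (∀ᵐ x ∂posVol, IntegrableOn (fun y => a y * b x y * R h y) (Ioi x)) ∧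
      Integrable (fragOp a b (R h)) (weightMeasure m) ∧
      ∫ x, |fragOp a b (R h) x| ∂weightMeasure m ≤ κ * ‖h‖ := by
    intro h
    obtain ⟨F, hF, -⟩ := hR h
    obtain ⟨h1, h2, h3⟩ := fragOp_bound_of_absorb hb hκ.le hD ha₁ hF.absorb_mem
    refine ⟨h1, h2, h3.trans ?_⟩
    have hest := mul_le_mul_of_nonneg_left ((hR h).estimate hc hm hC0 hC hlamC.le) hκ.le
    have := mul_le_mul_of_nonneg_right hlamD (norm_nonneg (R h))
    linarith
  have hKbd : ∀ h k : X m, (∀ᵐ x ∂posVol, k x = fragOp a b (R h) x) → ‖k‖ ≤ κ * ‖h‖ := by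
    intro h k hk
    rw [norm_eq_integral k]
    refine le_trans (le_of_eq ?_) (hfrag h).2.2
    refine integral_congr_ae ?_
    filter_upwards [ae_weightMeasure_iff.2 hk] with x hx
    rw [hx]
  obtain ⟨K, hK⟩ := exists_continuousLinearMap_of_relation
    (fun h k : X m => ∀ᵐ x ∂posVol, k x = fragOp a b (R h) x) (inv_pos.2 hκ)
    (fun h k h' k' c hk hk' => by
      have hsum := coeFn_add_smul (R h) (R h') c
      filter_upwards [hk, hk', coeFn_add_smul k k' c, (hfrag h).1, (hfrag h').1, ae_pos]
        with x e1 e2 e3 e4 e5 hx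
      rw [e3, e1, e2, map_add, map_smul, fragOp_congr hsum hx, (fragOp_add_smul e4 e5).2])
    (fun h => ⟨(hfrag h).2.1.toL1 _, coeFn_toL1 (hfrag h).2.1⟩)
    (fun h k hk => by
      rw [inv_mul_le_iff₀ hκ]
      exact hKbd h k hk)
  have hKnorm : ‖K‖ < 1 :=
    (ContinuousLinearMap.opNorm_le_bound _ hκ.le fun h => hKbd h _ (hK h)).trans_lt hκ1
  have hKpos : ∀ h, 0 ≤ h → 0 ≤ K h := by
    intro h hh
    rw [nonneg_iff]
    filter_upwards [hK h, ae_pos] with x h1 hx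
    rw [h1]
    exact fragOp_nonneg hb ((nonneg_iff _).1 (hRpos h hh)) hx
  -- K is B R(λ,T), so λ - G = (1 - K)(λ - T) on D(T) and the resolvent is R J with J = (1 - K)⁻¹.
  -- The Neumann series also shows that J is positive.
  set J : X m →L[ℝ] X m := ∑' n : ℕ, K ^ n with hJ
  have hsum : Summable fun n : ℕ => K ^ n := summable_geometric_of_norm_lt_one hKnorm
  have hJinv : ∀ h, J h - K (J h) = h := by
    intro h
    have := mul_neg_geom_series K hKnorm
    have h1 := congrArg (fun T : X m →L[ℝ] X m => T h) this
    simpa [sub_mul] using h1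
  have hJpos : ∀ h, 0 ≤ h → 0 ≤ J h := by
    intro h hh
    have h1 := hsum.hasSum.mapL (ContinuousLinearMap.apply ℝ (X m) h)
    refine ge_of_tendsto h1 (Eventually.of_forall fun s => Finset.sum_nonneg fun n hn => ?_)
    clear hn
    simp only [ContinuousLinearMap.apply_apply]
    induction n with
    | zero => simpa using hh
    | succ n ih => rw [pow_succ']; exact hKpos _ ih
  have hsol : ∀ h, graphG r a a₁ b m (R (J h)) (lam • R (J h) - h) := by
    intro h
    obtain ⟨F, hF, e⟩ := hR (J h)
    refine ⟨F, hF, (hfrag (J h)).1, ?_⟩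
    have e2 := ae_weightMeasure_iff.1 (Lp.coeFn_sub (lam • R (J h)) h)
    have e3 := ae_weightMeasure_iff.1 (Lp.coeFn_smul lam (R (J h)))
    have e4 := ae_weightMeasure_iff.1 (Lp.coeFn_sub (J h) (K (J h)))
    rw [hJinv] at e4
    filter_upwards [e, hK (J h), e2, e3, e4] with x h1 h2 h3 h4 h5
    rw [h3, Pi.sub_apply, h4, Pi.smul_apply, smul_eq_mul, h5, Pi.sub_apply, h2, h1, fragOp]
    ring
  have hω : 0 < lam - (C + D) := by linarith
  have hest : ∀ u g, graphG r a a₁ b m u g → (lam - (C + D)) * ‖u‖ ≤ ‖lam • u - g‖ :=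
    fun u g h => h.estimate hc hb hκ.le hκ1.le hD ha₁ hm hC0 hC hlamC.le
  refine ⟨R.comp J, fun f g => ⟨fun h => ?_, fun h => ?_⟩, ?_, fun h hh => hRpos _ (hJpos _ hh)⟩
  · have h1 := hest _ _ ((hsol (lam • f - g)).add_smul h (-1))
    have h2 : lam • (R (J (lam • f - g)) + (-1 : ℝ) • f) -
        (lam • R (J (lam • f - g)) - (lam • f - g) + (-1 : ℝ) • g) = 0 := by
      rw [smul_add, smul_comm lam, neg_one_smul, neg_one_smul]; abel
    rw [h2, norm_zero] at h1
    have h3 : ‖R (J (lam • f - g)) + (-1 : ℝ) • f‖ ≤ 0 := by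
      by_contra hcon
      push Not at hcon
      nlinarith
    have h4 := norm_le_zero_iff.1 h3
    rw [neg_one_smul, ← sub_eq_add_neg] at h4
    exact sub_eq_zero.1 h4
  · have h1 := hsol (lam • f - g)
    have h2 : R (J (lam • f - g)) = f := h
    rw [h2, sub_sub_cancel] at h1
    exact h1
  · refine ContinuousLinearMap.opNorm_le_bound _ (inv_nonneg.2 hω.le) fun h => ?_
    have h1 := hest _ _ (hsol h)
    rw [sub_sub_cancel] at h1
    rw [inv_mul_eq_div, le_div_iff₀ hω, mul_comm]
    exact h1

end GrowthFragResolvent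


/-! ### Density of the domain -/

section Density

variable {r q : ℝ → ℝ} {m : ℝ}

theorem integrable_of_support_Icc {p : ℝ → ℝ} {x y : ℝ} (hx : 0 < x) (hxy : x ≤ y)
    (hp : IntegrableOn p (Icc x y)) (h0 : ∀ z, z ∉ Icc x y → p z = 0) :
    Integrable p (weightMeasure m) := by
  rw [integrable_weightMeasure_iff]
  have hW := (locAC_weight (m := m) x y hx hxy).continuousOn
  rw [uIcc_of_le hxy] at hW
  have h1 : IntegrableOn (fun z => (1 + z ^ m) * p z) (Icc x y) :=
    hp.continuousOn_mul hW isCompact_Icc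
  rw [integrableOn_iff_integrable_of_support_subset] at h1
  · exact h1.restrict
  · intro z hz
    by_contra hcon
    exact hz (by simp [h0 z hcon])

/-- Smooth functions supported in a compact subinterval of `(0, ∞)` are fluxes. -/
theorem exists_isFlux_of_contDiff (hc : TransportCoeff r q) {ψ : ℝ → ℝ} {x y : ℝ}
    (hx : 0 < x) (hxy : x ≤ y) (hψ : ContDiff ℝ 1 ψ) (h0 : ∀ z, z ∉ Ioo x y → ψ z = 0) :
    ∃ g : X m, IsFlux r q m g ψ ∧ ∀ᵐ z ∂posVol, g z = ψ z * (1 / r z) := by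
  have h0' : ∀ z, z ∉ Icc x y → ψ z = 0 := fun z hz => h0 z fun h => hz (Ioo_subset_Icc_self h)
  have hr := hc.integrableOn_inv (x := x) (y := y) hx
  have hg1 : IntegrableOn (fun z => ψ z * (1 / r z)) (Icc x y) :=
    hr.continuousOn_mul hψ.continuous.continuousOn isCompact_Icc
  have hg : Integrable (fun z => ψ z * (1 / r z)) (weightMeasure m) :=
    integrable_of_support_Icc hx hxy hg1 fun z hz => by rw [h0' z hz, zero_mul]
  have hae := coeFn_toL1 hg
  refine ⟨hg.toL1 _, ⟨?_, ?_, ?_, ?_, ?_⟩, hae⟩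
  · filter_upwards [hae, ae_pos] with z h1 hz
    have := (hc.r_pos z hz).ne'
    rw [h1]
    field_simp
  · intro s t _ _
    exact hψ.contDiffOn.absolutelyContinuousOnInterval
  · refine integrable_of_support_Icc hx hxy
      ((hψ.continuous_deriv le_rfl).continuousOn.integrableOn_Icc) fun z hz => ?_
    have : ψ =ᶠ[𝓝 z] fun _ => 0 := by
      filter_upwards [isClosed_Icc.isOpen_compl.mem_nhds hz] with t ht using h0' t ht
    rw [this.deriv_eq, deriv_const]
  · obtain ⟨M, hM⟩ := hc.q_loc.2 y
    have hsub : Icc x y ⊆ Ioc 0 y := fun z hz => ⟨hx.trans_le hz.1, hz.2⟩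
    have hM' : ∀ᵐ z ∂volume.restrict (Icc x y), ‖q z‖ ≤ M :=
      ae_restrict_of_ae_restrict_of_subset hsub hM
    have h1 : IntegrableOn (fun z => q z * (ψ z * (1 / r z))) (Icc x y) :=
      hg1.bdd_mul (hc.q_loc.1.mono_set fun z hz => hx.trans_le hz.1).aestronglyMeasurable hM'
    have h2 : Integrable (fun z => q z * (ψ z * (1 / r z))) (weightMeasure m) :=
      integrable_of_support_Icc hx hxy h1 fun z hz => by rw [h0' z hz]; ring
    refine h2.congr ?_
    filter_upwards [ae_weightMeasure_iff.2 hae] with z hz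
    rw [hz]
  · intro _
    refine tendsto_const_nhds.congr' ?_
    filter_upwards [Ioo_mem_nhdsGT hx] with z hz
    exact (h0 z fun h => absurd h.1 (not_lt.2 hz.2.le)).symm

theorem exists_truncation (f : X m) {ε : ℝ} (hε : 0 < ε) :
    ∃ α β : ℝ, 0 < α ∧ α < β ∧ ∫ x in (Ioc α β)ᶜ, |f x| ∂weightMeasure m < ε := by
  have hcov : AECover (weightMeasure m) atTop
      fun n : ℕ => Ioc (1 / ((n : ℝ) + 1)) ((n : ℝ) + 1) :=
    ⟨ae_weightMeasure_iff.2 aecover_posVol.1, fun n => measurableSet_Ioc⟩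
  have hInt := (integrable_coe f).abs
  have hlim := hcov.integral_tendsto_of_countably_generated hInt
  have hev := hlim.eventually (Ioi_mem_nhds (sub_lt_self (∫ x, |f x| ∂weightMeasure m) hε))
  obtain ⟨n, h1, h2⟩ := (hev.and (eventually_ge_atTop 1)).exists
  have hn : (1 : ℝ) ≤ n := by exact_mod_cast h2
  refine ⟨1 / ((n : ℝ) + 1), (n : ℝ) + 1, by positivity, ?_, ?_⟩
  · rw [div_lt_iff₀ (by positivity)]
    nlinarith
  · have h3 := integral_add_compl (μ := weightMeasure m)
      (measurableSet_Ioc (a := 1 / ((n : ℝ) + 1)) (b := (n : ℝ) + 1)) hInt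
    have h1 : _ < _ := h1
    linarith

/-- The functions ψ/r with ψ smooth and compactly supported in (0, ∞) lie in the domain. After
truncating f, approximating it by ψ/r in the weighted norm means approximating r f by ψ in L¹ of the
measure w/r, which is finite on compact intervals because 1/r is locally integrable; smooth
functions are dense there. The approximant need not vanish near 0, hence the bump function. Where r
f has been truncated to 0, the error is bounded by the same L¹ distance. -/
theorem dense_isFlux (hc : TransportCoeff r q) : Dense {f : X m | ∃ F, IsFlux r q m f F} := by
  intro f
  rw [Metric.mem_closure_iff]
  intro ε hε
  obtain ⟨α, β, hα, hαβ, htail⟩ := exists_truncation f (show 0 < ε / 2 by positivity)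
  set x := α / 2 with hx
  set y := β + α with hy
  have hx0 : 0 < x := by positivity
  have hxy : x ≤ y := by linarith
  set I := Icc x y with hI
  -- the measure `1 / r` on the enlarged interval
  set d : ℝ → NNReal := fun z => Real.toNNReal (1 / r z) with hd
  have hdm : AEMeasurable d ((weightMeasure m).restrict I) := by
    have h1 : AEMeasurable (fun z => 1 / r z) (weightMeasure m) :=
      (aestronglyMeasurable_weightMeasure_iff.2 hc.aemeasurable_inv.aestronglyMeasurable).aemeasurable
    exact h1.restrict.real_toNNReal
  have hdpos : ∀ z ∈ I, (d z : ℝ) = 1 / r z := fun z hz => by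
    rw [hd, Real.coe_toNNReal _ (one_div_nonneg.2 (hc.r_pos z (hx0.trans_le hz.1)).le)]
  have hrI : IntegrableOn (fun z => 1 / r z) I (weightMeasure m) := by
    have h1 : Integrable (I.indicator fun z => 1 / r z) (weightMeasure m) := by
      refine integrable_of_support_Icc hx0 hxy ?_ fun z hz => indicator_of_notMem hz _
      refine (hc.integrableOn_inv (x := x) (y := y) hx0).congr_fun (fun z hz => ?_)
        measurableSet_Icc
      rw [indicator_of_mem hz]
    rwa [integrable_indicator_iff measurableSet_Icc] at h1
  set ν : Measure ℝ := ((weightMeasure m).restrict I).withDensity fun z => (d z : ENNReal) with hν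
  have hfin : IsFiniteMeasure ν := by
    refine isFiniteMeasure_withDensity ?_
    have h1 : Integrable (fun z => (d z : ℝ)) ((weightMeasure m).restrict I) := by
      refine hrI.congr ?_
      filter_upwards [ae_restrict_mem measurableSet_Icc] with z hz
      rw [hdpos z hz]
    have h2 := h1.2.ne
    simpa [HasFiniteIntegral, enorm] using h2
  -- the function to be approximated
  set s := Ioc α β with hs
  have hsI : s ⊆ I := fun z hz => ⟨by have := hz.1; linarith, by have := hz.2; linarith⟩
  set φ₀ : ℝ → ℝ := s.indicator fun z => r z * f z with hφ₀
  have hφ₀int : Integrable φ₀ ν := by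
    rw [hν, integrable_withDensity_iff_integrable_smul₀ hdm]
    have h1 : IntegrableOn (s.indicator f) I (weightMeasure m) :=
      ((integrable_coe f).indicator measurableSet_Ioc).integrableOn
    refine Integrable.congr h1 ?_
    filter_upwards [ae_restrict_mem measurableSet_Icc] with z hz
    by_cases hzs : z ∈ s
    · have := (hc.r_pos z (hx0.trans_le hz.1)).ne'
      rw [hφ₀, indicator_of_mem hzs, indicator_of_mem hzs, NNReal.smul_def, hdpos z hz,
        smul_eq_mul]
      field_simp
    · rw [hφ₀, indicator_of_notMem hzs, indicator_of_notMem hzs, smul_zero]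
  obtain ⟨φ, -, hφs, hφle⟩ := (memLp_one_iff_integrable.2 hφ₀int).exist_eLpNorm_sub_le
    ENNReal.one_ne_top le_rfl (show 0 < ε / 4 by positivity)
  have hφs1 : ContDiff ℝ 1 φ := hφs.of_le (by exact_mod_cast le_top)
  -- the cut-off function
  let χ : ContDiffBump ((α + β) / 2) :=
    ⟨(β - α) / 2, (β - α) / 2 + α / 2, by linarith, by linarith⟩
  have hχ1 : ∀ z ∈ s, χ z = 1 := fun z hz => by
    refine χ.one_of_mem_closedBall ?_
    rw [Metric.mem_closedBall, Real.dist_eq, abs_le]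
    have h1 := hz.1
    have h2 := hz.2
    simp only [χ]
    constructor <;> linarith
  have hχ0 : ∀ z, z ∉ Ioo x y → χ z = 0 := fun z hz => by
    refine χ.zero_of_le_dist ?_
    rw [Real.dist_eq]
    simp only [χ]
    by_contra hcon
    push Not at hcon
    rw [abs_lt] at hcon
    exact hz ⟨by linarith, by linarith⟩
  obtain ⟨g, hgF, hgae⟩ := exists_isFlux_of_contDiff (m := m) hc (ψ := fun z => χ z * φ z) hx0 hxy
    ((χ.contDiff (n := 1)).mul hφs1) fun z hz => by rw [hχ0 z hz, zero_mul]
  refine ⟨g, ⟨_, hgF⟩, ?_⟩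
  -- the distance
  have hdiff : Integrable (fun z => φ₀ z - φ z) ν := by
    refine hφ₀int.sub ?_
    have : MemLp (φ₀ - φ) 1 ν :=
      ⟨(hφ₀int.1.sub hφs1.continuous.aestronglyMeasurable), hφle.trans_lt ENNReal.ofReal_lt_top⟩
    have h2 := hφ₀int.sub (memLp_one_iff_integrable.1 this)
    simpa using h2
  have hν2 : ∫ z, ‖φ₀ z - φ z‖ ∂ν ≤ ε / 4 := by
    rw [integral_norm_eq_lintegral_enorm hdiff.1, ← eLpNorm_one_eq_lintegral_enorm]
    exact ENNReal.toReal_le_of_le_ofReal (by positivity) hφle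
  have hνI : ∫ z in I, (1 / r z) * |φ₀ z - φ z| ∂weightMeasure m ≤ ε / 4 := by
    refine le_trans (le_of_eq ?_) hν2
    rw [hν, integral_withDensity_eq_integral_smul₀ hdm]
    refine setIntegral_congr_fun measurableSet_Icc fun z hz => ?_
    rw [NNReal.smul_def, hdpos z hz, smul_eq_mul, Real.norm_eq_abs]
  have hintI : IntegrableOn (fun z => (1 / r z) * |φ₀ z - φ z|) I (weightMeasure m) := by
    have h1 := hdiff.abs
    rw [hν, integrable_withDensity_iff_integrable_smul₀ hdm] at h1
    refine h1.congr ?_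
    filter_upwards [ae_restrict_mem measurableSet_Icc] with z hz
    rw [NNReal.smul_def, hdpos z hz, smul_eq_mul]
  have hmain : ∫ z, |f z - g z| ∂weightMeasure m ≤
      ∫ z, (sᶜ.indicator (fun z => |f z|) z + I.indicator (fun z => (1 / r z) * |φ₀ z - φ z|) z)
        ∂weightMeasure m := by
    refine integral_mono_ae ((integrable_coe f).sub (integrable_coe g)).abs
      (((integrable_coe f).abs.indicator measurableSet_Ioc.compl).add
        ((integrable_indicator_iff measurableSet_Icc).2 hintI)) ?_
    filter_upwards [ae_weightMeasure_iff.2 hgae, ae_weightMeasure_iff.2 ae_pos] with z h1 hz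
    have hr := hc.r_pos z hz
    rw [h1]
    by_cases hzs : z ∈ s
    · rw [indicator_of_notMem (notMem_compl_iff.2 hzs), indicator_of_mem (hsI hzs), hφ₀,
        indicator_of_mem hzs, hχ1 z hzs, zero_add]
      have : f z - 1 * φ z * (1 / r z) = (1 / r z) * (r z * f z - φ z) := by field_simp
      rw [this, abs_mul, abs_of_pos (one_div_pos.2 hr)]
    · rw [indicator_of_mem (show z ∈ sᶜ from hzs)]
      refine (abs_sub _ _).trans (add_le_add le_rfl ?_)
      by_cases hzI : z ∈ I
      · rw [indicator_of_mem hzI, hφ₀, indicator_of_notMem hzs, zero_sub, abs_neg, abs_mul,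
          abs_mul, abs_of_pos (one_div_pos.2 hr), abs_of_nonneg χ.nonneg, mul_comm]
        gcongr
        exact mul_le_of_le_one_left (abs_nonneg _) χ.le_one
      · rw [indicator_of_notMem hzI, hχ0 z fun h => hzI (Ioo_subset_Icc_self h)]
        simp
  rw [integral_add ((integrable_coe f).abs.indicator measurableSet_Ioc.compl)
    ((integrable_indicator_iff measurableSet_Icc).2 hintI),
    integral_indicator measurableSet_Ioc.compl, integral_indicator measurableSet_Icc] at hmain
  have hdist : dist f g = ∫ z, |f z - g z| ∂weightMeasure m := by
    rw [dist_eq_norm, norm_eq_integral]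
    refine integral_congr_ae ?_
    filter_upwards [Lp.coeFn_sub f g] with z hz
    rw [hz, Pi.sub_apply]
  rw [hdist]
  linarith

end Density


/-! ### Moments of the fragmentation kernel -/

section Moments

variable {a : ℝ → ℝ} {b : ℝ → ℝ → ℝ}

theorem integrableOn_moment {y : ℝ}
    (hInt : IntegrableOn (fun x => b x y) (Ioc 0 y)) {m : ℝ} (hm : 0 ≤ m) :
    IntegrableOn (fun x => b x y * x ^ m) (Ioc 0 y) := by
  refine hInt.mul_bdd (c := y ^ m) (by fun_prop) ?_
  filter_upwards [ae_restrict_mem measurableSet_Ioc] with x hx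
  rw [Real.norm_of_nonneg (Real.rpow_nonneg hx.1.le _)]
  exact Real.rpow_le_rpow hx.1.le hx.2 hm

/-- Interpolation between the moment of order one and the moment of order `m₀`. -/
theorem fragMoment_interpolate
    (hb_nonneg : ∀ x y : ℝ, 0 < x → 0 < y → 0 ≤ b x y)
    (hb_mass : ∀ y : ℝ, 0 < y → fragMoment b 1 y = y)
    (hb_int : ∀ y : ℝ, 0 < y → IntegrableOn (fun x => b x y) (Ioc 0 y))
    {m m₀ θ : ℝ} (hm₀ : 1 < m₀) (hm : 1 ≤ m) (hθ0 : 0 ≤ θ)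
    (hθ1 : θ ≤ 1) (hθ : θ * (m₀ - 1) ≤ m - 1) {y : ℝ} (hy : 0 < y) :
    fragMoment b m y ≤ (1 - θ) * y ^ m + θ * (y ^ (m - m₀) * fragMoment b m₀ y) := by
  have hi := fun {k : ℝ} (hk : 0 ≤ k) => integrableOn_moment (hb_int y hy) hk
  have hrhs : (1 - θ) * y ^ m + θ * (y ^ (m - m₀) * fragMoment b m₀ y) =
      ∫ x in Ioc 0 y, (((1 - θ) * y ^ (m - 1)) * (b x y * x ^ (1 : ℝ)) +
        (θ * y ^ (m - m₀)) * (b x y * x ^ m₀)) := by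
    rw [integral_add ((hi zero_le_one).const_mul _) ((hi (by linarith)).const_mul _),
      integral_const_mul, integral_const_mul]
    have h1 := hb_mass y hy
    rw [fragMoment] at h1
    rw [h1, fragMoment, mul_assoc, mul_assoc, ← Real.rpow_add_one hy.ne', sub_add_cancel]
  rw [hrhs, fragMoment]
  refine setIntegral_mono_on (hi (by linarith)) (((hi zero_le_one).const_mul _).add
    ((hi (by linarith)).const_mul _)) measurableSet_Ioc fun x hx => ?_
  have hx0 := hx.1
  set z := x / y with hz
  have hz0 : 0 < z := div_pos hx0 hy
  have hz1 : z ≤ 1 := (div_le_one hy).2 hx.2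
  have hxz : x = z * y := by rw [hz]; field_simp
  -- For z in (0, 1], a smaller exponent gives a larger power, and Bernoulli's inequality for the
  -- exponent θ ≤ 1 makes the result affine in z^(m₀-1).
  have hzineq : z ^ (m - 1) ≤ 1 - θ + θ * z ^ (m₀ - 1) := by
    calc z ^ (m - 1) ≤ z ^ ((m₀ - 1) * θ) :=
          Real.rpow_le_rpow_of_exponent_ge hz0 hz1 (by linarith)
      _ = (1 + (z ^ (m₀ - 1) - 1)) ^ θ := by rw [Real.rpow_mul hz0.le]; congr 1; ring
      _ ≤ 1 + θ * (z ^ (m₀ - 1) - 1) :=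
          rpow_one_add_le_one_add_mul_self
            (by have : 0 ≤ z ^ (m₀ - 1) := by positivity
                linarith) hθ0 hθ1
      _ = _ := by ring
  have hb := hb_nonneg x y hx0 hy
  have e1 : x ^ m = z ^ (m - 1) * (y ^ (m - 1) * x) := by
    rw [← mul_assoc, ← Real.mul_rpow hz0.le hy.le, ← hxz, ← Real.rpow_add_one hx0.ne',
      sub_add_cancel]
  have e2 : y ^ (m - m₀) * x ^ m₀ = z ^ (m₀ - 1) * (y ^ (m - 1) * x) := by
    have : x ^ m₀ = z ^ (m₀ - 1) * y ^ (m₀ - 1) * x := by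
      rw [← Real.mul_rpow hz0.le hy.le, ← hxz, ← Real.rpow_add_one hx0.ne', sub_add_cancel]
    rw [this, show m - 1 = (m - m₀) + (m₀ - 1) by ring, Real.rpow_add hy]
    ring
  have hpos : 0 ≤ b x y * (y ^ (m - 1) * x) := by positivity
  calc b x y * x ^ m = b x y * (y ^ (m - 1) * x) * z ^ (m - 1) := by rw [e1]; ring
    _ ≤ b x y * (y ^ (m - 1) * x) * (1 - θ + θ * z ^ (m₀ - 1)) := by gcongr
    _ = (1 - θ) * y ^ (m - 1) * (b x y * x ^ (1 : ℝ)) +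
        θ * b x y * (z ^ (m₀ - 1) * (y ^ (m - 1) * x)) := by rw [Real.rpow_one]; ring
    _ = _ := by rw [← e2]; ring

/-- With θ = 0 only mass conservation remains in the interpolation; the exponent 2 is a dummy. -/
theorem fragMoment_le
    (hb_nonneg : ∀ x y : ℝ, 0 < x → 0 < y → 0 ≤ b x y)
    (hb_mass : ∀ y : ℝ, 0 < y → fragMoment b 1 y = y)
    (hb_int : ∀ y : ℝ, 0 < y → IntegrableOn (fun x => b x y) (Ioc 0 y))
    {m : ℝ} (hm : 1 ≤ m) {y : ℝ} (hy : 0 < y) : fragMoment b m y ≤ y ^ m := by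
  have := fragMoment_interpolate hb_nonneg hb_mass hb_int (m₀ := 2) (θ := 0) (by norm_num)
    hm le_rfl zero_le_one (by linarith) hy
  simpa using this

/-- A defect c at the single exponent m₀ becomes a defect θc at any m > 1, where θ = min(1,
(m-1)/(m₀-1)) is the largest admissible interpolation weight. -/
theorem exists_fragMoment_le
    (hb_nonneg : ∀ x y : ℝ, 0 < x → 0 < y → 0 ≤ b x y)
    (hb_mass : ∀ y : ℝ, 0 < y → fragMoment b 1 y = y)
    (hb_int : ∀ y : ℝ, 0 < y → IntegrableOn (fun x => b x y) (Ioc 0 y))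
    {m : ℝ} (hm : 1 < m) (hliminf : ∃ m₀ : ℝ, 1 < m₀ ∧
      0 < liminf (fun y : ℝ => fragDefect b m₀ y / y ^ m₀) atTop) :
    ∃ κ : ℝ, 0 ≤ κ ∧ κ < 1 ∧ ∀ᶠ y in atTop, fragMoment b m y ≤ κ * y ^ m := by
  obtain ⟨m₀, hm₀, hlim⟩ := hliminf
  obtain ⟨c, hc0, hc⟩ := exists_between hlim
  -- A lower bound is needed to extract information from a real-valued `liminf`, ℝ being only
  -- conditionally complete.
  have hbdd : IsBoundedUnder (· ≥ ·) atTop fun y : ℝ => fragDefect b m₀ y / y ^ m₀ := by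
    refine isBoundedUnder_of_eventually_ge (a := 0) ?_
    filter_upwards [eventually_gt_atTop 0] with y hy
    have := fragMoment_le hb_nonneg hb_mass hb_int hm₀.le hy
    exact div_nonneg (by rw [fragDefect]; linarith) (by positivity)
  have hev := eventually_lt_of_lt_liminf hc hbdd
  set θ := min 1 ((m - 1) / (m₀ - 1)) with hθ
  have hθpos : 0 < θ := lt_min one_pos (div_pos (by linarith) (by linarith))
  refine ⟨max 0 (1 - θ * c), le_max_left _ _, max_lt one_pos ?_, ?_⟩
  · have : 0 < θ * c := by positivity
    linarith
  filter_upwards [hev, eventually_gt_atTop 0] with y h1 hy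
  have h2 := fragMoment_interpolate hb_nonneg hb_mass hb_int (θ := θ) hm₀ hm.le hθpos.le
    (min_le_left _ _) (by
      have : θ ≤ (m - 1) / (m₀ - 1) := min_le_right _ _
      rwa [le_div_iff₀ (by linarith)] at this) hy
  have hym : 0 < y ^ m := by positivity
  rw [lt_div_iff₀ (by positivity), fragDefect] at h1
  have h3 : y ^ (m - m₀) * fragMoment b m₀ y ≤ (1 - c) * y ^ m := by
    calc y ^ (m - m₀) * fragMoment b m₀ y ≤ y ^ (m - m₀) * ((1 - c) * y ^ m₀) := by
          gcongr; linarith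
      _ = (1 - c) * (y ^ (m - m₀) * y ^ m₀) := by ring
      _ = _ := by rw [← Real.rpow_add hy, sub_add_cancel]
  calc fragMoment b m y ≤ (1 - θ) * y ^ m + θ * ((1 - c) * y ^ m) := by
        have := mul_le_mul_of_nonneg_left h3 hθpos.le
        linarith
    _ = (1 - θ * c) * y ^ m := by ring
    _ ≤ _ := by
        gcongr
        exact le_max_right _ _

/-- For large y, the gap between κ₀ and κ = (κ₀ + 1)/2 absorbs n_0(y) ≤ 2b₀y^l, of lower order than
y^m since l < m. For bounded y, a is essentially bounded and the moments are at most Z; their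
product is D. -/
theorem exists_fragBound (hb_meas : Measurable (Function.uncurry b))
    (hb_nonneg : ∀ x y : ℝ, 0 < x → 0 < y → 0 ≤ b x y)
    (hb_mass : ∀ y : ℝ, 0 < y → fragMoment b 1 y = y)
    (hb_int : ∀ y : ℝ, 0 < y → IntegrableOn (fun x => b x y) (Ioc 0 y))
    (ha_nonneg : ∀ x : ℝ, 0 < x → 0 ≤ a x) (ha_loc : MemLinftyLoc a)
    {b₀ l m : ℝ} (hb₀ : 0 < b₀) (hl : 0 ≤ l)
    (hb_number : ∀ y : ℝ, 0 < y → fragMoment b 0 y ≤ b₀ * (1 + y ^ l))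
    (hliminf : ∃ m₀ : ℝ, 1 < m₀ ∧
      0 < liminf (fun y : ℝ => fragDefect b m₀ y / y ^ m₀) atTop) (hm : max 1 l < m) :
    ∃ κ D : ℝ, 0 < κ ∧ κ < 1 ∧ 0 ≤ D ∧ FragBound a b m κ D := by
  have hm1 : 1 < m := (le_max_left _ _).trans_lt hm
  have hml : l < m := (le_max_right _ _).trans_lt hm
  obtain ⟨κ₀, hκ₀, hκ₀1, hev⟩ := exists_fragMoment_le hb_nonneg hb_mass hb_int hm1 hliminf
  set κ := (κ₀ + 1) / 2 with hκ
  have hgap : 0 < κ - κ₀ := by rw [hκ]; linarith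
  have hev2 : ∀ᶠ y in atTop, fragMoment b 0 y + fragMoment b m y ≤ κ * (1 + y ^ m) := by
    have h1 := (tendsto_rpow_atTop (show 0 < m - l by linarith)).eventually_ge_atTop
      (2 * b₀ / (κ - κ₀))
    filter_upwards [hev, h1, eventually_ge_atTop 1] with y h2 h3 hy
    have hy0 : 0 < y := by linarith
    have h4 := hb_number y hy0
    have h5 : 1 ≤ y ^ l := Real.one_le_rpow hy hl
    rw [div_le_iff₀ hgap] at h3
    have h6 : 2 * b₀ * y ^ l ≤ (κ - κ₀) * y ^ m := by
      have h7 := mul_le_mul_of_nonneg_right h3 (show 0 ≤ y ^ l by positivity)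
      have h8 : y ^ (m - l) * y ^ l = y ^ m := by rw [← Real.rpow_add hy0, sub_add_cancel]
      calc _ ≤ y ^ (m - l) * (κ - κ₀) * y ^ l := h7
        _ = (κ - κ₀) * (y ^ (m - l) * y ^ l) := by ring
        _ = _ := by rw [h8]
    have h9 : b₀ * (1 + y ^ l) ≤ 2 * b₀ * y ^ l := by nlinarith
    have h10 : 0 < κ := by linarith
    linarith
  obtain ⟨Y, hY⟩ := eventually_atTop.1 hev2
  obtain ⟨A, hA⟩ := ha_loc.2 (max Y 1)
  set Z := b₀ * (1 + (max Y 1) ^ l) + (max Y 1) ^ m with hZ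
  have hY1 : 0 < max Y 1 := lt_max_of_lt_right one_pos
  have hZ0 : 0 ≤ Z := by positivity
  refine ⟨κ, |A| * Z, by linarith, by rw [hκ]; linarith, by positivity,
    ⟨ha_nonneg, ha_loc.1, hb_meas, hb_nonneg, ?_⟩⟩
  have hA' : ∀ᵐ y ∂posVol, y ∈ Ioc 0 (max Y 1) → |a y| ≤ A := by
    rw [ae_restrict_iff' measurableSet_Ioc] at hA
    exact ae_restrict_of_ae hA
  filter_upwards [hA', ae_pos] with y h1 hy
  have hi := fun {k : ℝ} (hk : 0 ≤ k) => integrableOn_moment (hb_int y hy) hk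
  have hlint : ∫⁻ x in Ioc 0 y, ENNReal.ofReal ((1 + x ^ m) * b x y) =
      ENNReal.ofReal (fragMoment b 0 y + fragMoment b m y) := by
    rw [fragMoment, fragMoment, ← integral_add (hi le_rfl) (hi (by linarith)),
      ofReal_integral_eq_lintegral_ofReal
        (f := fun x => b x y * x ^ (0 : ℝ) + b x y * x ^ m) ((hi le_rfl).add (hi (by linarith)))]
    · refine lintegral_congr fun x => ?_
      rw [Real.rpow_zero]
      congr 1
      ring
    · filter_upwards [ae_restrict_mem measurableSet_Ioc] with x hx
      have h2 := hb_nonneg x y hx.1 hy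
      have hx0 := hx.1
      simp only [Pi.zero_apply]
      positivity
  rw [hlint, ← ENNReal.ofReal_mul (ha_nonneg y hy)]
  refine ENNReal.ofReal_le_ofReal ?_
  have hay := ha_nonneg y hy
  have hw := weight_pos m hy
  have hym : 0 ≤ y ^ m := by positivity
  rcases le_or_gt (max Y 1) y with hYy | hYy
  · have h2 := hY y ((le_max_left _ _).trans hYy)
    have h3 := mul_le_mul_of_nonneg_left h2 hay
    have h4 : 0 ≤ |A| * Z * (1 + y ^ m) := by positivity
    linarith
  · have h2 : a y ≤ |A| := (le_abs_self _).trans ((h1 ⟨hy, hYy.le⟩).trans (le_abs_self _))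
    have h3 : fragMoment b 0 y + fragMoment b m y ≤ Z := by
      have h4 := hb_number y hy
      have h5 := fragMoment_le hb_nonneg hb_mass hb_int hm1.le hy
      have h6 : y ^ l ≤ (max Y 1) ^ l := Real.rpow_le_rpow hy.le hYy.le hl
      have h7 : y ^ m ≤ (max Y 1) ^ m := Real.rpow_le_rpow hy.le hYy.le (by linarith)
      have h8 := mul_le_mul_of_nonneg_left h6 hb₀.le
      rw [hZ]
      linarith
    have h4 : a y * (fragMoment b 0 y + fragMoment b m y) ≤ a y * Z := by gcongr
    have h5 : a y * Z ≤ |A| * Z := by gcongr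
    have h6 : 0 ≤ |A| * Z * y ^ m := by positivity
    have h7 : 0 ≤ κ * a y * (1 + y ^ m) := by
      have : 0 < κ := by linarith
      positivity
    linarith

end Moments


/-! ### Generation -/

section Generation

variable {r a a₁ : ℝ → ℝ} {b : ℝ → ℝ → ℝ} {m κ D : ℝ}

/-- The resolvents are recorded beside the semigroup because the regularization of domains uses
them. Positivity is the invariance of the closed cone of nonnegative functions in `hilleYosida`. -/
theorem exists_semigroupG (hc : TransportCoeff r fun x => a x + a₁ x)
    (hb : FragBound a b m κ D) (hκ : 0 < κ) (hκ1 : κ < 1) (hD : 0 ≤ D)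
    (ha₁ : ∀ x : ℝ, 0 < x → 0 ≤ a₁ x) (hm : 1 < m) :
    (∃ lam₀ : ℝ, ∀ lam, lam₀ < lam → ∃ R : X m →L[ℝ] X m,
      ∀ f g, graphG r a a₁ b m f g ↔ R (lam • f - g) = f) ∧
    ∃ S : ℝ → X m →L[ℝ] X m, IsSemigroupG r a a₁ b m S ∧ ∀ t, 0 ≤ t → ∀ f, 0 ≤ f → 0 ≤ S t f := by
  obtain ⟨C, hC0, hC⟩ := hc.exists_growth_bound hm
  have hres : ∀ lam, C + D / κ < lam → ∃ R : X m →L[ℝ] X m,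
      (∀ f g, graphG r a a₁ b m f g ↔ R (lam • f - g) = f) ∧
      ‖R‖ ≤ (lam - (C + D))⁻¹ ∧ ∀ h, 0 ≤ h → 0 ≤ R h := fun lam hlam =>
    exists_resolventG hc hb hκ hκ1 hD ha₁ hm hC0 hC hlam
  refine ⟨⟨C + D / κ, fun lam hlam => (hres lam hlam).imp fun R hR => hR.1⟩, ?_⟩
  have hDκ : D ≤ D / κ := by
    rw [le_div_iff₀ hκ]
    nlinarith
  choose R hR using hres
  have hdom : {f : X m | ∃ g, graphG r a a₁ b m f g} = domG r a a₁ m := by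
    ext f
    exact ⟨fun ⟨g, F, hF, _⟩ => ⟨F, hF⟩, fun hf => exists_graphG hb hκ.le hD ha₁ hf⟩
  set R' : ℝ → X m →L[ℝ] X m := fun lam => if h : C + D / κ < lam then R lam h else 0 with hR'
  have hR'eq : ∀ lam (h : C + D / κ < lam), R' lam = R lam h := fun lam h => by
    simp only [hR', dif_pos h]
  obtain ⟨S, hS, hgen, hpos⟩ := hilleYosida (graphG r a a₁ b m) (C + D) (C + D / κ) (by linarith)
    R' (fun lam h f g => by rw [hR'eq lam h]; exact (hR lam h).1 f g)
    (fun lam h => by rw [hR'eq lam h]; exact (hR lam h).2.1)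
    (by rw [hdom]; exact dense_isFlux hc)
  refine ⟨S, ⟨hS, fun f => ?_, hgen⟩, fun t ht f hf => ?_⟩
  · simp only [hgen]
    rw [← hdom]
    rfl
  · refine hpos (Ici 0) isClosed_Ici (mem_Ici.2 le_rfl) (fun f hf g hg => mem_Ici.2
      (add_nonneg hf hg)) (fun c hc f hf => mem_Ici.2 ?_) (fun lam h f hf => ?_) t ht f hf
    · rw [nonneg_iff]
      filter_upwards [ae_weightMeasure_iff.1 (Lp.coeFn_smul c f), (nonneg_iff f).1 hf] with x h1 h2
      rw [h1, Pi.smul_apply, smul_eq_mul]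
      exact mul_nonneg hc h2
    · rw [hR'eq lam h]
      exact (hR lam h).2.2 f hf

end Generation

/-! ### Embeddings between the weighted spaces -/

section Embedding

variable {p m : ℝ}

theorem weight_le_two_mul (hp : 0 ≤ p) (hpm : p ≤ m) {x : ℝ} (hx : 0 < x) :
    1 + x ^ p ≤ 2 * (1 + x ^ m) := by
  have h0 : 0 ≤ x ^ m := by positivity
  rcases le_total x 1 with h | h
  · have := Real.rpow_le_one hx.le h hp
    linarith
  · have := Real.rpow_le_rpow_of_exponent_le h hpm
    linarith

theorem integrable_weight_of_le {p' : ℝ} {f g : ℝ → ℝ} (hf : AEMeasurable f posVol)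
    (hg : Integrable g (weightMeasure m))
    (hle : ∀ᵐ x ∂posVol, (1 + x ^ p') * |f x| ≤ (1 + x ^ m) * g x) :
    Integrable f (weightMeasure p') ∧
      ∫ x, |f x| ∂weightMeasure p' ≤ ∫ x, g x ∂weightMeasure m := by
  have h1 := integrable_weightMeasure_iff.1 hg
  have h2 : Integrable f (weightMeasure p') := by
    rw [integrable_weightMeasure_iff]
    refine h1.mono' ((measurable_weight p').aemeasurable.mul hf).aestronglyMeasurable ?_
    filter_upwards [hle, ae_pos] with x h3 hx
    rw [norm_mul, Real.norm_of_nonneg (weight_pos p' hx).le]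
    exact h3
  refine ⟨h2, ?_⟩
  rw [integral_weightMeasure, integral_weightMeasure]
  exact integral_mono_ae (integrable_weightMeasure_iff.1 h2.abs) h1 hle

theorem integrable_weight_mono (hp : 0 ≤ p) (hpm : p ≤ m) {f : ℝ → ℝ}
    (hf : Integrable f (weightMeasure m)) :
    Integrable f (weightMeasure p) ∧
      ∫ x, |f x| ∂weightMeasure p ≤ 2 * ∫ x, |f x| ∂weightMeasure m := by
  rw [← integral_const_mul]
  refine integrable_weight_of_le (aestronglyMeasurable_weightMeasure_iff.1 hf.1).aemeasurable
    (hf.abs.const_mul 2) ?_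
  filter_upwards [ae_pos] with x hx
  have h1 := mul_le_mul_of_nonneg_right (weight_le_two_mul hp hpm hx) (abs_nonneg (f x))
  linarith

/-- The continuous embedding of `X m` into `X p` for `p ≤ m`. -/
def embed (hp : 0 ≤ p) (hpm : p ≤ m) : X m →L[ℝ] X p :=
  LinearMap.mkContinuous
    { toFun := fun f => (integrable_weight_mono hp hpm (integrable_coe f)).1.toL1 f
      map_add' := fun f g => by
        rw [← Integrable.toL1_add]
        refine (Integrable.toL1_eq_toL1_iff _ _ _ _).2 (ae_weightMeasure_iff.2 ?_)
        exact ae_weightMeasure_iff.1 (Lp.coeFn_add f g)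
      map_smul' := fun c f => by
        rw [RingHom.id_apply, ← Integrable.toL1_smul]
        refine (Integrable.toL1_eq_toL1_iff _ _ _ _).2 (ae_weightMeasure_iff.2 ?_)
        exact ae_weightMeasure_iff.1 (Lp.coeFn_smul c f) } 2 fun f => by
    have h := integrable_weight_mono hp hpm (integrable_coe f)
    rw [norm_eq_integral f, norm_eq_integral]
    refine le_trans (le_of_eq ?_) h.2
    refine integral_congr_ae ?_
    filter_upwards [h.1.coeFn_toL1] with x hx
    exact congrArg _ hx

theorem embed_ae (hp : 0 ≤ p) (hpm : p ≤ m) (f : X m) :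
    ∀ᵐ x ∂posVol, embed hp hpm f x = f x :=
  coeFn_toL1 (integrable_weight_mono hp hpm (integrable_coe f)).1

theorem exists_embed_eq (hp : 0 ≤ p) (hpm : p ≤ m) {f : X p}
    (hf : Integrable f (weightMeasure m)) : ∃ h : X m, embed hp hpm h = f := by
  refine ⟨hf.toL1 _, ext_posVol ?_⟩
  filter_upwards [embed_ae hp hpm (hf.toL1 _), coeFn_toL1 hf] with x h1 h2
  rw [h1, h2]

theorem integrable_embed (hp : 0 ≤ p) (hpm : p ≤ m) (h : X m) :
    Integrable (embed hp hpm h) (weightMeasure m) :=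
  (integrable_coe h).congr (ae_weightMeasure_iff.2 (by
    filter_upwards [embed_ae hp hpm h] with x hx using hx.symm))

variable {r q a a₁ : ℝ → ℝ} {b : ℝ → ℝ → ℝ}

theorem IsFlux.embed (hp : 0 ≤ p) (hpm : p ≤ m) {f : X m} {F : ℝ → ℝ} (hF : IsFlux r q m f F) :
    IsFlux r q p (GrowthFrag.embed hp hpm f) F := by
  have hae := embed_ae hp hpm f
  refine ⟨?_, hF.absCont, (integrable_weight_mono hp hpm hF.deriv_mem).1, ?_, hF.boundary⟩
  · filter_upwards [hF.ae_eq, hae] with x h1 h2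
    rw [h1, h2]
  · refine (integrable_weight_mono hp hpm hF.absorb_mem).1.congr ?_
    filter_upwards [ae_weightMeasure_iff.2 hae] with x hx
    rw [hx]

theorem graphG.embed (hp : 0 ≤ p) (hpm : p ≤ m) {f g : X m} (h : graphG r a a₁ b m f g) :
    graphG r a a₁ b p (GrowthFrag.embed hp hpm f) (GrowthFrag.embed hp hpm g) := by
  obtain ⟨F, hF, hi, e⟩ := h
  have hf := embed_ae hp hpm f
  have hf' : ∀ᵐ x ∂posVol, f x = GrowthFrag.embed hp hpm f x := by
    filter_upwards [hf] with x hx using hx.symm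
  refine ⟨F, hF.embed hp hpm, ?_, ?_⟩
  · filter_upwards [hi, ae_pos] with x h1 hx
    exact integrableOn_fragOp_congr hf' hx h1
  · filter_upwards [e, hf, embed_ae hp hpm g, ae_pos] with x h1 h2 h3 hx
    have h4 := fragOp_congr (a := a) (b := b) hf hx
    rw [fragOp, fragOp] at h4
    rw [h3, h1, h2, h4]

/-- The operators are given by the same formula, so the embedding carries the graph of G_{0,m} into
that of G_{0,p}; `intertwine` and density of the domain do the rest. -/
theorem embed_semigroup (hp : 0 ≤ p) (hpm : p ≤ m) {S : ℝ → X m →L[ℝ] X m}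
    {S' : ℝ → X p →L[ℝ] X p} (hS : IsSemigroupG r a a₁ b m S) (hS' : IsSemigroupG r a a₁ b p S')
    (hc : TransportCoeff r fun x => a x + a₁ x) {t : ℝ} (ht : 0 ≤ t) (f : X m) :
    embed hp hpm (S t f) = S' t (embed hp hpm f) := by
  refine hS.isC0.intertwine hS'.isC0 (embed hp hpm) (fun f g h => ?_) ?_ ht f
  · exact (hS'.graph_iff _ _).2 (((hS.graph_iff _ _).1 h).embed hp hpm)
  · have : {f : X m | ∃ g, graphGenerator S f g} = domG r a a₁ m := by
      ext f
      exact hS.dom_iff f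
    rw [this]
    exact dense_isFlux hc

end Embedding

/-! ### Gain of moments -/

section Gain

variable {r a a₁ : ℝ → ℝ} {b : ℝ → ℝ → ℝ} {m a₀ γ x₀ : ℝ}

/-- Elements of the domain have additional moments. -/
theorem integrable_of_mem_domG (ha_nonneg : ∀ x : ℝ, 0 < x → 0 ≤ a x)
    (ha₁ : ∀ x : ℝ, 0 < x → 0 ≤ a₁ x) (ha₀ : 0 < a₀) (hγ : 0 < γ)
    (hx₀ : 0 < x₀) (ha_lower : ∀ x : ℝ, x₀ ≤ x → a₀ * x ^ γ ≤ a x) {f : X m}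
    (hf : f ∈ domG r a a₁ m) : Integrable f (weightMeasure (m + γ)) := by
  obtain ⟨F, hF⟩ := hf
  have hq := integrable_absorb_abs (fun x hx => add_nonneg (ha_nonneg x hx) (ha₁ x hx))
    hF.absorb_mem
  refine (integrable_weight_of_le (aemeasurable_coe f)
    (((integrable_coe f).abs.const_mul (1 + x₀ ^ γ)).add (hq.const_mul a₀⁻¹)) ?_).1
  filter_upwards [ae_pos] with x hx
  have h1 := ha_nonneg x hx
  have h2 := ha₁ x hx
  have h3 : x ^ γ ≤ x₀ ^ γ + a₀⁻¹ * (a x + a₁ x) := by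
    rcases le_total x₀ x with h | h
    · have h4 : x ^ γ ≤ a₀⁻¹ * (a x + a₁ x) := by
        rw [inv_mul_eq_div, le_div_iff₀ ha₀]
        linarith [ha_lower x h]
      have : 0 ≤ x₀ ^ γ := by positivity
      linarith
    · have h4 := Real.rpow_le_rpow hx.le h hγ.le
      have : 0 ≤ a₀⁻¹ * (a x + a₁ x) := by positivity
      linarith
  have h5 : 1 + x ^ (m + γ) ≤ (1 + x ^ m) * (1 + x₀ ^ γ + a₀⁻¹ * (a x + a₁ x)) := by
    rw [Real.rpow_add hx]
    have h6 : 0 ≤ x ^ m := by positivity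
    have h7 : 0 ≤ x ^ γ := by positivity
    nlinarith
  have h8 := mul_le_mul_of_nonneg_right h5 (abs_nonneg (f x))
  simp only [Pi.add_apply]
  linarith

theorem integrable_trunc_mul (n : ℕ) {f : ℝ → ℝ} (hf : Integrable f (weightMeasure m)) :
    Integrable (fun x => min (x ^ γ) (n : ℝ) * f x) (weightMeasure m) := by
  refine hf.bdd_mul (c := n) (by fun_prop) ?_
  filter_upwards [ae_weightMeasure_iff.2 ae_pos] with x hx
  rw [Real.norm_of_nonneg (le_min (by positivity) n.cast_nonneg)]
  exact min_le_right _ _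

/-- Integration against the truncated power `min (x ^ γ) n` is a bounded functional. -/
theorem exists_truncMoment (m γ : ℝ) (n : ℕ) :
    ∃ ψ : X m →L[ℝ] ℝ, ∀ f : X m, ψ f = ∫ x, min (x ^ γ) (n : ℝ) * f x ∂weightMeasure m := by
  refine ⟨LinearMap.mkContinuous
    { toFun := fun f => ∫ x, min (x ^ γ) (n : ℝ) * f x ∂weightMeasure m
      map_add' := fun f g => ?_
      map_smul' := fun c f => ?_ } n fun f => ?_, fun f => rfl⟩
  · rw [← integral_add (integrable_trunc_mul n (integrable_coe f))
      (integrable_trunc_mul n (integrable_coe g))]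
    refine integral_congr_ae ?_
    filter_upwards [Lp.coeFn_add f g] with x hx
    rw [hx, Pi.add_apply, mul_add]
  · rw [RingHom.id_apply, smul_eq_mul, ← integral_const_mul]
    refine integral_congr_ae ?_
    filter_upwards [Lp.coeFn_smul c f] with x hx
    rw [hx, Pi.smul_apply, smul_eq_mul]
    ring
  · rw [norm_eq_integral, ← integral_const_mul]
    refine (norm_integral_le_integral_norm _).trans ?_
    refine integral_mono_ae (integrable_trunc_mul n (integrable_coe f)).norm
      ((integrable_coe f).abs.const_mul _) ?_
    filter_upwards [ae_weightMeasure_iff.2 ae_pos] with x hx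
    rw [norm_mul, Real.norm_of_nonneg (le_min (by positivity) n.cast_nonneg), Real.norm_eq_abs]
    gcongr
    exact min_le_right _ _

/-- A nonnegative function whose truncated moments are bounded has a moment of higher order. -/
theorem integrable_of_truncMoment_le {f : X m} (hf : 0 ≤ f) {M : ℝ}
    (hM : ∀ n : ℕ, ∫ x, min (x ^ γ) (n : ℝ) * f x ∂weightMeasure m ≤ M) :
    Integrable f (weightMeasure (m + γ)) := by
  have hf0 := ae_weightMeasure_iff (m := m).2 ((nonneg_iff f).1 hf)
  have hpos := ae_weightMeasure_iff (m := m).2 ae_pos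
  have hmeas : ∀ n : ℕ, AEMeasurable
      (fun x => ENNReal.ofReal (min (x ^ γ) (n : ℝ) * f x)) (weightMeasure m) := fun n =>
    (integrable_trunc_mul n (integrable_coe f)).1.aemeasurable.ennreal_ofReal
  have hlim : ∫⁻ x, ENNReal.ofReal (x ^ γ * f x) ∂weightMeasure m ≤ ENNReal.ofReal M := by
    have h1 : Tendsto (fun n : ℕ => ∫⁻ x, ENNReal.ofReal (min (x ^ γ) (n : ℝ) * f x)
        ∂weightMeasure m) atTop (𝓝 (∫⁻ x, ENNReal.ofReal (x ^ γ * f x) ∂weightMeasure m)) := by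
      refine lintegral_tendsto_of_tendsto_of_monotone hmeas ?_ ?_
      · filter_upwards [hf0] with x hx
        intro n k hnk
        have : (n : ℝ) ≤ k := by exact_mod_cast hnk
        refine ENNReal.ofReal_le_ofReal (mul_le_mul_of_nonneg_right ?_ hx)
        exact min_le_min le_rfl this
      · filter_upwards with x
        refine tendsto_const_nhds.congr' ?_
        obtain ⟨N, hN⟩ := exists_nat_ge (x ^ γ)
        filter_upwards [eventually_ge_atTop N] with n hn
        have : (N : ℝ) ≤ n := by exact_mod_cast hn
        rw [min_eq_left (hN.trans this)]
    refine le_of_tendsto h1 (Eventually.of_forall fun n => ?_)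
    rw [← ofReal_integral_eq_lintegral_ofReal (integrable_trunc_mul n (integrable_coe f))]
    · exact ENNReal.ofReal_le_ofReal (hM n)
    · filter_upwards [hf0, hpos] with x h1 hx
      exact mul_nonneg (le_min (by positivity) n.cast_nonneg) h1
  have hInt : Integrable (fun x => x ^ γ * f x) (weightMeasure m) := by
    refine ⟨AEStronglyMeasurable.mul (by fun_prop) (integrable_coe f).1, ?_⟩
    refine lt_of_le_of_lt (le_trans (le_of_eq ?_) hlim) ENNReal.ofReal_lt_top
    refine lintegral_congr_ae ?_
    filter_upwards [hf0, hpos] with x h1 hx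
    rw [Real.enorm_of_nonneg (mul_nonneg (by positivity) h1)]
  refine (integrable_weight_of_le (aemeasurable_coe f)
    ((integrable_coe f).abs.add hInt.abs) ?_).1
  filter_upwards [ae_pos] with x hx
  have h6 : 0 ≤ x ^ m := by positivity
  have h7 : 0 ≤ x ^ γ := by positivity
  have h5 : 1 + x ^ (m + γ) ≤ (1 + x ^ m) * (1 + x ^ γ) := by
    rw [Real.rpow_add hx]
    nlinarith
  have h8 := mul_le_mul_of_nonneg_right h5 (abs_nonneg (f x))
  simp only [Pi.add_apply]
  rw [abs_mul, abs_of_nonneg h7]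
  linarith

/-- The truncated moments of a function with higher moments are bounded. -/
theorem truncMoment_le (hm : 0 ≤ m) (hγ : 0 < γ) {v : ℝ → ℝ} (hv : Integrable v (weightMeasure m))
    (hv' : Integrable v (weightMeasure (m + γ))) (n : ℕ) :
    ∫ x, min (x ^ γ) (n : ℝ) * v x ∂weightMeasure m ≤
      ∫ x, 2 * |v x| ∂weightMeasure (m + γ) := by
  refine le_trans (le_trans (le_abs_self _) abs_integral_le_integral_abs)
    (integrable_weight_of_le (p' := m) (aestronglyMeasurable_weightMeasure_iff.1
      (integrable_trunc_mul (γ := γ) n hv).1).aemeasurable (hv'.abs.const_mul 2) ?_).2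
  filter_upwards [ae_pos] with x hx
  have h0 : 0 ≤ min (x ^ γ) (n : ℝ) := le_min (by positivity) n.cast_nonneg
  have h1 : (1 + x ^ m) * min (x ^ γ) (n : ℝ) ≤ 2 * (1 + x ^ (m + γ)) := by
    have h2 : (1 + x ^ m) * min (x ^ γ) (n : ℝ) ≤ (1 + x ^ m) * x ^ γ :=
      mul_le_mul_of_nonneg_left (min_le_left _ _) (weight_pos m hx).le
    have h4 : x ^ γ ≤ 1 + x ^ (m + γ) := by
      rcases le_total x 1 with h | h
      · have := Real.rpow_le_one hx.le h hγ.le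
        have : 0 ≤ x ^ (m + γ) := by positivity
        linarith
      · have := Real.rpow_le_rpow_of_exponent_le h (le_add_of_nonneg_left hm : γ ≤ m + γ)
        linarith
    have h6 : (1 + x ^ m) * x ^ γ = x ^ γ + x ^ (m + γ) := by rw [Real.rpow_add hx]; ring
    linarith
  rw [abs_mul, abs_of_nonneg h0]
  have h5 := mul_le_mul_of_nonneg_right h1 (abs_nonneg (v x))
  linarith

/-- Orbits of nonnegative data gain moments at some arbitrarily small time. -/
theorem exists_time_integrable (ha_nonneg : ∀ x : ℝ, 0 < x → 0 ≤ a x)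
    (ha₁ : ∀ x : ℝ, 0 < x → 0 ≤ a₁ x) (ha₀ : 0 < a₀) (hγ : 0 < γ)
    (hx₀ : 0 < x₀) (ha_lower : ∀ x : ℝ, x₀ ≤ x → a₀ * x ^ γ ≤ a x) (hm : 0 ≤ m)
    {S : ℝ → X m →L[ℝ] X m} (hS : IsSemigroupG r a a₁ b m S)
    (hpos : ∀ t, 0 ≤ t → ∀ f, 0 ≤ f → 0 ≤ S t f) {f : X m} (hf : 0 ≤ f) {t : ℝ} (ht : 0 < t) :
    ∃ s ∈ Ioc 0 t, Integrable (S s f) (weightMeasure (m + γ)) := by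
  -- v lies in the domain for any f, hence has γ extra moments. The moment of order m + γ is not a
  -- bounded functional on `X m`, so it is truncated at level n in order to commute with the time
  -- integral.
  set v : X m := ∫ s in (0 : ℝ)..t, S s f with hv
  have hvdom : v ∈ domG r a a₁ m :=
    (hS.dom_iff v).1 ⟨_, hS.isC0.graphGenerator_integral f ht.le⟩
  have hvint := integrable_of_mem_domG ha_nonneg ha₁ ha₀ hγ hx₀ ha_lower hvdom
  choose ψ hψ using exists_truncMoment m γ
  set K := ∫ x, 2 * |v x| ∂weightMeasure (m + γ) with hK
  have hSpos : ∀ s ∈ Ioc 0 t, 0 ≤ S s f := fun s hs => hpos s hs.1.le f hf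
  have hψmono : ∀ s ∈ Ioc 0 t, Monotone fun n => ψ n (S s f) := by
    intro s hs n k hnk
    simp only [hψ]
    refine integral_mono_ae (integrable_trunc_mul n (integrable_coe _))
      (integrable_trunc_mul k (integrable_coe _)) ?_
    filter_upwards [ae_weightMeasure_iff.2 ((nonneg_iff _).1 (hSpos s hs))] with x hx
    have : (n : ℝ) ≤ k := by exact_mod_cast hnk
    exact mul_le_mul_of_nonneg_right (min_le_min le_rfl this) hx
  have hψ0 : ∀ n, ∀ s ∈ Ioc 0 t, 0 ≤ ψ n (S s f) := by
    intro n s hs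
    rw [hψ]
    refine integral_nonneg_of_ae ?_
    filter_upwards [ae_weightMeasure_iff.2 ((nonneg_iff _).1 (hSpos s hs)),
      ae_weightMeasure_iff.2 ae_pos] with x h1 hx
    exact mul_nonneg (le_min (by positivity) n.cast_nonneg) h1
  have hψint : ∀ n, IntegrableOn (fun s => ψ n (S s f)) (Ioc 0 t) := by
    intro n
    have h1 : ContinuousOn (fun s => ψ n (S s f)) (Icc 0 t) :=
      (ψ n).continuous.comp_continuousOn ((hS.isC0.continuousOn_apply f).mono fun s hs => hs.1)
    exact h1.integrableOn_Icc.mono_set Ioc_subset_Icc_self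
  have hbd : ∀ n, ∫⁻ s in Ioc 0 t, ENNReal.ofReal (ψ n (S s f)) ≤ ENNReal.ofReal K := by
    intro n
    rw [← ofReal_integral_eq_lintegral_ofReal (hψint n)]
    · refine ENNReal.ofReal_le_ofReal ?_
      rw [← intervalIntegral.integral_of_le ht.le, ContinuousLinearMap.intervalIntegral_comp_comm _
        (hS.isC0.intervalIntegrable_apply f le_rfl ht.le), ← hv, hψ]
      exact truncMoment_le hm hγ (integrable_coe v) hvint n
    · filter_upwards [ae_restrict_mem measurableSet_Ioc] with s hs using hψ0 n s hs
  -- The bound K is uniform in n, so monotone convergence makes the untruncated moment of S(s)f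
  -- finite for almost every s.
  have hsup : ∫⁻ s in Ioc 0 t, ⨆ n, ENNReal.ofReal (ψ n (S s f)) ≤ ENNReal.ofReal K := by
    rw [lintegral_iSup' (fun n => (hψint n).1.aemeasurable.ennreal_ofReal)]
    · exact iSup_le hbd
    · filter_upwards [ae_restrict_mem measurableSet_Ioc] with s hs n k hnk
      exact ENNReal.ofReal_le_ofReal (hψmono s hs hnk)
  have hfin : ∀ᵐ s ∂volume.restrict (Ioc 0 t), ⨆ n, ENNReal.ofReal (ψ n (S s f)) < ⊤ :=
    ae_lt_top' (AEMeasurable.iSup fun n => (hψint n).1.aemeasurable.ennreal_ofReal)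
      (hsup.trans_lt ENNReal.ofReal_lt_top).ne
  have hne : (ae (volume.restrict (Ioc 0 t))).NeBot := by
    rw [ae_neBot, Ne, Measure.restrict_eq_zero]
    simp [ht]
  obtain ⟨s, hs1, hs⟩ := (hfin.and (ae_restrict_mem measurableSet_Ioc)).exists
  refine ⟨s, hs, integrable_of_truncMoment_le (hSpos s hs)
    (M := (⨆ n, ENNReal.ofReal (ψ n (S s f))).toReal) fun n => ?_⟩
  rw [← hψ, ← ENNReal.ofReal_le_iff_le_toReal hs1.ne]
  exact le_iSup (fun n => ENNReal.ofReal (ψ n (S s f))) n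

/-- The semigroup maps `X m` into `X (m + γ)` for positive times. -/
theorem integrable_semigroup (hc : TransportCoeff r fun x => a x + a₁ x)
    (ha_nonneg : ∀ x : ℝ, 0 < x → 0 ≤ a x)
    (ha₁ : ∀ x : ℝ, 0 < x → 0 ≤ a₁ x) (ha₀ : 0 < a₀) (hγ : 0 < γ)
    (hx₀ : 0 < x₀) (ha_lower : ∀ x : ℝ, x₀ ≤ x → a₀ * x ^ γ ≤ a x) (hm : 0 ≤ m)
    {S : ℝ → X m →L[ℝ] X m} (hS : IsSemigroupG r a a₁ b m S)
    (hpos : ∀ t, 0 ≤ t → ∀ f, 0 ≤ f → 0 ≤ S t f)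
    {S' : ℝ → X (m + γ) →L[ℝ] X (m + γ)} (hS' : IsSemigroupG r a a₁ b (m + γ) S')
    (f : X m) {t : ℝ} (ht : 0 < t) : Integrable (S t f) (weightMeasure (m + γ)) := by
  have hle : m ≤ m + γ := by linarith
  -- Once S(s)f is in X_{0,m+γ} it stays there, since S(t)f = S(t-s)S(s)f is the embedding of an
  -- orbit of S'. General f is split into positive and negative parts.
  have key : ∀ f : X m, 0 ≤ f → Integrable (S t f) (weightMeasure (m + γ)) := by
    intro f hf
    obtain ⟨s, hs, hInt⟩ :=
      exists_time_integrable ha_nonneg ha₁ ha₀ hγ hx₀ ha_lower hm hS hpos hf ht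
    obtain ⟨h, hh⟩ := exists_embed_eq hm hle hInt
    have h1 := embed_semigroup hm hle hS' hS hc (sub_nonneg.2 hs.2) h
    rw [hh, ← hS.isC0.apply_add (sub_nonneg.2 hs.2) hs.1.le, sub_add_cancel] at h1
    rw [← h1]
    exact integrable_embed hm hle _
  have hsplit : S t f = S t f⁺ - S t f⁻ := by rw [← map_sub, posPart_sub_negPart]
  rw [hsplit]
  refine ((key _ (posPart_nonneg f)).sub (key _ (negPart_nonneg f))).congr ?_
  refine ae_weightMeasure_iff.2 ?_
  filter_upwards [ae_weightMeasure_iff.1 (Lp.coeFn_sub (S t f⁺) (S t f⁻))] with x hx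
  rw [hx]

end Gain


/-! ### Regularization and classical solutions -/

section Regularization

/-- An orbit that lies in the domain of the generator for positive times is a classical solution. -/
theorem IsC0Semigroup.classicalSolution {E : Type*} [NormedAddCommGroup E] [NormedSpace ℝ E]
    [CompleteSpace E] {S : ℝ → E →L[ℝ] E} (hS : IsC0Semigroup S) {A : E → E → Prop}
    (hA : ∀ f g, graphGenerator S f g → A f g) {f₀ : E}
    (hdom : ∀ t, 0 < t → ∃ g, graphGenerator S (S t f₀) g) :
    IsClassicalSolution A f₀ fun t => S t f₀ := by
  -- The orbit is restarted at a time s > 0, where it is in the domain; s = t/2 is used below.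
  have key : ∀ s, 0 < s → ∀ k, graphGenerator S (S s f₀) k → ∀ t, s < t →
      HasDerivAt (fun τ => S τ f₀) (S (t - s) k) t := by
    intro s hs k hk t hst
    refine ((hS.hasDerivAt_apply hk (sub_pos.2 hst)).comp_sub_const t s).congr_of_eventuallyEq ?_
    filter_upwards [lt_mem_nhds hst] with τ hτ
    rw [← hS.apply_add (sub_pos.2 hτ).le hs.le, sub_add_cancel]
  have half : ∀ t : ℝ, 0 < t → 0 < t / 2 ∧ t / 2 < t := fun t ht => ⟨half_pos ht, half_lt_self ht⟩
  refine ⟨hS.apply_zero f₀, hS.continuousOn_apply f₀, fun t ht => ?_, fun t ht => ?_,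
    fun t ht => ?_⟩
  · obtain ⟨k, hk⟩ := hdom _ (half t ht).1
    exact (key _ (half t ht).1 k hk t (half t ht).2).differentiableAt
  · obtain ⟨hs, hst⟩ := half t ht
    obtain ⟨k, hk⟩ := hdom _ hs
    have hcont : ContinuousAt (fun τ => S (τ - t / 2) k) t :=
      ContinuousAt.comp (f := fun τ => τ - t / 2) (g := fun τ => S τ k)
        ((hS.continuousOn_apply k).continuousAt (Ici_mem_nhds (sub_pos.2 hst)))
        (continuous_id.sub continuous_const).continuousAt
    refine (hcont.congr ?_).continuousWithinAt
    filter_upwards [lt_mem_nhds hst] with τ hτ using (key _ hs k hk τ hτ).deriv.symm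
  · obtain ⟨hs, hst⟩ := half t ht
    obtain ⟨k, hk⟩ := hdom _ hs
    have h := hS.graphGenerator_apply hk (sub_pos.2 hst).le
    rw [← hS.apply_add (sub_pos.2 hst).le hs.le, sub_add_cancel] at h
    rw [(key _ hs k hk t hst).deriv]
    exact hA _ _ h

variable {r a a₁ : ℝ → ℝ} {b : ℝ → ℝ → ℝ} {l : ℝ}

/-- The growth–fragmentation operators have resolvents and generate positive semigroups. -/
def GeneratesPositive (r a a₁ : ℝ → ℝ) (b : ℝ → ℝ → ℝ) (m : ℝ) : Prop :=
  (∃ lam₀ : ℝ, ∀ lam, lam₀ < lam → ∃ R : X m →L[ℝ] X m,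
    ∀ f g, graphG r a a₁ b m f g ↔ R (lam • f - g) = f) ∧
  ∃ S : ℝ → X m →L[ℝ] X m, IsSemigroupG r a a₁ b m S ∧ ∀ t, 0 ≤ t → ∀ f, 0 ≤ f → 0 ≤ S t f

/-- For positive times the semigroup produces moments of every order. -/
theorem IsSemigroupG.integrable_of_le (hc : TransportCoeff r fun x => a x + a₁ x)
    (hG : ∀ m, max 1 l < m → GeneratesPositive r a a₁ b m)
    (ha_nonneg : ∀ x : ℝ, 0 < x → 0 ≤ a x) (ha₁ : ∀ x : ℝ, 0 < x → 0 ≤ a₁ x)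
    {a₀ γ x₀ : ℝ} (ha₀ : 0 < a₀) (hγ : 0 < γ)
    (hx₀ : 0 < x₀) (ha_lower : ∀ x : ℝ, x₀ ≤ x → a₀ * x ^ γ ≤ a x) {p : ℝ} (hp : max 1 l < p)
    {S : ℝ → X p →L[ℝ] X p} (hS : IsSemigroupG r a a₁ b p S) (m : ℝ) (hm : 0 ≤ m) (f : X p)
    {t : ℝ} (ht : 0 < t) : Integrable (S t f) (weightMeasure m) := by
  have hp0 : 0 ≤ p := by linarith [(le_max_left 1 l).trans_lt hp]
  -- Each gain of γ costs half of the available time, which is harmless because t > 0 is arbitrary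
  -- in the induction hypothesis.
  have key : ∀ k : ℕ, ∀ t, 0 < t → Integrable (S t f) (weightMeasure (p + k * γ)) := by
    intro k
    induction k with
    | zero =>
      intro t _
      rw [Nat.cast_zero, zero_mul, add_zero]
      exact integrable_coe _
    | succ k ih =>
      intro t ht
      set p' := p + k * γ with hp'
      have hkγ : 0 ≤ k * γ := by positivity
      have hpp' : p ≤ p' := by linarith
      obtain ⟨-, S₁, hS₁, hpos₁⟩ := hG p' (by linarith)
      obtain ⟨-, S₂, hS₂, -⟩ := hG (p' + γ) (by linarith)
      obtain ⟨h, hh⟩ := exists_embed_eq hp0 hpp' (ih (t / 2) (by positivity))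
      have h1 := embed_semigroup hp0 hpp' hS₁ hS hc (t := t / 2) (by positivity) h
      rw [hh, ← hS.isC0.apply_add (by positivity) (by positivity), add_halves] at h1
      have h2 := integrable_semigroup hc ha_nonneg ha₁ ha₀ hγ hx₀ ha_lower (hp0.trans hpp') hS₁
        hpos₁ hS₂ h (t := t / 2) (by positivity)
      have h3 : p + (k + 1 : ℕ) * γ = p' + γ := by rw [hp']; push_cast; ring
      rw [h3, ← h1]
      refine h2.congr (ae_weightMeasure_iff.2 ?_)
      filter_upwards [embed_ae hp0 hpp' (S₁ (t / 2) h)] with x hx using hx.symm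
  obtain ⟨k, hk⟩ := exists_nat_ge ((m - p) / γ)
  rw [div_le_iff₀ hγ] at hk
  exact (integrable_weight_mono hm (by linarith) (key k t ht)).1

/-- For positive times the semigroup maps the domain in `X p` into the domain in `X m`. -/
theorem IsSemigroupG.exists_mem_domG (hc : TransportCoeff r fun x => a x + a₁ x)
    (hG : ∀ m, max 1 l < m → GeneratesPositive r a a₁ b m)
    (ha_nonneg : ∀ x : ℝ, 0 < x → 0 ≤ a x) (ha₁ : ∀ x : ℝ, 0 < x → 0 ≤ a₁ x)
    {a₀ γ x₀ : ℝ} (ha₀ : 0 < a₀) (hγ : 0 < γ)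
    (hx₀ : 0 < x₀) (ha_lower : ∀ x : ℝ, x₀ ≤ x → a₀ * x ^ γ ≤ a x) {p m : ℝ}
    (hp : max 1 l < p) (hp0 : 0 ≤ p) (hpm : p ≤ m) {S : ℝ → X p →L[ℝ] X p}
    (hS : IsSemigroupG r a a₁ b p S) {t : ℝ} (ht : 0 < t) {f : X p} (hf : f ∈ domG r a a₁ p) :
    ∃ g ∈ domG r a a₁ m, embed hp0 hpm g = S t f := by
  obtain ⟨k, hk⟩ := (hS.dom_iff f).2 hf
  have hInt : ∀ h : X p, ∃ h' : X m, embed hp0 hpm h' = S t h := fun h =>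
    exists_embed_eq hp0 hpm (hS.integrable_of_le hc hG ha_nonneg ha₁ ha₀ hγ hx₀ ha_lower hp m
      (hp0.trans hpm) h ht)
  obtain ⟨u, hu⟩ := hInt f
  obtain ⟨g, hg⟩ := hInt k
  have hgr : graphG r a a₁ b p (S t f) (S t k) :=
    (hS.graph_iff _ _).1 (hS.isC0.graphGenerator_apply hk ht.le)
  obtain ⟨⟨lam₁, h₁⟩, -⟩ := hG p hp
  obtain ⟨⟨lam₂, h₂⟩, -⟩ := hG m (hp.trans_le hpm)
  set lam := max lam₁ lam₂ + 1 with hlam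
  obtain ⟨R₁, hR₁⟩ := h₁ lam (by linarith [le_max_left lam₁ lam₂])
  obtain ⟨R₂, hR₂⟩ := h₂ lam (by linarith [le_max_right lam₁ lam₂])
  -- u and g represent S(t)f and G_{0,p}S(t)f in X_{0,m}. Solving (λ - G_{0,m})v = λu - g there
  -- gives a member of D(G_{0,m}); its embedding solves the same equation as S(t)f in X_{0,p}, where
  -- `R₁` gives uniqueness.
  set v := R₂ (lam • u - g) with hv
  have hvG : graphG r a a₁ b m v (lam • v - (lam • u - g)) := by
    rw [hR₂, sub_sub_cancel]
  refine ⟨v, ⟨hvG.choose, hvG.choose_spec.1⟩, ?_⟩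
  have h3 := (hR₁ _ _).1 (hvG.embed hp0 hpm)
  have h4 := (hR₁ _ _).1 hgr
  have h5 : lam • embed hp0 hpm v - embed hp0 hpm (lam • v - (lam • u - g)) =
      lam • S t f - S t k := by
    rw [← hu, ← hg]
    simp only [map_sub, map_smul, sub_sub_cancel]
  rw [← h3, h5, h4]

end Regularization

end

end GrowthFrag

theorem mainTheorem4
    (r a a₁ : ℝ → ℝ) (b : ℝ → ℝ → ℝ) (r₀ r₁ b₀ l a₀ γ₀ x₀ : ℝ)
    -- fragmentation rate
    (ha_nonneg : ∀ x : ℝ, 0 < x → 0 ≤ a x)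
    (ha_loc : GrowthFrag.MemLinftyLoc a)
    (ha₀ : 0 < a₀) (hγ₀ : 0 < γ₀) (hx₀ : 0 < x₀)
    (ha_lower : ∀ x : ℝ, x₀ ≤ x → a₀ * x ^ γ₀ ≤ a x)
    -- growth rate
    (hr_loc : MeasureTheory.LocallyIntegrableOn (fun x => 1 / r x) (Set.Ioi 0))
    (hr₀ : 0 ≤ r₀) (hr₁ : 0 ≤ r₁)
    (hr_pos : ∀ x : ℝ, 0 < x → 0 < r x)
    (hr_le : ∀ x : ℝ, 0 < x → r x ≤ r₀ + r₁ * x)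
    -- additional absorption rate
    (ha₁_nonneg : ∀ x : ℝ, 0 < x → 0 ≤ a₁ x)
    (ha₁_loc : GrowthFrag.MemLinftyLoc a₁)
    (ha₁_bdd : ∃ M : ℝ, ∀ᶠ x in Filter.atTop, a₁ x / a x ≤ M)
    -- fragmentation kernel
    (hb_meas : Measurable (Function.uncurry b))
    (hb_nonneg : ∀ x y : ℝ, 0 < x → 0 < y → 0 ≤ b x y)
    (hb_zero : ∀ x y : ℝ, 0 < y → y < x → b x y = 0)
    (hb_mass : ∀ y : ℝ, 0 < y → GrowthFrag.fragMoment b 1 y = y)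
    (hb₀ : 0 < b₀) (hl : 0 ≤ l)
    (hb_number : ∀ y : ℝ, 0 < y →
      MeasureTheory.IntegrableOn (fun x => b x y) (Set.Ioc 0 y) ∧
        GrowthFrag.fragMoment b 0 y ≤ b₀ * (1 + y ^ l))
    (hb_liminf : ∃ m₀ : ℝ, 1 < m₀ ∧
      0 < Filter.liminf (fun y : ℝ => GrowthFrag.fragDefect b m₀ y / y ^ m₀) Filter.atTop) :
    -- `G_{0,m}` generates a strongly continuous semigroup on `X_{0,m}`
    (∀ m : ℝ, max 1 l < m →
      ∃ S : ℝ → GrowthFrag.X m →L[ℝ] GrowthFrag.X m, GrowthFrag.IsSemigroupG r a a₁ b m S) ∧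
    -- `S_{G_{0,p}}(t)` maps `D(G_{0,p})` into `D(G_{0,m})`
    (∀ p m : ℝ, max 1 l < p → p < m →
      ∀ S : ℝ → GrowthFrag.X p →L[ℝ] GrowthFrag.X p, GrowthFrag.IsSemigroupG r a a₁ b p S →
        ∀ t : ℝ, 0 < t → ∀ f ∈ GrowthFrag.domG r a a₁ p,
          ∃ g ∈ GrowthFrag.domG r a a₁ m, ∀ᵐ x ∂GrowthFrag.posVol, g x = S t f x) ∧
    -- classical solutions in `X_{0,m}` for initial data in `X_{0,m} ∩ D(G_{0,p})`
    (∀ p m : ℝ, max 1 l < p → max 1 l < m →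
      ∀ f₀ : GrowthFrag.X m,
        (∃ g ∈ GrowthFrag.domG r a a₁ p, ∀ᵐ x ∂GrowthFrag.posVol, g x = f₀ x) →
        ∃ u : ℝ → GrowthFrag.X m,
          GrowthFrag.IsClassicalSolution (GrowthFrag.graphG r a a₁ b m) f₀ u) := by
  have hc : GrowthFrag.TransportCoeff r fun x => a x + a₁ x := by
    refine ⟨hr_pos, hr_loc, ⟨r₀, r₁, hr₀, hr₁, hr_le⟩,
      fun x hx => add_nonneg (ha_nonneg x hx) (ha₁_nonneg x hx),
      ha_loc.1.add ha₁_loc.1, fun ρ => ?_⟩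
    obtain ⟨C, hC⟩ := ha_loc.2 ρ
    obtain ⟨C', hC'⟩ := ha₁_loc.2 ρ
    refine ⟨C + C', ?_⟩
    filter_upwards [hC, hC'] with x h1 h2
    exact (abs_add_le _ _).trans (add_le_add h1 h2)
  have hG : ∀ m, max 1 l < m → GrowthFrag.GeneratesPositive r a a₁ b m := by
    intro m hm
    obtain ⟨κ, D, hκ, hκ1, hD, hb⟩ := GrowthFrag.exists_fragBound hb_meas hb_nonneg hb_mass
      (fun y hy => (hb_number y hy).1) ha_nonneg ha_loc hb₀ hl (fun y hy => (hb_number y hy).2)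
      hb_liminf hm
    exact GrowthFrag.exists_semigroupG hc hb hκ hκ1 hD ha₁_nonneg ((le_max_left _ _).trans_lt hm)
  have hone : ∀ m, max 1 l < m → 0 ≤ m := fun m hm => by
    linarith [(le_max_left 1 l).trans_lt hm]
  refine ⟨fun m hm => (hG m hm).2.imp fun S hS => hS.1, ?_, ?_⟩
  · intro p m hp hpm S hS t ht f hf
    obtain ⟨g, hg, heq⟩ := hS.exists_mem_domG hc hG ha_nonneg ha₁_nonneg ha₀ hγ₀ hx₀ ha_lower hp
      (hone p hp) hpm.le ht hf
    refine ⟨g, hg, ?_⟩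
    rw [← heq]
    filter_upwards [GrowthFrag.embed_ae (hone p hp) hpm.le g] with x hx using hx.symm
  · rintro p m hp hm f₀ ⟨g, hg, hgf⟩
    obtain ⟨-, S, hS, -⟩ := hG m hm
    have hdom : ∀ t, 0 < t → S t f₀ ∈ GrowthFrag.domG r a a₁ m := by
      intro t ht
      -- If p ≤ m, the orbit in X_{0,m} is also the orbit of S' in X_{0,p}, to which the
      -- regularization applies. If m ≤ p, D(G_{0,p}) embeds in D(G_{0,m}), which the semigroup
      -- leaves invariant.
      rcases le_total p m with hpm | hpm
      · obtain ⟨-, S', hS', -⟩ := hG p hp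
        obtain ⟨h, hh, heq⟩ := hS'.exists_mem_domG hc hG ha_nonneg ha₁_nonneg ha₀ hγ₀ hx₀ ha_lower
          hp (hone p hp) hpm ht hg
        have h1 : GrowthFrag.embed (hone p hp) hpm f₀ = g := by
          refine GrowthFrag.ext_posVol ?_
          filter_upwards [GrowthFrag.embed_ae (hone p hp) hpm f₀, hgf] with x h2 h3
          rw [h2, h3]
        have h2 := GrowthFrag.embed_semigroup (hone p hp) hpm hS hS' hc ht.le f₀
        rw [h1, ← heq] at h2
        have h3 : S t f₀ = h := by
          refine GrowthFrag.ext_posVol ?_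
          filter_upwards [GrowthFrag.embed_ae (hone p hp) hpm (S t f₀),
            GrowthFrag.embed_ae (hone p hp) hpm h] with x h4 h5
          rw [← h4, h2, h5]
        rwa [h3]
      · have h1 : GrowthFrag.embed (hone m hm) hpm g = f₀ := by
          refine GrowthFrag.ext_posVol ?_
          filter_upwards [GrowthFrag.embed_ae (hone m hm) hpm g, hgf] with x h2 h3
          rw [h2, h3]
        obtain ⟨F, hF⟩ := hg
        have h2 : f₀ ∈ GrowthFrag.domG r a a₁ m := h1 ▸ ⟨F, hF.embed (hone m hm) hpm⟩
        obtain ⟨k, hk⟩ := (hS.dom_iff f₀).2 h2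
        exact (hS.dom_iff _).1 ⟨_, hS.isC0.graphGenerator_apply hk ht.le⟩
    exact ⟨fun t => S t f₀, hS.isC0.classicalSolution (fun f g => (hS.graph_iff f g).1)
      fun t ht => (hS.dom_iff _).2 (hdom t ht)⟩
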